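/- Let $\mathcal D_z$ be a fixed sub-Gaussian probability distribution on $\mathbb R$ (its mean $\mu$ need not be zero; sub-Gaussian means that for some $c\ge 0$, $\mathbb E\,e^{t(z-\mu)}\le e^{ct^2/2}$ for all $t\in\mathbb R$ when $z\sim\mathcal D_z$), and let $\lambda>0$, $\gamma>0$ and $\alpha,\sigma_\varepsilon\in\mathbb R$ be fixed. Let $n,d\to\infty$ along a sequence with $d/n\to\gamma$, and for each pair $(n,d)$ in the sequence let $A\in\mathbb R^{n\times n}$ and $B\in\mathbb R^{d\times d}$ be arbitrary deterministic matrices. Let $Z\in\mathbb R^{n\times d}$ have i.i.d. entries with law $\mathcal D_z$, let $G\in\mathbb R^{n\times d}$ have i.i.d. Gaussian entries with the same mean and variance as $\mathcal D_z$, and let $\beta_\star\sim\mathsf N(0,\tfrac{\alpha^2}{d}I_d)$ and $\varepsilon\sim\mathsf N(0,\sigma_\varepsilon^2 I_n)$, where $Z,\beta_\star,\varepsilon$ are mutually independent and $G,\beta_\star,\varepsilon$ are mutually independent (nothing is assumed on the joint law of $Z$ and $G$). Put $X=AZB$, $y=X\beta_\star+\varepsilon$, $\tilde X=AGB$, $\tilde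 y=\tilde X\beta_\star+\varepsilon$, and consider the ridge estimators $$\hat\beta=(X^\top X+\lambda n I_d)^{-1}X^\top y,\qquad \tilde\beta=(\tilde X^\top\tilde X+\lambda n I_d)^{-1}\tilde X^\top\tilde y,$$ with estimation errors $R(\hat\beta)=\|\hat\beta-\beta_\star\|_2^2$ and $R(\tilde\beta)=\|\tilde\beta-\beta_\star\|_2^2$. Then $|R(\hat\beta)-R(\tilde\beta)|\to 0$ with probability $1-o(1)$; that is, for every $\eta>0$, $$\mathbb P\big(|R(\hat\beta)-R(\tilde\beta)|\le\eta\big)\to 1 .$$ -/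

import Mathlib

open MeasureTheory ProbabilityTheory Filter Topology
open scoped Matrix

noncomputable section

/-- A probability law `D` on the real line is sub-Gaussian: the centred variable `z - E z`, with
`z ~ D`, has a sub-Gaussian moment generating function for some variance proxy `c`. The mean
itself may be nonzero. -/
def IsSubGaussianLaw (D : Measure ℝ) : Prop :=
  ∃ c : NNReal, HasSubgaussianMGF (fun z : ℝ => z - ∫ x, x ∂D) c D

/-- The Gaussian law on the real line with the same mean and variance as `D`. -/
def matchingGaussian (D : Measure ℝ) : Measure ℝ :=
  gaussianReal (∫ x, x ∂D) (Real.toNNReal (variance (fun z : ℝ => z) D))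

/-- Law of an `n × d` array (the entries of a random matrix) that is i.i.d. with law `D`. -/
def iidMatrixLaw (D : Measure ℝ) (n d : ℕ) : Measure (Fin n → Fin d → ℝ) :=
  Measure.pi fun _ : Fin n => Measure.pi fun _ : Fin d => D

/-- The law `N(0, (α² / d) I_d)` of the coefficient vector. -/
def coefficientLaw (α : ℝ) (d : ℕ) : Measure (Fin d → ℝ) :=
  Measure.pi fun _ : Fin d => gaussianReal 0 (Real.toNNReal (α ^ 2 / d))

/-- The law `N(0, σ² I_n)` of the noise vector. -/
def noiseLaw (σ : ℝ) (n : ℕ) : Measure (Fin n → ℝ) :=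
  Measure.pi fun _ : Fin n => gaussianReal 0 (Real.toNNReal (σ ^ 2))

/-- Joint law of `(W, β, ε)` when the array `W` has i.i.d. entries with law `D`, the coefficient
vector is `β ~ N(0, (α² / d) I_d)`, the noise is `ε ~ N(0, σ² I_n)`, and `W`, `β`, `ε` are
mutually independent. -/
def modelLaw (D : Measure ℝ) (α σ : ℝ) (n d : ℕ) :
    Measure ((Fin n → Fin d → ℝ) × (Fin d → ℝ) × (Fin n → ℝ)) :=
  (iidMatrixLaw D n d).prod ((coefficientLaw α d).prod (noiseLaw σ n))

/-- The ridge estimator `(XᵀX + lam n I_d)⁻¹ Xᵀ y` from the data set `(X, y)`. -/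
def ridge {n d : ℕ} (lam : ℝ) (X : Matrix (Fin n) (Fin d) ℝ) (y : Fin n → ℝ) : Fin d → ℝ :=
  (Xᵀ * X + (lam * (n : ℝ)) • (1 : Matrix (Fin d) (Fin d) ℝ))⁻¹ *ᵥ (Xᵀ *ᵥ y)

/-- The estimation error `R(b) = ‖b - β‖₂²`, in the Euclidean norm. -/
def estimationError {d : ℕ} (b β : Fin d → ℝ) : ℝ :=
  ‖WithLp.toLp 2 (b - β)‖ ^ 2

/-- The estimation error of ridge regression with covariates `X = A W B`, where `W` is given by
its array of entries, and responses `y = X β + ε`. -/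
def ridgeError {n d : ℕ} (lam : ℝ) (A : Matrix (Fin n) (Fin n) ℝ) (B : Matrix (Fin d) (Fin d) ℝ)
    (W : Fin n → Fin d → ℝ) (β : Fin d → ℝ) (ε : Fin n → ℝ) : ℝ :=
  let X : Matrix (Fin n) (Fin d) ℝ := A * Matrix.of W * B
  estimationError (ridge lam X (X *ᵥ β + ε)) β

end

/-!
Put `Y = (lam n)^(-1/2) A W B` and `Q = (1 + Yᵀ Y)⁻¹`. The estimation error is a quadratic form in
the Gaussian vector `(β, ε)`, so given `W` it concentrates around its conditional mean
`w tr Q² + w' (tr Q - tr Q²)`, where `w = α² / d` and `w' = σ² / (lam n)`. As a function of `t`,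
`tr (1 + t Yᵀ Y)⁻¹` has derivative `tr Q² - tr Q` at `t = 1`, so a difference quotient with a small
fixed step replaces `tr Q²` by traces of resolvents. Changing one row of `W` is a rank-one
perturbation and moves such a trace by at most `1`; by bounded differences the trace concentrates
around its mean.

It remains to compare `E tr Q` between two entry laws with the same mean and variance, with an error
`o(n)` that is uniform in `A` and `B`. Recentring `W` is again a rank-one perturbation, so the laws
may be taken standardized. When `A` and `B` are bounded, replace the entries one at a time: the
third derivatives are controlled because the resolvent is a block of the inverse of `1` plus a skew
matrix that is linear in `W`. For general `A` and `B`, singular values larger than a level `L` are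
truncated after `A` and `B` have been rescaled against each other, and integration by parts in the
entries bounds the cost of the truncation, uniformly in `n`, by a quantity tending to `0` as
`L → ∞`.
-/

section GramResolvent

open Matrix

lemma dotProduct_self_nonneg {p : Type*} [Fintype p] (x : p → ℝ) : 0 ≤ x ⬝ᵥ x :=
  dotProduct_self_star_nonneg x

lemma gram_add_vecMulVec {m p : Type*} [Fintype m] (X : Matrix m p ℝ) {a : m → ℝ}
    (ha : a ⬝ᵥ a = 1) (b : p → ℝ) :
    (X + vecMulVec a b)ᵀ * (X + vecMulVec a b) + vecMulVec (Xᵀ *ᵥ a) (Xᵀ *ᵥ a)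
      = Xᵀ * X + vecMulVec (b + Xᵀ *ᵥ a) (b + Xᵀ *ᵥ a) := by
  rw [transpose_add, transpose_vecMulVec, Matrix.add_mul, Matrix.mul_add, Matrix.mul_add,
    mul_vecMulVec, vecMulVec_mul, ← mulVec_transpose, vecMulVec_mul_vecMulVec, ha, one_smul]
  simp only [vecMulVec_add, add_vecMulVec]
  abel

variable {m p q : Type*} [Fintype m] [Fintype p] [Fintype q] [DecidableEq p]

lemma inv_add_vecMulVec {G : Matrix p p ℝ} (hG : IsUnit G.det) (u v : p → ℝ)
    (h : 1 + v ⬝ᵥ (G⁻¹ *ᵥ u) ≠ 0) :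
    (G + vecMulVec u v)⁻¹
      = G⁻¹ - (1 + v ⬝ᵥ (G⁻¹ *ᵥ u))⁻¹ • vecMulVec (G⁻¹ *ᵥ u) (v ᵥ* G⁻¹) := by
  refine inv_eq_right_inv ?_
  have hcross : vecMulVec u v * vecMulVec (G⁻¹ *ᵥ u) (v ᵥ* G⁻¹)
      = (v ⬝ᵥ (G⁻¹ *ᵥ u)) • vecMulVec u (v ᵥ* G⁻¹) := by
    rw [vecMulVec_mul_vecMulVec, vecMulVec_smul]
  rw [Matrix.add_mul, Matrix.mul_sub, Matrix.mul_sub, mul_nonsing_inv G hG, Matrix.mul_smul,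
    Matrix.mul_smul, hcross,
    mul_vecMulVec, mulVec_mulVec, mul_nonsing_inv G hG, one_mulVec, vecMulVec_mul]
  match_scalars <;> field_simp
  ring

lemma trace_inv_sub_trace_inv_add_vecMulVec {G : Matrix p p ℝ} (hs : G.IsSymm)
    (hG : IsUnit G.det) {w : p → ℝ} (h : 1 + w ⬝ᵥ (G⁻¹ *ᵥ w) ≠ 0) :
    G⁻¹.trace - (G + vecMulVec w w)⁻¹.trace
      = (G⁻¹ *ᵥ w) ⬝ᵥ (G⁻¹ *ᵥ w) / (1 + w ⬝ᵥ (G⁻¹ *ᵥ w)) := by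
  have hinv : w ᵥ* G⁻¹ = G⁻¹ *ᵥ w := by
    rw [← mulVec_transpose, transpose_nonsing_inv, hs.eq]
  rw [inv_add_vecMulVec hG w w h, trace_sub, trace_smul, trace_vecMulVec, hinv, sub_sub_cancel,
    smul_eq_mul, inv_mul_eq_div]

lemma trace_inv_sub_trace_inv_add_vecMulVec_mem_Icc {G : Matrix p p ℝ}
    (hG : (G - 1).PosSemidef) (w : p → ℝ) :
    G⁻¹.trace - (G + vecMulVec w w)⁻¹.trace ∈ Set.Icc 0 1 := by
  have hpos : G.PosDef := by simpa using PosDef.one.add_posSemidef hG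
  have hunit : IsUnit G.det := (isUnit_iff_isUnit_det G).mp hpos.isUnit
  set u := G⁻¹ *ᵥ w with hu
  have hGu : G *ᵥ u = w := by rw [hu, mulVec_mulVec, mul_nonsing_inv G hunit, one_mulVec]
  have huw : u ⬝ᵥ u ≤ w ⬝ᵥ u := by
    have := hG.dotProduct_mulVec_nonneg u
    rw [star_trivial, sub_mulVec, one_mulVec, hGu, dotProduct_sub, dotProduct_comm u w] at this
    linarith
  have hu0 := dotProduct_self_nonneg u
  rw [trace_inv_sub_trace_inv_add_vecMulVec (by simpa using! hpos.isHermitian) hunit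
    (by linarith : 1 + w ⬝ᵥ u ≠ 0)]
  exact ⟨div_nonneg hu0 (by linarith), (div_le_one (by linarith)).mpr (by linarith)⟩

/-- The resolvent `(1 + XᵀX)⁻¹` of the Gram matrix of `X`. The ridge resolvent
`(XᵀX + λn)⁻¹` is `(λn)⁻¹ • gramResolvent ((λn)^(-1/2) • X)`. -/
noncomputable def gramResolvent (X : Matrix m p ℝ) : Matrix p p ℝ := (1 + Xᵀ * X)⁻¹

lemma isUnit_det_one_add_gram (X : Matrix m p ℝ) : IsUnit (1 + Xᵀ * X).det :=
  (isUnit_iff_isUnit_det _).mp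
    (PosDef.one.add_posSemidef (posSemidef_conjTranspose_mul_self X)).isUnit

lemma gramResolvent_mul_one_add_gram (X : Matrix m p ℝ) :
    gramResolvent X * (1 + Xᵀ * X) = 1 :=
  nonsing_inv_mul _ (isUnit_det_one_add_gram X)

lemma one_add_gram_mul_gramResolvent (X : Matrix m p ℝ) :
    (1 + Xᵀ * X) * gramResolvent X = 1 :=
  mul_nonsing_inv _ (isUnit_det_one_add_gram X)

lemma gramResolvent_transpose (X : Matrix m p ℝ) : (gramResolvent X)ᵀ = gramResolvent X := by
  simp only [gramResolvent, transpose_nonsing_inv, transpose_add, transpose_one, transpose_mul,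
    transpose_transpose]

lemma gram_mul_gramResolvent (X : Matrix m p ℝ) :
    Xᵀ * X * gramResolvent X = 1 - gramResolvent X := by
  rw [eq_sub_iff_add_eq', ← one_add_gram_mul_gramResolvent X, Matrix.add_mul, Matrix.one_mul]

lemma gramResolvent_mul_gram (X : Matrix m p ℝ) :
    gramResolvent X * (Xᵀ * X) = 1 - gramResolvent X := by
  rw [eq_sub_iff_add_eq', ← gramResolvent_mul_one_add_gram X, Matrix.mul_add, Matrix.mul_one]

lemma mul_gramResolvent [DecidableEq m] (X : Matrix m p ℝ) :
    X * gramResolvent X = gramResolvent Xᵀ * X := by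
  have hleft := gramResolvent_mul_one_add_gram Xᵀ
  rw [transpose_transpose] at hleft
  calc X * gramResolvent X = gramResolvent Xᵀ * (1 + X * Xᵀ) * (X * gramResolvent X) := by
        rw [hleft, Matrix.one_mul]
    _ = gramResolvent Xᵀ * X * ((1 + Xᵀ * X) * gramResolvent X) := by
        simp only [Matrix.mul_add, Matrix.add_mul, Matrix.mul_assoc, Matrix.one_mul]
    _ = gramResolvent Xᵀ * X := by rw [one_add_gram_mul_gramResolvent, Matrix.mul_one]

lemma transpose_mul_gramResolvent_mul [DecidableEq m] (X : Matrix m p ℝ) :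
    Xᵀ * gramResolvent Xᵀ * X = 1 - gramResolvent X := by
  rw [Matrix.mul_assoc, ← mul_gramResolvent, ← Matrix.mul_assoc, gram_mul_gramResolvent]

lemma trace_gramResolvent_transpose [DecidableEq m] (X : Matrix m p ℝ) :
    (gramResolvent Xᵀ).trace - Fintype.card m = (gramResolvent X).trace - Fintype.card p := by
  have hX := congrArg trace (transpose_mul_gramResolvent_mul X)
  have hXt := congrArg trace (gramResolvent_mul_gram Xᵀ)
  rw [transpose_transpose, ← Matrix.mul_assoc, trace_mul_comm, ← Matrix.mul_assoc, hX, trace_sub,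
    trace_sub, trace_one, trace_one] at hXt
  linarith

lemma dotProduct_one_add_gram_mulVec (X : Matrix m p ℝ) (x y : p → ℝ) :
    x ⬝ᵥ ((1 + Xᵀ * X) *ᵥ y) = x ⬝ᵥ y + (X *ᵥ x) ⬝ᵥ (X *ᵥ y) := by
  rw [add_mulVec, one_mulVec, dotProduct_add, ← mulVec_mulVec, dotProduct_mulVec x Xᵀ,
    vecMul_transpose]

lemma dotProduct_eq_gramResolvent_mulVec (X : Matrix m p ℝ) (b x : p → ℝ) :
    x ⬝ᵥ b = x ⬝ᵥ (gramResolvent X *ᵥ b) + (X *ᵥ x) ⬝ᵥ (X *ᵥ (gramResolvent X *ᵥ b)) := by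
  rw [← dotProduct_one_add_gram_mulVec, mulVec_mulVec, one_add_gram_mul_gramResolvent, one_mulVec]

-- Legendre duality: `b ↦ b · (1 + XᵀX)⁻¹ b` is the conjugate of `x ↦ |x|² + |Xx|²`.
lemma two_mul_dotProduct_sub_le (X : Matrix m p ℝ) (b x : p → ℝ) :
    2 * (x ⬝ᵥ b) - (x ⬝ᵥ x + (X *ᵥ x) ⬝ᵥ (X *ᵥ x)) ≤ (gramResolvent X *ᵥ b) ⬝ᵥ b := by
  set y := gramResolvent X *ᵥ b
  have hxy := dotProduct_self_nonneg (x - y)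
  have hXxy := dotProduct_self_nonneg (X *ᵥ x - X *ᵥ y)
  simp only [sub_dotProduct, dotProduct_sub, dotProduct_comm y x,
    dotProduct_comm (X *ᵥ y) (X *ᵥ x)] at hxy hXxy
  rw [dotProduct_eq_gramResolvent_mulVec X b x, dotProduct_eq_gramResolvent_mulVec X b y]
  linarith

lemma two_mul_apply_sub_le_gramResolvent_diag (X : Matrix m p ℝ) (j : p) (x : p → ℝ) :
    2 * x j - (x ⬝ᵥ x + (X *ᵥ x) ⬝ᵥ (X *ᵥ x)) ≤ gramResolvent X j j := by
  simpa using two_mul_dotProduct_sub_le X (Pi.single j 1) x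

lemma exists_gramResolvent_diag_eq (X : Matrix m p ℝ) (j : p) :
    ∃ x : p → ℝ, gramResolvent X j j = 2 * x j - (x ⬝ᵥ x + (X *ᵥ x) ⬝ᵥ (X *ᵥ x)) := by
  refine ⟨gramResolvent X *ᵥ Pi.single j 1, ?_⟩
  have h := dotProduct_eq_gramResolvent_mulVec X (Pi.single j 1)
    (gramResolvent X *ᵥ Pi.single j 1)
  rw [← h]
  simp only [mulVec_single_one, col_apply, dotProduct_single_one]
  ring

lemma gramResolvent_diag_le_of_forall_exists {X : Matrix m p ℝ} {Y : Matrix q p ℝ} {j : p}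
    (h : ∀ x : p → ℝ, ∃ y : p → ℝ, y j = x j ∧
      y ⬝ᵥ y + (Y *ᵥ y) ⬝ᵥ (Y *ᵥ y) ≤ x ⬝ᵥ x + (X *ᵥ x) ⬝ᵥ (X *ᵥ x)) :
    gramResolvent X j j ≤ gramResolvent Y j j := by
  obtain ⟨x, hx⟩ := exists_gramResolvent_diag_eq X j
  obtain ⟨y, hyj, hyx⟩ := h x
  linarith [two_mul_apply_sub_le_gramResolvent_diag Y j y]

lemma gramResolvent_diag_nonneg (X : Matrix m p ℝ) (j : p) : 0 ≤ gramResolvent X j j := by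
  simpa using two_mul_apply_sub_le_gramResolvent_diag X j 0

lemma gramResolvent_diag_le_one (X : Matrix m p ℝ) (j : p) : gramResolvent X j j ≤ 1 := by
  obtain ⟨x, hx⟩ := exists_gramResolvent_diag_eq X j
  have hxj : x j * x j ≤ x ⬝ᵥ x :=
    Finset.single_le_sum (f := fun i => x i * x i) (fun i _ => mul_self_nonneg _)
      (Finset.mem_univ j)
  nlinarith [dotProduct_self_nonneg (X *ᵥ x), sq_nonneg (x j - 1)]

lemma gramResolvent_diag_eq_one {X : Matrix m p ℝ} {j : p} (h : ∀ i, X i j = 0) :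
    gramResolvent X j j = 1 := by
  refine le_antisymm (gramResolvent_diag_le_one X j) ?_
  have hX : X *ᵥ Pi.single j 1 = 0 := by
    ext i
    simp [h i]
  have := two_mul_apply_sub_le_gramResolvent_diag X j (Pi.single j 1)
  rw [hX] at this
  simp only [Pi.single_eq_same, dotProduct_single_one, dotProduct_zero] at this
  linarith

lemma abs_trace_gramResolvent_le (X : Matrix m p ℝ) :
    |(gramResolvent X).trace| ≤ Fintype.card p := by
  have hnonneg : 0 ≤ (gramResolvent X).trace :=
    Finset.sum_nonneg fun j _ => gramResolvent_diag_nonneg X j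
  rw [abs_of_nonneg hnonneg]
  calc (gramResolvent X).trace ≤ ∑ _j : p, (1 : ℝ) :=
        Finset.sum_le_sum fun j _ => gramResolvent_diag_le_one X j
    _ = Fintype.card p := by simp

lemma abs_trace_gramResolvent_add_vecMulVec_sub_le (X : Matrix m p ℝ) (a : m → ℝ) (b : p → ℝ) :
    |(gramResolvent (X + vecMulVec a b)).trace - (gramResolvent X).trace| ≤ 1 := by
  rcases eq_or_ne a 0 with rfl | ha
  · simp
  wlog hunit : a ⬝ᵥ a = 1 generalizing a b
  · have hpos : 0 < a ⬝ᵥ a :=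
      (dotProduct_self_nonneg a).lt_of_ne' (dotProduct_self_eq_zero.not.mpr ha)
    have hs : √(a ⬝ᵥ a) ≠ 0 := (Real.sqrt_pos.mpr hpos).ne'
    have hab : vecMulVec a b = vecMulVec ((√(a ⬝ᵥ a))⁻¹ • a) (√(a ⬝ᵥ a) • b) := by
      rw [smul_vecMulVec, vecMulVec_smul, smul_smul, inv_mul_cancel₀ hs, one_smul]
    rw [hab]
    refine this _ _ (smul_ne_zero (inv_ne_zero hs) ha) ?_
    rw [smul_dotProduct, dotProduct_smul, smul_smul, smul_eq_mul, ← mul_inv,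
      Real.mul_self_sqrt hpos.le, inv_mul_cancel₀ hpos.ne']
  have hgram (Y : Matrix m p ℝ) : (1 + Yᵀ * Y - 1).PosSemidef := by
    simpa using! posSemidef_conjTranspose_mul_self Y
  have hX := trace_inv_sub_trace_inv_add_vecMulVec_mem_Icc (hgram X) (b + Xᵀ *ᵥ a)
  have hXab := trace_inv_sub_trace_inv_add_vecMulVec_mem_Icc (hgram (X + vecMulVec a b)) (Xᵀ *ᵥ a)
  rw [add_assoc, gram_add_vecMulVec X hunit b, ← add_assoc] at hXab
  rw [gramResolvent, gramResolvent, abs_le]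
  constructor <;> linarith [hX.1, hX.2, hXab.1, hXab.2]

end GramResolvent

section LinearizedResolvent

open Matrix
open scoped Matrix.Norms.L2Operator

/-- The skew-symmetric block matrix with off-diagonal blocks `X` and `-Xᵀ`. It is linear in `X`,
and its square is the block diagonal matrix with blocks `-XXᵀ` and `-XᵀX`. -/
def skewBlock {m p : Type*} (X : Matrix m p ℝ) : Matrix (m ⊕ p) (m ⊕ p) ℝ :=
  fromBlocks 0 X (-Xᵀ) 0

lemma skewBlock_add_smul {m p : Type*} (X E : Matrix m p ℝ) (z : ℝ) :
    skewBlock (X + z • E) = skewBlock X + z • skewBlock E := by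
  simp [skewBlock, fromBlocks_smul, fromBlocks_add, neg_add_rev, add_comm]

variable {m p q : Type*} [Fintype m] [Fintype p] [Fintype q]

lemma dotProduct_skewBlock_mulVec_self (X : Matrix m p ℝ) (v : m ⊕ p → ℝ) :
    v ⬝ᵥ (skewBlock X *ᵥ v) = 0 := by
  have hskew : (skewBlock X)ᵀ = -skewBlock X := by
    simp [skewBlock, fromBlocks_transpose, fromBlocks_neg]
  have hneg : v ⬝ᵥ (skewBlock X *ᵥ v) = -(v ⬝ᵥ (skewBlock X *ᵥ v)) := by
    conv_lhs => rw [dotProduct_mulVec, ← mulVec_transpose, hskew, neg_mulVec, neg_dotProduct,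
      dotProduct_comm]
  exact self_eq_neg.mp hneg

lemma norm_toLp_sq (x : p → ℝ) : ‖WithLp.toLp 2 x‖ ^ 2 = x ⬝ᵥ x := by
  rw [EuclideanSpace.real_norm_sq_eq]
  simp [dotProduct, sq]

section Norm

variable [DecidableEq p]

lemma dotProduct_mulVec_self_le (M : Matrix m p ℝ) (x : p → ℝ) :
    (M *ᵥ x) ⬝ᵥ (M *ᵥ x) ≤ ‖M‖ ^ 2 * (x ⬝ᵥ x) := by
  classical
  rw [← norm_toLp_sq, ← norm_toLp_sq, ← mul_pow]
  exact pow_le_pow_left₀ (norm_nonneg _) (by simpa using l2_opNorm_mulVec M (WithLp.toLp 2 x)) 2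

lemma l2_opNorm_le_of_dotProduct_le {M : Matrix m p ℝ} {c : ℝ} (hc : 0 ≤ c)
    (h : ∀ x, (M *ᵥ x) ⬝ᵥ (M *ᵥ x) ≤ c ^ 2 * (x ⬝ᵥ x)) : ‖M‖ ≤ c := by
  classical
  rw [l2_opNorm_def]
  refine ContinuousLinearMap.opNorm_le_bound _ hc fun x => ?_
  have hx := h (WithLp.ofLp x)
  rw [← norm_toLp_sq, ← norm_toLp_sq, ← mul_pow] at hx
  exact (abs_le_of_sq_le_sq' hx (by positivity)).2

lemma l2_opNorm_le_one_of_transpose_mul_self {M : Matrix m p ℝ}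
    (h : Mᵀ * M = 1) : ‖M‖ ≤ 1 := by
  refine l2_opNorm_le_of_dotProduct_le zero_le_one fun x => ?_
  rw [dotProduct_mulVec, ← mulVec_transpose, mulVec_mulVec, h, one_mulVec, one_pow, one_mul]

lemma sum_sq_apply_le_l2_opNorm_sq (M : Matrix m p ℝ) (j : p) : ∑ i, M i j ^ 2 ≤ ‖M‖ ^ 2 := by
  simpa [dotProduct, sq, Pi.single_apply] using dotProduct_mulVec_self_le M (Pi.single j 1)

lemma abs_apply_le_l2_opNorm (M : Matrix m p ℝ) (i : m) (j : p) : |M i j| ≤ ‖M‖ := by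
  refine abs_le_of_sq_le_sq ?_ (norm_nonneg _)
  exact (Finset.single_le_sum (f := fun i => M i j ^ 2) (fun i _ => sq_nonneg _)
    (Finset.mem_univ i)).trans (sum_sq_apply_le_l2_opNorm_sq M j)

lemma l2_opNorm_transpose [DecidableEq m] (M : Matrix m p ℝ) : ‖Mᵀ‖ = ‖M‖ := by
  rw [← conjTranspose_eq_transpose_of_trivial, l2_opNorm_conjTranspose]

lemma l2_opNorm_mul_le_of_le [DecidableEq q] {M : Matrix m p ℝ} {N : Matrix p q ℝ} {a b : ℝ}
    (hM : ‖M‖ ≤ a) (hN : ‖N‖ ≤ b) : ‖M * N‖ ≤ a * b :=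
  (l2_opNorm_mul M N).trans (mul_le_mul hM hN (norm_nonneg _) ((norm_nonneg _).trans hM))

end Norm

/-- The matrix of the isometric embedding of the first block into the direct sum. -/
def inlMatrix (m p : Type*) [DecidableEq m] : Matrix (m ⊕ p) m ℝ := fromRows 1 0

/-- The matrix of the isometric embedding of the second block into the direct sum. -/
def inrMatrix (m p : Type*) [DecidableEq p] : Matrix (m ⊕ p) p ℝ := fromRows 0 1

lemma norm_inlMatrix_le_one [DecidableEq m] : ‖inlMatrix m p‖ ≤ 1 :=
  l2_opNorm_le_one_of_transpose_mul_self (by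
    simp [inlMatrix, transpose_fromRows, fromCols_mul_fromRows])

lemma norm_inrMatrix_le_one [DecidableEq p] : ‖inrMatrix m p‖ ≤ 1 :=
  l2_opNorm_le_one_of_transpose_mul_self (by
    simp [inrMatrix, transpose_fromRows, fromCols_mul_fromRows])

variable [DecidableEq m] [DecidableEq p]

/-- The resolvent `(1 + skewBlock X)⁻¹`, written out in blocks. It linearizes `gramResolvent X`,
which is its lower right block. -/
noncomputable def skewResolvent (X : Matrix m p ℝ) : Matrix (m ⊕ p) (m ⊕ p) ℝ :=
  fromBlocks (gramResolvent Xᵀ) (-(gramResolvent Xᵀ * X)) (Xᵀ * gramResolvent Xᵀ)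
    (gramResolvent X)

lemma one_add_skewBlock_mul_skewResolvent (X : Matrix m p ℝ) :
    (1 + skewBlock X) * skewResolvent X = 1 := by
  have htop := gram_mul_gramResolvent Xᵀ
  rw [transpose_transpose, Matrix.mul_assoc] at htop
  rw [skewBlock, skewResolvent, ← fromBlocks_one, fromBlocks_add, fromBlocks_multiply]
  simp only [add_zero, zero_add, Matrix.one_mul, Matrix.neg_mul, Matrix.mul_neg, neg_neg]
  congr 1
  · rw [htop, add_sub_cancel]
  · rw [mul_gramResolvent, neg_add_cancel]
  · rw [neg_add_cancel]
  · rw [← Matrix.mul_assoc, transpose_mul_gramResolvent_mul, sub_add_cancel]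

lemma skewResolvent_mul_one_add_skewBlock (X : Matrix m p ℝ) :
    skewResolvent X * (1 + skewBlock X) = 1 :=
  mul_eq_one_comm.mp (one_add_skewBlock_mul_skewResolvent X)

lemma norm_skewResolvent_le_one (X : Matrix m p ℝ) : ‖skewResolvent X‖ ≤ 1 := by
  refine l2_opNorm_le_of_dotProduct_le zero_le_one fun v => ?_
  set w := skewResolvent X *ᵥ v with hw
  have hv : v = w + skewBlock X *ᵥ w := by
    have hinv : (1 + skewBlock X) *ᵥ w = v := by
      rw [hw, mulVec_mulVec, one_add_skewBlock_mul_skewResolvent, one_mulVec]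
    rw [← hinv, add_mulVec, one_mulVec]
  have hpythagoras : v ⬝ᵥ v = w ⬝ᵥ w + (skewBlock X *ᵥ w) ⬝ᵥ (skewBlock X *ᵥ w) := by
    conv_lhs => rw [hv]
    rw [add_dotProduct, dotProduct_add, dotProduct_add, dotProduct_comm (skewBlock X *ᵥ w) w,
      dotProduct_skewBlock_mulVec_self, add_zero, zero_add]
  linarith [dotProduct_self_nonneg (skewBlock X *ᵥ w)]

lemma trace_skewResolvent (X : Matrix m p ℝ) :
    (skewResolvent X).trace = 2 * (gramResolvent X).trace + Fintype.card m - Fintype.card p := by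
  have hblocks : (skewResolvent X).trace = (gramResolvent Xᵀ).trace + (gramResolvent X).trace := by
    simp [skewResolvent, trace, Fintype.sum_sum_type]
  linarith [trace_gramResolvent_transpose X]

section Expansion

variable (X E : Matrix m p ℝ) (z : ℝ)

lemma skewResolvent_add_smul :
    skewResolvent (X + z • E)
      = skewResolvent X - z • (skewResolvent X * skewBlock E * skewResolvent (X + z • E)) := by
  have hR := skewResolvent_mul_one_add_skewBlock X
  have hRz := one_add_skewBlock_mul_skewResolvent (X + z • E)
  rw [skewBlock_add_smul] at hRz
  have hdiff : skewResolvent X - skewResolvent (X + z • E)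
      = skewResolvent X * (z • skewBlock E) * skewResolvent (X + z • E) := by
    calc skewResolvent X - skewResolvent (X + z • E)
        = skewResolvent X * ((1 + (skewBlock X + z • skewBlock E)) * skewResolvent (X + z • E))
          - (skewResolvent X * (1 + skewBlock X)) * skewResolvent (X + z • E) := by
          rw [hR, hRz, Matrix.mul_one, Matrix.one_mul]
      _ = _ := by noncomm_ring
  rw [← Matrix.smul_mul, ← Matrix.mul_smul, ← hdiff, sub_sub_cancel]

lemma skewResolvent_add_smul_two :
    skewResolvent (X + z • E)
      = skewResolvent X - z • (skewResolvent X * skewBlock E * skewResolvent X)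
        + z ^ 2 • (skewResolvent X * skewBlock E * skewResolvent X * skewBlock E
          * skewResolvent (X + z • E)) := by
  conv_lhs => rw [skewResolvent_add_smul, skewResolvent_add_smul]
  simp only [Matrix.mul_sub, smul_sub, Matrix.mul_smul, smul_smul, Matrix.mul_assoc, sq]
  abel

lemma skewResolvent_add_smul_three :
    skewResolvent (X + z • E)
      = skewResolvent X - z • (skewResolvent X * skewBlock E * skewResolvent X)
        + z ^ 2 • (skewResolvent X * skewBlock E * skewResolvent X * skewBlock E
          * skewResolvent X)
        - z ^ 3 • (skewResolvent X * skewBlock E * skewResolvent X * skewBlock E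
          * skewResolvent X * skewBlock E * skewResolvent (X + z • E)) := by
  conv_lhs => rw [skewResolvent_add_smul_two]
  conv_lhs => enter [2]; rw [skewResolvent_add_smul]
  simp only [Matrix.mul_sub, smul_sub, Matrix.mul_smul, smul_smul, Matrix.mul_assoc, pow_succ]
  abel

end Expansion

lemma norm_inlMatrix_transpose_le_one : ‖(inlMatrix m p)ᵀ‖ ≤ 1 :=
  (l2_opNorm_transpose _).trans_le norm_inlMatrix_le_one

lemma norm_inrMatrix_transpose_le_one : ‖(inrMatrix m p)ᵀ‖ ≤ 1 :=
  (l2_opNorm_transpose _).trans_le norm_inrMatrix_le_one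

lemma skewBlock_eq_sub (E : Matrix m p ℝ) :
    skewBlock E
      = inlMatrix m p * E * (inrMatrix m p)ᵀ - inrMatrix m p * Eᵀ * (inlMatrix m p)ᵀ := by
  ext (i | i) (j | j) <;>
    simp [skewBlock, inlMatrix, inrMatrix, transpose_fromRows, fromRows_mul, mul_fromCols]

lemma inlMatrix_transpose_mul_skewResolvent_mul_inlMatrix (X : Matrix m p ℝ) :
    (inlMatrix m p)ᵀ * skewResolvent X * inlMatrix m p = gramResolvent Xᵀ := by
  simp [inlMatrix, skewResolvent, transpose_fromRows, fromCols_mul_fromBlocks,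
    fromCols_mul_fromRows]

lemma inrMatrix_transpose_mul_skewResolvent_mul_inlMatrix (X : Matrix m p ℝ) :
    (inrMatrix m p)ᵀ * skewResolvent X * inlMatrix m p = Xᵀ * gramResolvent Xᵀ := by
  simp [inrMatrix, inlMatrix, skewResolvent, transpose_fromRows, fromCols_mul_fromBlocks,
    fromCols_mul_fromRows]

lemma inrMatrix_transpose_mul_skewResolvent_mul_inrMatrix (X : Matrix m p ℝ) :
    (inrMatrix m p)ᵀ * skewResolvent X * inrMatrix m p = gramResolvent X := by
  simp [inrMatrix, skewResolvent, transpose_fromRows, fromCols_mul_fromBlocks,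
    fromCols_mul_fromRows]

omit [DecidableEq m] in
lemma norm_gramResolvent_le_one (X : Matrix m p ℝ) : ‖gramResolvent X‖ ≤ 1 := by
  classical
  rw [← inrMatrix_transpose_mul_skewResolvent_mul_inrMatrix]
  simpa using l2_opNorm_mul_le_of_le (l2_opNorm_mul_le_of_le norm_inrMatrix_transpose_le_one
    (norm_skewResolvent_le_one X)) (norm_inrMatrix_le_one (m := m))

lemma norm_skewBlock_le (E : Matrix m p ℝ) : ‖skewBlock E‖ ≤ 2 * ‖E‖ := by
  have hupper := l2_opNorm_mul_le_of_le (l2_opNorm_mul_le_of_le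
    (norm_inlMatrix_le_one (m := m) (p := p)) (le_refl ‖E‖))
    (norm_inrMatrix_transpose_le_one (m := m) (p := p))
  have hlower := l2_opNorm_mul_le_of_le (l2_opNorm_mul_le_of_le
    (norm_inrMatrix_le_one (m := m) (p := p)) (le_refl ‖Eᵀ‖))
    (norm_inlMatrix_transpose_le_one (m := m) (p := p))
  rw [l2_opNorm_transpose] at hlower
  rw [skewBlock_eq_sub]
  exact (norm_sub_le _ _).trans (by linarith)

lemma abs_trace_mul_skewBlock_le {E : Matrix m p ℝ} {k : ℝ} (hk : 0 ≤ k)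
    (hE : ∀ M : Matrix p m ℝ, |(M * E).trace| ≤ k * ‖M‖) (M : Matrix (m ⊕ p) (m ⊕ p) ℝ) :
    |(M * skewBlock E).trace| ≤ 2 * k * ‖M‖ := by
  have hsplit : (M * skewBlock E).trace = ((inrMatrix m p)ᵀ * M * inlMatrix m p * E).trace
      - (((inlMatrix m p)ᵀ * M * inrMatrix m p)ᵀ * E).trace := by
    rw [skewBlock_eq_sub, Matrix.mul_sub, trace_sub]
    congr 1
    · rw [← Matrix.mul_assoc, trace_mul_comm]
      simp only [Matrix.mul_assoc]
    · rw [← trace_transpose, trace_mul_comm _ E]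
      simp only [transpose_mul, transpose_transpose, Matrix.mul_assoc]
      rw [trace_mul_comm]
      simp only [Matrix.mul_assoc]
  have hrl : ‖(inrMatrix m p)ᵀ * M * inlMatrix m p‖ ≤ ‖M‖ := by
    simpa using l2_opNorm_mul_le_of_le (l2_opNorm_mul_le_of_le norm_inrMatrix_transpose_le_one
      (le_refl ‖M‖)) norm_inlMatrix_le_one
  have hlr : ‖((inlMatrix m p)ᵀ * M * inrMatrix m p)ᵀ‖ ≤ ‖M‖ := by
    rw [l2_opNorm_transpose]
    simpa using l2_opNorm_mul_le_of_le (l2_opNorm_mul_le_of_le norm_inlMatrix_transpose_le_one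
      (le_refl ‖M‖)) norm_inrMatrix_le_one
  calc |(M * skewBlock E).trace|
      ≤ |((inrMatrix m p)ᵀ * M * inlMatrix m p * E).trace|
        + |(((inlMatrix m p)ᵀ * M * inrMatrix m p)ᵀ * E).trace| := hsplit ▸ abs_sub _ _
    _ ≤ k * ‖M‖ + k * ‖M‖ := add_le_add
        ((hE _).trans (mul_le_mul_of_nonneg_left hrl hk))
        ((hE _).trans (mul_le_mul_of_nonneg_left hlr hk))
    _ = 2 * k * ‖M‖ := by ring

-- The remainder carries three factors `skewBlock E`. Two are bounded in operator norm and the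
-- third, of rank two in the applications, absorbs the trace.
lemma exists_trace_gramResolvent_add_smul_approx (X : Matrix m p ℝ) {E : Matrix m p ℝ} {k : ℝ}
    (hnorm : ‖E‖ ≤ k) (hE : ∀ M : Matrix p m ℝ, |(M * E).trace| ≤ k * ‖M‖) :
    ∃ c₀ c₁ c₂ : ℝ, ∀ z : ℝ,
      |(gramResolvent (X + z • E)).trace - (c₀ + c₁ * z + c₂ * z ^ 2)|
        ≤ (2 * k) ^ 3 * |z| ^ 3 := by
  have hk : 0 ≤ k := (norm_nonneg E).trans hnorm
  set R := skewResolvent X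
  set K := skewBlock E
  have hR : ‖R‖ ≤ 1 := norm_skewResolvent_le_one X
  have hK : ‖K‖ ≤ 2 * k := (norm_skewBlock_le E).trans (by linarith)
  refine ⟨(R.trace + Fintype.card p - Fintype.card m) / 2, -(R * K * R).trace / 2,
    (R * K * R * K * R).trace / 2, fun z => ?_⟩
  set Rz := skewResolvent (X + z • E)
  have hRz : ‖Rz‖ ≤ 1 := norm_skewResolvent_le_one _
  have hexpansion := congrArg trace (skewResolvent_add_smul_three X E z)
  rw [trace_skewResolvent] at hexpansion
  simp only [trace_add, trace_sub, trace_smul, smul_eq_mul] at hexpansion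
  have hremainder : |(R * K * R * K * R * K * Rz).trace| ≤ (2 * k) ^ 3 := by
    have hnorm : ‖Rz * (R * K * R * K * R)‖ ≤ 1 * (1 * (2 * k) * 1 * (2 * k) * 1) :=
      l2_opNorm_mul_le_of_le hRz (l2_opNorm_mul_le_of_le (l2_opNorm_mul_le_of_le
        (l2_opNorm_mul_le_of_le (l2_opNorm_mul_le_of_le hR hK) hR) hK) hR)
    calc |(R * K * R * K * R * K * Rz).trace|
        = |(Rz * (R * K * R * K * R) * K).trace| := by rw [trace_mul_comm, ← Matrix.mul_assoc]
      _ ≤ 2 * k * ‖Rz * (R * K * R * K * R)‖ := abs_trace_mul_skewBlock_le hk hE _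
      _ ≤ 2 * k * (1 * (1 * (2 * k) * 1 * (2 * k) * 1)) := by gcongr
      _ = (2 * k) ^ 3 := by ring
  calc |(gramResolvent (X + z • E)).trace - _|
      = |z| ^ 3 * |(R * K * R * K * R * K * Rz).trace| / 2 := by
        rw [← abs_pow, ← abs_mul, ← abs_two, ← abs_div, abs_two, ← abs_neg]
        congr 1
        linarith
    _ ≤ |z| ^ 3 * (2 * k) ^ 3 / 2 := by gcongr
    _ ≤ (2 * k) ^ 3 * |z| ^ 3 := by
        have : 0 ≤ (2 * k) ^ 3 * |z| ^ 3 := by positivity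
        linarith

lemma norm_skewResolvent_add_smul_sub_le (X E : Matrix m p ℝ) (z : ℝ) :
    ‖skewResolvent (X + z • E)
        - (skewResolvent X - z • (skewResolvent X * skewBlock E * skewResolvent X))‖
      ≤ (2 * ‖E‖) ^ 2 * z ^ 2 := by
  have hR := norm_skewResolvent_le_one X
  have hK := norm_skewBlock_le E
  rw [sub_eq_iff_eq_add'.mpr (skewResolvent_add_smul_two X E z), norm_smul, Real.norm_eq_abs,
    abs_of_nonneg (sq_nonneg z), mul_comm]
  refine mul_le_mul_of_nonneg_right ?_ (sq_nonneg z)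
  exact (l2_opNorm_mul_le_of_le (l2_opNorm_mul_le_of_le (l2_opNorm_mul_le_of_le
    (l2_opNorm_mul_le_of_le hR hK) hR) hK) (norm_skewResolvent_le_one (X + z • E))).trans_eq
    (by ring)

lemma norm_skewResolvent_mul_skewBlock_mul_sub_le (X E : Matrix m p ℝ) (z : ℝ) :
    ‖skewResolvent (X + z • E) * skewBlock E * skewResolvent (X + z • E)
        - skewResolvent X * skewBlock E * skewResolvent X‖
      ≤ 2 * (2 * ‖E‖) ^ 2 * |z| := by
  set R := skewResolvent X
  set Rz := skewResolvent (X + z • E)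
  set K := skewBlock E
  have hR : ‖R‖ ≤ 1 := norm_skewResolvent_le_one X
  have hRz : ‖Rz‖ ≤ 1 := norm_skewResolvent_le_one (X + z • E)
  have hK : ‖K‖ ≤ 2 * ‖E‖ := norm_skewBlock_le E
  have hdiff : ‖Rz - R‖ ≤ |z| * (1 * (2 * ‖E‖) * 1) := by
    rw [show Rz - R = -(z • (R * K * Rz)) from
      sub_eq_iff_eq_add'.mpr ((skewResolvent_add_smul X E z).trans (sub_eq_add_neg _ _)), norm_neg,
      norm_smul, Real.norm_eq_abs]
    exact mul_le_mul_of_nonneg_left (l2_opNorm_mul_le_of_le (l2_opNorm_mul_le_of_le hR hK) hRz)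
      (abs_nonneg z)
  calc ‖Rz * K * Rz - R * K * R‖ = ‖(Rz - R) * K * Rz + R * K * (Rz - R)‖ := by
        congr 1
        noncomm_ring
    _ ≤ |z| * (1 * (2 * ‖E‖) * 1) * (2 * ‖E‖) * 1
        + 1 * (2 * ‖E‖) * (|z| * (1 * (2 * ‖E‖) * 1)) := (norm_add_le _ _).trans (add_le_add
          (l2_opNorm_mul_le_of_le (l2_opNorm_mul_le_of_le hdiff hK) hRz)
          (l2_opNorm_mul_le_of_le (l2_opNorm_mul_le_of_le hR hK) hdiff))
    _ = 2 * (2 * ‖E‖) ^ 2 * |z| := by ring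

end LinearizedResolvent

section ProductMeasure

lemma abs_integral_le_of_forall_abs_le {α : Type*} [MeasurableSpace α] {μ : Measure α}
    [IsProbabilityMeasure μ] {f : α → ℝ} {C : ℝ} (hb : ∀ x, |f x| ≤ C) :
    |∫ x, f x ∂μ| ≤ C := by
  have hnorm : ∀ x, ‖f x‖ ≤ C := fun x => (Real.norm_eq_abs _).trans_le (hb x)
  simpa using norm_integral_le_of_norm_le_const (μ := μ) (Eventually.of_forall hnorm)

variable {ι E : Type*} [MeasurableSpace E]

lemma isProbabilityMeasure_update [DecidableEq ι] (μ : ι → Measure E)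
    [∀ i, IsProbabilityMeasure (μ i)] (i : ι) (ν : Measure E) [IsProbabilityMeasure ν] (j : ι) :
    IsProbabilityMeasure (Function.update μ i ν j) := by
  rcases eq_or_ne j i with rfl | hji
  · simpa
  · simpa [hji] using (inferInstance : IsProbabilityMeasure (μ j))

variable [Fintype ι] [DecidableEq ι]

lemma map_update_pi (μ : ι → Measure E) [∀ i, IsProbabilityMeasure (μ i)] (i : ι)
    (ν : Measure E) [IsProbabilityMeasure ν] :
    ((Measure.pi μ).prod ν).map (fun w => Function.update w.1 i w.2)
      = Measure.pi (Function.update μ i ν) := by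
  have := isProbabilityMeasure_update μ i ν
  refine (Measure.pi_eq fun s hs => ?_).symm
  have hpreimage : (fun w : (ι → E) × E => Function.update w.1 i w.2) ⁻¹' Set.univ.pi s
      = Set.univ.pi (Function.update s i Set.univ) ×ˢ s i := by
    ext w
    simp only [Set.mem_preimage, Set.mem_pi, Set.mem_univ, true_imp_iff, Set.mem_prod]
    refine ⟨fun h => ⟨fun j => ?_, by simpa using h i⟩, fun h j => ?_⟩ <;>
      rcases eq_or_ne j i with rfl | hji
    · simp
    · simpa [hji] using h j
    · simpa using h.2
    · simpa [hji] using h.1 j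
  rw [Measure.map_apply measurable_update' (MeasurableSet.univ_pi hs), hpreimage,
    Measure.prod_prod, Measure.pi_pi, ← Finset.mul_prod_erase _ _ (Finset.mem_univ i),
    ← Finset.mul_prod_erase _ (fun j => Function.update μ i ν j (s j)) (Finset.mem_univ i)]
  simp only [Function.update_self, measure_univ, one_mul]
  rw [mul_comm]
  congr 1
  refine Finset.prod_congr rfl fun j hj => ?_
  simp [Finset.ne_of_mem_erase hj]

lemma integral_pi_update (μ : ι → Measure E) [∀ i, IsProbabilityMeasure (μ i)] (i : ι)
    (ν : Measure E) [IsProbabilityMeasure ν] {F : (ι → E) → ℝ}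
    (hF : Integrable F (Measure.pi (Function.update μ i ν))) :
    ∫ x, F x ∂Measure.pi (Function.update μ i ν)
      = ∫ x, ∫ z, F (Function.update x i z) ∂ν ∂Measure.pi μ := by
  rw [← map_update_pi] at hF ⊢
  rw [integral_map measurable_update'.aemeasurable hF.1]
  exact integral_prod _ (hF.comp_measurable measurable_update')

lemma abs_integral_pi_le_of_forall_update (μ : ι → Measure E) [∀ i, IsProbabilityMeasure (μ i)]
    (i : ι) {F : (ι → E) → ℝ} (hF : Integrable F (Measure.pi μ)) {c : ℝ}
    (hc : ∀ x, |∫ z, F (Function.update x i z) ∂μ i| ≤ c) :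
    |∫ x, F x ∂Measure.pi μ| ≤ c := by
  have hupdate := integral_pi_update μ i (μ i) (F := F)
  rw [Function.update_eq_self] at hupdate
  rw [hupdate hF]
  exact abs_integral_le_of_forall_abs_le hc

lemma integrable_of_measurable_of_abs_le {α : Type*} [MeasurableSpace α] {μ : Measure α}
    [IsFiniteMeasure μ] {f : α → ℝ} (hf : Measurable f) {C : ℝ} (hb : ∀ x, |f x| ≤ C) :
    Integrable f μ :=
  Integrable.of_bound hf.aestronglyMeasurable C (Eventually.of_forall hb)

lemma abs_integral_sum_le {Ω ι : Type*} [Fintype ι] [MeasurableSpace Ω] {μ : Measure Ω}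
    {f : ι → Ω → ℝ} {C : ℝ} (hf : ∀ i, Integrable (f i) μ) (hC : ∀ i, |∫ ω, f i ω ∂μ| ≤ C) :
    |∫ ω, ∑ i, f i ω ∂μ| ≤ Fintype.card ι * C := by
  rw [integral_finsetSum _ fun i _ => hf i]
  calc |∑ i, ∫ ω, f i ω ∂μ| ≤ ∑ i, |∫ ω, f i ω ∂μ| := Finset.abs_sum_le_sum_abs _ _
    _ ≤ ∑ _i : ι, C := Finset.sum_le_sum fun i _ => hC i
    _ = Fintype.card ι * C := by simp

end ProductMeasure

section Lindeberg

/-- Probability laws on the line with mean zero, variance one and third absolute moment at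
most `M`: the class of entry laws over which the replacement and integration by parts estimates
are uniform. -/
structure IsStandardized (ν : Measure ℝ) (M : ℝ) : Prop where
  isProbabilityMeasure : IsProbabilityMeasure ν
  memLp : MemLp (fun z : ℝ => z) 3 ν
  integral_id : ∫ z, z ∂ν = 0
  integral_sq : ∫ z, z ^ 2 ∂ν = 1
  integral_abs_cube_le : ∫ z, |z| ^ 3 ∂ν ≤ M

namespace IsStandardized

variable {ν : Measure ℝ} {M : ℝ}

lemma integrable_id (h : IsStandardized ν M) : Integrable (fun z : ℝ => z) ν :=
  have := h.isProbabilityMeasure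
  memLp_one_iff_integrable.mp (h.memLp.mono_exponent (by norm_num))

lemma integrable_sq (h : IsStandardized ν M) : Integrable (fun z : ℝ => z ^ 2) ν :=
  have := h.isProbabilityMeasure
  (h.memLp.mono_exponent (q := 3) (p := 2) (by norm_num)).integrable_sq

lemma integrable_abs_cube (h : IsStandardized ν M) : Integrable (fun z : ℝ => |z| ^ 3) ν := by
  simpa using h.memLp.integrable_norm_rpow (by norm_num) (by norm_num)

lemma mono (h : IsStandardized ν M) {M' : ℝ} (hM : M ≤ M') : IsStandardized ν M' :=
  { h with integral_abs_cube_le := h.integral_abs_cube_le.trans hM }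

lemma nonneg (h : IsStandardized ν M) : 0 ≤ M :=
  (integral_nonneg fun z => by positivity).trans h.integral_abs_cube_le

lemma integrable_quadratic (h : IsStandardized ν M) (c₀ c₁ c₂ : ℝ) :
    Integrable (fun z => c₀ + c₁ * z + c₂ * z ^ 2) ν :=
  have := h.isProbabilityMeasure
  ((integrable_const c₀).add (h.integrable_id.const_mul c₁)).add (h.integrable_sq.const_mul c₂)

lemma integral_quadratic (h : IsStandardized ν M) (c₀ c₁ c₂ : ℝ) :
    ∫ z, (c₀ + c₁ * z + c₂ * z ^ 2) ∂ν = c₀ + c₂ := by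
  have := h.isProbabilityMeasure
  have hlinear : Integrable (fun z : ℝ => c₀ + c₁ * z) ν :=
    (integrable_const c₀).add (h.integrable_id.const_mul c₁)
  rw [integral_add hlinear (h.integrable_sq.const_mul c₂), integral_add (integrable_const c₀)
    (h.integrable_id.const_mul c₁), integral_const_mul, integral_const_mul, h.integral_id,
    h.integral_sq]
  simp

lemma integral_abs_le_one (h : IsStandardized ν M) : ∫ z, |z| ∂ν ≤ 1 := by
  calc ∫ z, |z| ∂ν ≤ ∫ z, (1 / 2 + 0 * z + 1 / 2 * z ^ 2) ∂ν :=
        integral_mono h.integrable_id.abs (h.integrable_quadratic _ _ _) fun z => by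
          change |z| ≤ 1 / 2 + 0 * z + 1 / 2 * z ^ 2
          nlinarith [sq_nonneg (|z| - 1), sq_abs z]
    _ = 1 := by rw [h.integral_quadratic]; norm_num

lemma abs_integral_sub_le_of_cubic_remainder (h : IsStandardized ν M) {f : ℝ → ℝ}
    (hf : Integrable f ν) {C c₀ c₁ c₂ : ℝ}
    (hexp : ∀ z, |f z - (c₀ + c₁ * z + c₂ * z ^ 2)| ≤ C * |z| ^ 3) :
    |∫ z, f z ∂ν - (c₀ + c₂)| ≤ C * M := by
  have hC : 0 ≤ C := by simpa using (abs_nonneg _).trans (hexp 1)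
  have hquadratic := h.integrable_quadratic c₀ c₁ c₂
  rw [← h.integral_quadratic c₀ c₁ c₂, ← integral_sub hf hquadratic]
  calc |∫ z, (f z - (c₀ + c₁ * z + c₂ * z ^ 2)) ∂ν|
      ≤ ∫ z, |f z - (c₀ + c₁ * z + c₂ * z ^ 2)| ∂ν := abs_integral_le_integral_abs
    _ ≤ ∫ z, C * |z| ^ 3 ∂ν :=
        integral_mono (hf.sub hquadratic).abs (h.integrable_abs_cube.const_mul C) hexp
    _ ≤ C * M := by
        rw [integral_const_mul]
        exact mul_le_mul_of_nonneg_left h.integral_abs_cube_le hC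

-- `z * g z - g' z` is within `C (|z|³ + |z|)` of `c₀ z + c₁ (z² - 1)`, whose integral vanishes.
lemma abs_integral_mul_sub_le_of_linear_remainder (h : IsStandardized ν M) {g g' : ℝ → ℝ}
    (hg : Integrable (fun z => z * g z) ν) (hg' : Integrable g' ν) {C c₀ c₁ : ℝ}
    (hexp : ∀ z, |g z - (c₀ + c₁ * z)| ≤ C * z ^ 2) (hexp' : ∀ z, |g' z - c₁| ≤ C * |z|) :
    |∫ z, (z * g z - g' z) ∂ν| ≤ C * (M + 1) := by
  have hC : 0 ≤ C := by simpa using (abs_nonneg _).trans (hexp' 1)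
  have hquadratic := h.integrable_quadratic (-c₁) c₀ c₁
  have hvanish : ∫ z, (-c₁ + c₀ * z + c₁ * z ^ 2) ∂ν = 0 := by
    rw [h.integral_quadratic, neg_add_cancel]
  have hstein : Integrable (fun z => z * g z - g' z) ν := hg.sub hg'
  rw [← sub_zero (∫ z, (z * g z - g' z) ∂ν), ← hvanish, ← integral_sub hstein hquadratic]
  calc |∫ z, (z * g z - g' z - (-c₁ + c₀ * z + c₁ * z ^ 2)) ∂ν|
      ≤ ∫ z, |z * g z - g' z - (-c₁ + c₀ * z + c₁ * z ^ 2)| ∂ν := abs_integral_le_integral_abs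
    _ ≤ ∫ z, (C * |z| ^ 3 + C * |z|) ∂ν := by
        refine integral_mono (hstein.sub hquadratic).abs
          ((h.integrable_abs_cube.const_mul C).add (h.integrable_id.abs.const_mul C)) fun z => ?_
        calc |z * g z - g' z - (-c₁ + c₀ * z + c₁ * z ^ 2)|
            = |z * (g z - (c₀ + c₁ * z)) - (g' z - c₁)| := by congr 1; ring
          _ ≤ |z| * |g z - (c₀ + c₁ * z)| + |g' z - c₁| := abs_mul z _ ▸ abs_sub _ _
          _ ≤ |z| * (C * z ^ 2) + C * |z| := by gcongr; exacts [hexp z, hexp' z]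
          _ = C * |z| ^ 3 + C * |z| := by rw [← sq_abs]; ring
    _ ≤ C * (M + 1) := by
        rw [integral_add (h.integrable_abs_cube.const_mul C) (h.integrable_id.abs.const_mul C),
          integral_const_mul, integral_const_mul, ← mul_add]
        exact mul_le_mul_of_nonneg_left (add_le_add h.integral_abs_cube_le h.integral_abs_le_one)
          hC

end IsStandardized

variable {ι : Type*} [Fintype ι] {ν₁ ν₂ : Measure ℝ} {M : ℝ}

lemma abs_integral_pi_update_sub_le [DecidableEq ι] (h₁ : IsStandardized ν₁ M)
    (h₂ : IsStandardized ν₂ M) (μ : ι → Measure ℝ) [∀ i, IsProbabilityMeasure (μ i)] (i : ι)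
    {F : (ι → ℝ) → ℝ} (hF : Measurable F) {b C : ℝ} (hb : ∀ x, |F x| ≤ b)
    (hexp : ∀ x, ∃ c₀ c₁ c₂ : ℝ, ∀ z : ℝ,
      |F (Function.update x i z) - (c₀ + c₁ * z + c₂ * z ^ 2)| ≤ C * |z| ^ 3) :
    |∫ x, F x ∂Measure.pi (Function.update μ i ν₁)
      - ∫ x, F x ∂Measure.pi (Function.update μ i ν₂)| ≤ C * (2 * M) := by
  have := h₁.isProbabilityMeasure
  have := h₂.isProbabilityMeasure
  have := isProbabilityMeasure_update μ i ν₁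
  have := isProbabilityMeasure_update μ i ν₂
  have hslice (ν : Measure ℝ) [IsProbabilityMeasure ν] (x : ι → ℝ) :
      Integrable (fun z => F (Function.update x i z)) ν :=
    integrable_of_measurable_of_abs_le
      (hF.comp (measurable_update'.comp measurable_prodMk_left)) fun z => hb _
  have hmarginal (ν : Measure ℝ) [IsProbabilityMeasure ν] :
      Integrable (fun x => ∫ z, F (Function.update x i z) ∂ν) (Measure.pi μ) :=
    ((integrable_of_measurable_of_abs_le (μ := (Measure.pi μ).prod ν)
      (hF.comp measurable_update') fun w => hb _)).integral_prod_left
  rw [integral_pi_update μ i ν₁ (integrable_of_measurable_of_abs_le hF hb),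
    integral_pi_update μ i ν₂ (integrable_of_measurable_of_abs_le hF hb),
    ← integral_sub (hmarginal ν₁) (hmarginal ν₂)]
  refine abs_integral_le_of_forall_abs_le fun x => ?_
  obtain ⟨c₀, c₁, c₂, hx⟩ := hexp x
  have happrox₁ := abs_le.mp (h₁.abs_integral_sub_le_of_cubic_remainder (hslice ν₁ x) hx)
  have happrox₂ := abs_le.mp (h₂.abs_integral_sub_le_of_cubic_remainder (hslice ν₂ x) hx)
  exact abs_le.mpr ⟨by linarith [happrox₁.1, happrox₂.2], by linarith [happrox₁.2, happrox₂.1]⟩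

-- Lindeberg's argument: exchange the coordinates one at a time, each at cost `2CM`.
lemma abs_integral_pi_sub_integral_pi_le [DecidableEq ι] (h₁ : IsStandardized ν₁ M)
    (h₂ : IsStandardized ν₂ M) {F : (ι → ℝ) → ℝ} (hF : Measurable F) {b C : ℝ}
    (hb : ∀ x, |F x| ≤ b)
    (hexp : ∀ x i, ∃ c₀ c₁ c₂ : ℝ, ∀ z : ℝ,
      |F (Function.update x i z) - (c₀ + c₁ * z + c₂ * z ^ 2)| ≤ C * |z| ^ 3) :
    |∫ x, F x ∂Measure.pi (fun _ : ι => ν₁) - ∫ x, F x ∂Measure.pi (fun _ : ι => ν₂)|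
      ≤ Fintype.card ι * (C * (2 * M)) := by
  have := h₁.isProbabilityMeasure
  have := h₂.isProbabilityMeasure
  let hybrid (s : Finset ι) (i : ι) : Measure ℝ := if i ∈ s then ν₁ else ν₂
  have hprob (s : Finset ι) (i : ι) : IsProbabilityMeasure (hybrid s i) := by
    dsimp only [hybrid]
    split_ifs <;> assumption
  suffices hbound : ∀ s : Finset ι, |∫ x, F x ∂Measure.pi (hybrid s)
      - ∫ x, F x ∂Measure.pi (fun _ : ι => ν₂)| ≤ s.card * (C * (2 * M)) by
    simpa [hybrid] using hbound Finset.univ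
  intro s
  induction s using Finset.induction_on with
  | empty => simp [hybrid]
  | insert a s ha ih =>
    have hinsert : hybrid (insert a s) = Function.update (hybrid s) a ν₁ := by
      ext1 i
      rcases eq_or_ne i a with rfl | hia <;> simp [hybrid, *]
    have hself : hybrid s = Function.update (hybrid s) a ν₂ := by
      simp [hybrid, ha]
    have hexchange := abs_integral_pi_update_sub_le h₁ h₂ (hybrid s) a hF hb fun x => hexp x a
    rw [← hinsert, ← hself] at hexchange
    rw [Finset.card_insert_of_notMem ha, Nat.cast_add, Nat.cast_one, add_mul, one_mul, add_comm]
    exact (abs_sub_le _ _ _).trans (add_le_add hexchange ih)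

lemma IsStandardized.integrable_eval_mul (h : IsStandardized ν₁ M) (i : ι) {f : (ι → ℝ) → ℝ}
    (hf : Measurable f) {b : ℝ} (hb : ∀ x, |f x| ≤ b) :
    Integrable (fun x => x i * f x) (Measure.pi fun _ : ι => ν₁) := by
  have := h.isProbabilityMeasure
  have heval : Integrable (fun x : ι → ℝ => x i) (Measure.pi fun _ : ι => ν₁) :=
    (measurePreserving_eval (fun _ : ι => ν₁) i).integrable_comp_of_integrable h.integrable_id
  simpa only [mul_comm] using heval.bdd_mul hf.aestronglyMeasurable (Eventually.of_forall hb)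

lemma IsStandardized.abs_integral_eval_mul_sub_le [DecidableEq ι] (h : IsStandardized ν₁ M)
    (i : ι) {f f' : (ι → ℝ) → ℝ} (hf : Measurable f) (hf' : Measurable f') {b b' C : ℝ}
    (hb : ∀ x, |f x| ≤ b) (hb' : ∀ x, |f' x| ≤ b')
    (hexp : ∀ x, ∃ c₀ c₁ : ℝ, ∀ z : ℝ,
      |f (Function.update x i z) - (c₀ + c₁ * z)| ≤ C * z ^ 2 ∧
      |f' (Function.update x i z) - c₁| ≤ C * |z|) :
    |∫ x, (x i * f x - f' x) ∂Measure.pi (fun _ : ι => ν₁)| ≤ C * (M + 1) := by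
  have := h.isProbabilityMeasure
  have hslice (x : ι → ℝ) : Measurable fun z : ℝ => Function.update x i z :=
    measurable_update'.comp measurable_prodMk_left
  refine abs_integral_pi_le_of_forall_update (fun _ => ν₁) i ((h.integrable_eval_mul i hf hb).sub
    (integrable_of_measurable_of_abs_le hf' hb')) fun x => ?_
  obtain ⟨c₀, c₁, hx⟩ := hexp x
  simp only [Pi.sub_apply, Function.update_self]
  refine h.abs_integral_mul_sub_le_of_linear_remainder ?_
    (integrable_of_measurable_of_abs_le (hf'.comp (hslice x)) fun z => hb' _)
    (fun z => (hx z).1) (fun z => (hx z).2)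
  simpa only [mul_comm, Function.comp_apply] using h.integrable_id.bdd_mul
    (hf.comp (hslice x)).aestronglyMeasurable (Eventually.of_forall fun z => hb _)

end Lindeberg

section Sandwich

open Matrix
open scoped Matrix.Norms.L2Operator

variable {m p q l : Type*} [Fintype m] [Fintype p] [Fintype q] [Fintype l]

/-- The matrix `s • (A * W * B)`, where `W` has the entries `x`. The rescaled design matrix
`(λn)^(-1/2) • (A * Z * B)` has this form, with `x` distributed as a product measure. -/
noncomputable def sandwich (s : ℝ) (A : Matrix m m ℝ) (B : Matrix p p ℝ) (x : m × p → ℝ) :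
    Matrix m p ℝ := s • (A * Matrix.of (fun i j => x (i, j)) * B)

lemma continuous_sandwich (s : ℝ) (A : Matrix m m ℝ) (B : Matrix p p ℝ) :
    Continuous (sandwich s A B) := by
  have hentries : Continuous fun x : m × p → ℝ => (of fun i j => x (i, j) : Matrix m p ℝ) :=
    continuous_matrix fun i j => continuous_apply (i, j)
  exact ((continuous_const.matrix_mul hentries).matrix_mul continuous_const).const_smul s

lemma continuous_gramResolvent [DecidableEq p] :
    Continuous (gramResolvent : Matrix m p ℝ → Matrix p p ℝ) := by
  have hgram : Continuous fun X : Matrix m p ℝ => 1 + Xᵀ * X := by fun_prop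
  have hadjugate : (gramResolvent : Matrix m p ℝ → Matrix p p ℝ)
      = fun X => ((1 + Xᵀ * X).det)⁻¹ • (1 + Xᵀ * X).adjugate := by
    ext1 X
    rw [gramResolvent, inv_def, Ring.inverse_eq_inv']
  rw [hadjugate]
  exact (hgram.matrix_det.inv₀ fun X => (isUnit_det_one_add_gram X).ne_zero).smul
    hgram.matrix_adjugate

variable [DecidableEq m] [DecidableEq p]

lemma continuous_skewResolvent :
    Continuous (skewResolvent : Matrix m p ℝ → Matrix (m ⊕ p) (m ⊕ p) ℝ) := by
  have htop : Continuous fun X : Matrix m p ℝ => gramResolvent Xᵀ :=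
    continuous_gramResolvent.comp continuous_id.matrix_transpose
  exact htop.matrix_fromBlocks (htop.matrix_mul continuous_id).neg
    (continuous_id.matrix_transpose.matrix_mul htop) continuous_gramResolvent

/-- The increment of `sandwich s A B` when the entry `(i, j)` grows by one. -/
noncomputable def entryDirection (s : ℝ) (A : Matrix m m ℝ) (B : Matrix p p ℝ) (i : m) (j : p) :
    Matrix m p ℝ := s • (A * single i j (1 : ℝ) * B)

lemma sandwich_update (s : ℝ) (A : Matrix m m ℝ) (B : Matrix p p ℝ) (x : m × p → ℝ) (i : m)
    (j : p) (z : ℝ) : sandwich s A B (Function.update x (i, j) z)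
      = sandwich s A B (Function.update x (i, j) 0) + z • entryDirection s A B i j := by
  have hentries : (of fun i' j' => Function.update x (i, j) z (i', j') : Matrix m p ℝ)
      = of (fun i' j' => Function.update x (i, j) 0 (i', j')) + z • single i j (1 : ℝ) := by
    ext i' j'
    by_cases h : (i', j') = (i, j)
    · obtain ⟨rfl, rfl⟩ := Prod.mk.inj h
      simp
    · have hne : ¬ (i = i' ∧ j = j') := fun heq => h (by rw [heq.1, heq.2])
      simp [Function.update_of_ne h, hne]
  rw [sandwich, sandwich, entryDirection, hentries, Matrix.mul_add, Matrix.add_mul, smul_add,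
    Matrix.mul_smul, Matrix.smul_mul, smul_comm z s]

lemma norm_single_one_le_one (i : m) (j : p) : ‖(single i j 1 : Matrix m p ℝ)‖ ≤ 1 := by
  refine l2_opNorm_le_of_dotProduct_le zero_le_one fun x => ?_
  have hsingle : single i j (1 : ℝ) *ᵥ x = Pi.single i (x j) := by
    rw [single_mulVec]
    simp [Pi.single]
  rw [hsingle, single_dotProduct, Pi.single_eq_same, one_pow, one_mul]
  exact Finset.single_le_sum (f := fun i => x i * x i) (fun i _ => mul_self_nonneg _)
    (Finset.mem_univ j)

lemma norm_entryDirection_le (s : ℝ) (A : Matrix m m ℝ) (B : Matrix p p ℝ) (i : m) (j : p) :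
    ‖entryDirection s A B i j‖ ≤ |s| * (‖A‖ * ‖B‖) := by
  rw [entryDirection, norm_smul, Real.norm_eq_abs]
  refine mul_le_mul_of_nonneg_left ?_ (abs_nonneg s)
  simpa using l2_opNorm_mul_le_of_le (l2_opNorm_mul_le_of_le (le_refl ‖A‖)
    (norm_single_one_le_one i j)) (le_refl ‖B‖)

lemma abs_mul_mul_apply_le [DecidableEq l] (U : Matrix q m ℝ) (N : Matrix m p ℝ)
    (V : Matrix p l ℝ) (a : q) (b : l) : |(U * N * V) a b| ≤ ‖U‖ * ‖N‖ * ‖V‖ :=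
  (abs_apply_le_l2_opNorm _ a b).trans
    (l2_opNorm_mul_le_of_le (l2_opNorm_mul U N) (le_refl ‖V‖))

lemma abs_trace_mul_entryDirection_le (s : ℝ) (A : Matrix m m ℝ) (B : Matrix p p ℝ) (i : m)
    (j : p) (M : Matrix p m ℝ) :
    |(M * entryDirection s A B i j).trace| ≤ |s| * (‖A‖ * ‖B‖) * ‖M‖ := by
  have htrace : (M * (A * single i j (1 : ℝ) * B)).trace = (B * M * A) j i := by
    rw [← Matrix.mul_assoc, trace_mul_comm, ← Matrix.mul_assoc, ← Matrix.mul_assoc,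
      trace_mul_single, MulOpposite.op_one, one_smul]
  rw [entryDirection, Matrix.mul_smul, trace_smul, htrace, smul_eq_mul, abs_mul, mul_assoc]
  refine mul_le_mul_of_nonneg_left ?_ (abs_nonneg s)
  linarith [abs_mul_mul_apply_le B M A j i]

lemma abs_trace_le_card_mul_l2_opNorm (N : Matrix m m ℝ) : |N.trace| ≤ Fintype.card m * ‖N‖ :=
  calc |N.trace| ≤ ∑ i, |N i i| := Finset.abs_sum_le_sum_abs _ _
    _ ≤ ∑ _i : m, ‖N‖ := Finset.sum_le_sum fun i _ => abs_apply_le_l2_opNorm N i i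
    _ = Fintype.card m * ‖N‖ := by simp

end Sandwich

section Stein

open Matrix
open scoped Matrix.Norms.L2Operator

variable {m p q l : Type*} [Fintype m] [Fintype p] [Fintype q] [Fintype l] [DecidableEq m]
  [DecidableEq p] [DecidableEq l] {ν : Measure ℝ} {M : ℝ}

lemma exists_mul_skewResolvent_mul_apply_add_smul_approx (X E : Matrix m p ℝ)
    (U : Matrix q (m ⊕ p) ℝ) (V : Matrix (m ⊕ p) l ℝ) (a : q) (b : l) :
    ∃ c₀ c₁ : ℝ, ∀ z : ℝ,
      |(U * skewResolvent (X + z • E) * V) a b - (c₀ + c₁ * z)|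
        ≤ 2 * (‖U‖ * (2 * ‖E‖) ^ 2 * ‖V‖) * z ^ 2 ∧
      |-(U * (skewResolvent (X + z • E) * skewBlock E * skewResolvent (X + z • E)) * V) a b - c₁|
        ≤ 2 * (‖U‖ * (2 * ‖E‖) ^ 2 * ‖V‖) * |z| := by
  set R := skewResolvent X
  set K := skewBlock E
  refine ⟨(U * R * V) a b, -(U * (R * K * R) * V) a b, fun z => ?_⟩
  have hfirst := norm_skewResolvent_add_smul_sub_le X E z
  have hderiv := norm_skewResolvent_mul_skewBlock_mul_sub_le X E z
  set Rz := skewResolvent (X + z • E)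
  constructor
  · calc |(U * Rz * V) a b - ((U * R * V) a b + -(U * (R * K * R) * V) a b * z)|
        = |(U * (Rz - (R - z • (R * K * R))) * V) a b| := by
          congr 1
          simp only [Matrix.mul_sub, Matrix.sub_mul, Matrix.mul_smul, Matrix.smul_mul,
            Matrix.sub_apply, Matrix.smul_apply, smul_eq_mul]
          ring
      _ ≤ ‖U‖ * ((2 * ‖E‖) ^ 2 * z ^ 2) * ‖V‖ :=
          (abs_mul_mul_apply_le U _ V a b).trans (by gcongr)
      _ = ‖U‖ * (2 * ‖E‖) ^ 2 * ‖V‖ * z ^ 2 := by ring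
      _ ≤ 2 * (‖U‖ * (2 * ‖E‖) ^ 2 * ‖V‖) * z ^ 2 := by
          have : 0 ≤ ‖U‖ * (2 * ‖E‖) ^ 2 * ‖V‖ * z ^ 2 := by positivity
          linarith
  · calc |-(U * (Rz * K * Rz) * V) a b - -(U * (R * K * R) * V) a b|
        = |(U * (Rz * K * Rz - R * K * R) * V) a b| := by
          rw [← abs_neg]
          congr 1
          simp only [Matrix.mul_sub, Matrix.sub_mul, Matrix.sub_apply]
          ring
      _ ≤ ‖U‖ * (2 * (2 * ‖E‖) ^ 2 * |z|) * ‖V‖ :=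
          (abs_mul_mul_apply_le U _ V a b).trans (by gcongr)
      _ = 2 * (‖U‖ * (2 * ‖E‖) ^ 2 * ‖V‖) * |z| := by ring

lemma IsStandardized.abs_integral_eval_mul_skewResolvent_add_le (h : IsStandardized ν M) (s : ℝ)
    (A : Matrix m m ℝ) (B : Matrix p p ℝ) (U : Matrix q (m ⊕ p) ℝ) (V : Matrix (m ⊕ p) l ℝ)
    (a : q) (b : l) (i : m) (j : p) :
    Integrable (fun x => x (i, j) * (U * skewResolvent (sandwich s A B x) * V) a b
      + (U * (skewResolvent (sandwich s A B x) * skewBlock (entryDirection s A B i j)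
        * skewResolvent (sandwich s A B x)) * V) a b) (Measure.pi fun _ : m × p => ν) ∧
    |∫ x, (x (i, j) * (U * skewResolvent (sandwich s A B x) * V) a b
      + (U * (skewResolvent (sandwich s A B x) * skewBlock (entryDirection s A B i j)
        * skewResolvent (sandwich s A B x)) * V) a b) ∂Measure.pi fun _ : m × p => ν|
      ≤ 2 * (‖U‖ * (2 * ‖entryDirection s A B i j‖) ^ 2 * ‖V‖) * (M + 1) := by
  have := h.isProbabilityMeasure
  set K := skewBlock (entryDirection s A B i j)
  let R : (m × p → ℝ) → Matrix (m ⊕ p) (m ⊕ p) ℝ := fun x => skewResolvent (sandwich s A B x)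
  let f : (m × p → ℝ) → ℝ := fun x => (U * R x * V) a b
  let f' : (m × p → ℝ) → ℝ := fun x => -(U * (R x * K * R x) * V) a b
  have hR : Continuous R := continuous_skewResolvent.comp (continuous_sandwich s A B)
  have hf : Measurable f := Continuous.measurable (by fun_prop)
  have hf' : Measurable f' := Continuous.measurable (by fun_prop)
  have hb (x) : |f x| ≤ ‖U‖ * 1 * ‖V‖ :=
    (abs_mul_mul_apply_le _ _ _ _ _).trans (by gcongr; exact norm_skewResolvent_le_one _)
  have hb' (x) : |f' x| ≤ ‖U‖ * (1 * ‖K‖ * 1) * ‖V‖ := by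
    rw [abs_neg]
    refine (abs_mul_mul_apply_le _ _ _ _ _).trans ?_
    gcongr
    exact l2_opNorm_mul_le_of_le (l2_opNorm_mul_le_of_le (norm_skewResolvent_le_one _) le_rfl)
      (norm_skewResolvent_le_one _)
  have hsub (x) : x (i, j) * f x + (U * (R x * K * R x) * V) a b = x (i, j) * f x - f' x :=
    (sub_neg_eq_add _ _).symm
  refine ⟨((h.integrable_eval_mul _ hf hb).sub
    (integrable_of_measurable_of_abs_le hf' hb')).congr (ae_of_all _ fun x => (hsub x).symm), ?_⟩
  rw [integral_congr_ae (ae_of_all _ hsub)]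
  refine h.abs_integral_eval_mul_sub_le (i, j) hf hf' hb hb' fun x => ?_
  obtain ⟨c₀, c₁, happrox⟩ := exists_mul_skewResolvent_mul_apply_add_smul_approx
    (sandwich s A B (Function.update x (i, j) 0)) (entryDirection s A B i j) U V a b
  refine ⟨c₀, c₁, fun z => ?_⟩
  simp only [f, f', R]
  rw [sandwich_update]
  exact happrox z

lemma sum_sum_mul_skewBlock_entryDirection_mul (s : ℝ) (A : Matrix m m ℝ) (B : Matrix p p ℝ)
    (P : Matrix p (m ⊕ p) ℝ) (T : Matrix (m ⊕ p) m ℝ) :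
    ∑ i, ∑ j, (P * skewBlock (entryDirection s A B i j) * T) j i
      = s * (((P * inlMatrix m p * A)ᵀ * (B * (inrMatrix m p)ᵀ * T)).trace
        - (P * inrMatrix m p * Bᵀ).trace * (Aᵀ * (inlMatrix m p)ᵀ * T).trace) := by
  have hentry (i : m) (j : p) : (P * skewBlock (entryDirection s A B i j) * T) j i
      = s * ((P * inlMatrix m p * A) j i * (B * (inrMatrix m p)ᵀ * T) j i
        - (P * inrMatrix m p * Bᵀ) j j * (Aᵀ * (inlMatrix m p)ᵀ * T) i i) := by
    have hsingle (P : Matrix p m ℝ) (T : Matrix p m ℝ) :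
        (P * single i j (1 : ℝ) * T) j i = P j i * T j i := by
      simp [mul_apply, single_apply, ite_and]
    have hsingle' (P : Matrix p p ℝ) (T : Matrix m m ℝ) :
        (P * (single i j (1 : ℝ))ᵀ * T) j i = P j j * T i i := by
      simp [mul_apply, single_apply, ite_and]
    rw [← hsingle, ← hsingle', skewBlock_eq_sub, entryDirection]
    simp only [Matrix.mul_sub, Matrix.sub_mul, Matrix.mul_smul, Matrix.smul_mul,
      transpose_smul, transpose_mul, Matrix.sub_apply, Matrix.smul_apply, smul_eq_mul,
      Matrix.mul_assoc, mul_sub]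
  simp only [hentry, ← Finset.mul_sum, Finset.sum_sub_distrib]
  congr 2
  rw [trace, trace, mul_comm, Finset.sum_mul_sum]
  simp only [diag_apply, mul_comm]

omit [DecidableEq p] in
lemma mul_sum_sum_mul_gramResolvent (s : ℝ) (A Θ : Matrix m m ℝ) (B : Matrix p p ℝ)
    (x : m × p → ℝ) :
    s * ∑ i, ∑ j, x (i, j) * (B * ((sandwich s A B x)ᵀ * gramResolvent (sandwich s A B x)ᵀ)
        * (Θ * A)) j i
      = Θ.trace - (Θ * gramResolvent (sandwich s A B x)ᵀ).trace := by
  set X := sandwich s A B x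
  set Y := Xᵀ * gramResolvent Xᵀ
  let W : Matrix m p ℝ := of fun i j => x (i, j)
  have hXY : X * Y = 1 - gramResolvent Xᵀ := by
    simpa only [transpose_transpose, Matrix.mul_assoc] using gram_mul_gramResolvent Xᵀ
  calc s * ∑ i, ∑ j, x (i, j) * (B * Y * (Θ * A)) j i
      = s * (W * (B * Y * (Θ * A))).trace := by
        simp only [trace, diag_apply, mul_apply (M := W), W, of_apply]
    _ = (Θ * (s • (A * W * B) * Y)).trace := by
        rw [Matrix.smul_mul, Matrix.mul_smul, trace_smul, smul_eq_mul]
        congr 1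
        rw [← Matrix.mul_assoc, trace_mul_comm]
        simp only [Matrix.mul_assoc]
    _ = Θ.trace - (Θ * gramResolvent Xᵀ).trace := by
        rw [show s • (A * W * B) * Y = 1 - gramResolvent Xᵀ from hXY, Matrix.mul_sub,
          Matrix.mul_one, trace_sub]

lemma mul_sum_eval_mul_skewResolvent_add (s : ℝ) (A Θ : Matrix m m ℝ) (B : Matrix p p ℝ)
    {U : Matrix p (m ⊕ p) ℝ} {V : Matrix (m ⊕ p) m ℝ} (hU : U = B * (inrMatrix m p)ᵀ)
    (hV : V = inlMatrix m p * (Θ * A)) (x : m × p → ℝ) :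
    s * ∑ k : m × p, (x k * (U * skewResolvent (sandwich s A B x) * V) k.2 k.1
        + (U * (skewResolvent (sandwich s A B x) * skewBlock (entryDirection s A B k.1 k.2)
          * skewResolvent (sandwich s A B x)) * V) k.2 k.1)
      = Θ.trace - (Θ * gramResolvent (sandwich s A B x)ᵀ).trace
        - s ^ 2 * ((B * gramResolvent (sandwich s A B x) * Bᵀ).trace
          * (Aᵀ * gramResolvent (sandwich s A B x)ᵀ * (Θ * A)).trace)
        + s ^ 2 * ((U * skewResolvent (sandwich s A B x) * inlMatrix m p * A)ᵀ
          * (U * skewResolvent (sandwich s A B x) * V)).trace := by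
  set X := sandwich s A B x with hX
  set R := skewResolvent X
  have hoff : U * R * V = B * (Xᵀ * gramResolvent Xᵀ) * (Θ * A) := by
    rw [hU, hV, ← inrMatrix_transpose_mul_skewResolvent_mul_inlMatrix]
    simp only [Matrix.mul_assoc, R]
  have hbottom : U * R * inrMatrix m p * Bᵀ = B * gramResolvent X * Bᵀ := by
    rw [hU, ← inrMatrix_transpose_mul_skewResolvent_mul_inrMatrix]
    simp only [Matrix.mul_assoc, R]
  have htop : Aᵀ * (inlMatrix m p)ᵀ * (R * V) = Aᵀ * gramResolvent Xᵀ * (Θ * A) := by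
    rw [hV, ← inlMatrix_transpose_mul_skewResolvent_mul_inlMatrix]
    simp only [Matrix.mul_assoc, R]
  have hfirst := mul_sum_sum_mul_gramResolvent s A Θ B x
  have hsecond := sum_sum_mul_skewBlock_entryDirection_mul s A B (U * R) (R * V)
  rw [← hX, ← hoff] at hfirst
  rw [← hU, hbottom, htop, ← Matrix.mul_assoc U] at hsecond
  rw [Finset.sum_add_distrib, mul_add, Fintype.sum_prod_type, Fintype.sum_prod_type, hfirst]
  simp only [Matrix.mul_assoc] at hsecond ⊢
  rw [hsecond]
  ring

lemma abs_trace_transpose_mul_skewResolvent_le {a b : ℝ} (X : Matrix m p ℝ)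
    {A Θ : Matrix m m ℝ} (hA : ‖A‖ ≤ a) (hΘ : ‖Θ‖ ≤ 1) {U : Matrix q (m ⊕ p) ℝ} (hU : ‖U‖ ≤ b) :
    |((U * skewResolvent X * inlMatrix m p * A)ᵀ
        * (U * skewResolvent X * (inlMatrix m p * (Θ * A)))).trace|
      ≤ Fintype.card m * (a * b) ^ 2 := by
  classical
  have hUR : ‖U * skewResolvent X‖ ≤ b * 1 :=
    l2_opNorm_mul_le_of_le hU (norm_skewResolvent_le_one X)
  have hleft : ‖(U * skewResolvent X * inlMatrix m p * A)ᵀ‖ ≤ b * 1 * 1 * a := by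
    rw [l2_opNorm_transpose]
    exact l2_opNorm_mul_le_of_le (l2_opNorm_mul_le_of_le hUR norm_inlMatrix_le_one) hA
  have hright : ‖U * skewResolvent X * (inlMatrix m p * (Θ * A))‖ ≤ b * 1 * (1 * (1 * a)) :=
    l2_opNorm_mul_le_of_le hUR
      (l2_opNorm_mul_le_of_le norm_inlMatrix_le_one (l2_opNorm_mul_le_of_le hΘ hA))
  refine (abs_trace_le_card_mul_l2_opNorm _).trans
    (mul_le_mul_of_nonneg_left ?_ (Nat.cast_nonneg _))
  exact (l2_opNorm_mul_le_of_le hleft hright).trans_eq (by ring)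

lemma IsStandardized.abs_integral_trace_gramResolvent_sub_le (h : IsStandardized ν M)
    {s a b : ℝ} (hs : 0 ≤ s) {A Θ : Matrix m m ℝ} {B : Matrix p p ℝ} (hA : ‖A‖ ≤ a)
    (hB : ‖B‖ ≤ b) (hΘ : ‖Θ‖ ≤ 1) :
    |∫ x, ((Θ.trace - (Θ * gramResolvent (sandwich s A B x)ᵀ).trace)
        - s ^ 2 * ((B * gramResolvent (sandwich s A B x) * Bᵀ).trace
          * (Aᵀ * gramResolvent (sandwich s A B x)ᵀ * (Θ * A)).trace))
        ∂Measure.pi fun _ : m × p => ν|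
      ≤ s ^ 2 * (Fintype.card m * (a * b) ^ 2)
        + Fintype.card m * Fintype.card p * (8 * (s * a * b) ^ 3 * (M + 1)) := by
  have := h.isProbabilityMeasure
  have ha : 0 ≤ a := (norm_nonneg _).trans hA
  have hb : 0 ≤ b := (norm_nonneg _).trans hB
  have hM := h.nonneg
  set U : Matrix p (m ⊕ p) ℝ := B * (inrMatrix m p)ᵀ with hU
  set V : Matrix (m ⊕ p) m ℝ := inlMatrix m p * (Θ * A) with hV
  have hUb : ‖U‖ ≤ b := by
    simpa using l2_opNorm_mul_le_of_le hB
      ((l2_opNorm_transpose _).trans_le (norm_inrMatrix_le_one (m := m) (p := p)))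
  have hVa : ‖V‖ ≤ a := by
    simpa using l2_opNorm_mul_le_of_le norm_inlMatrix_le_one (l2_opNorm_mul_le_of_le hΘ hA)
  let R : (m × p → ℝ) → Matrix (m ⊕ p) (m ⊕ p) ℝ := fun x => skewResolvent (sandwich s A B x)
  let g : m × p → (m × p → ℝ) → ℝ := fun k x => x k * (U * R x * V) k.2 k.1
    + (U * (R x * skewBlock (entryDirection s A B k.1 k.2) * R x) * V) k.2 k.1
  let Φ : (m × p → ℝ) → ℝ := fun x => ((U * R x * inlMatrix m p * A)ᵀ * (U * R x * V)).trace
  have hR : Continuous R := continuous_skewResolvent.comp (continuous_sandwich s A B)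
  have hΦ (x) : |Φ x| ≤ Fintype.card m * (a * b) ^ 2 :=
    abs_trace_transpose_mul_skewResolvent_le _ hA hΘ hUb
  have hΦm : Measurable Φ := Continuous.measurable (by fun_prop)
  have hg (k : m × p) := h.abs_integral_eval_mul_skewResolvent_add_le s A B U V k.2 k.1 k.1 k.2
  have hgC (k : m × p) : |∫ x, g k x ∂Measure.pi fun _ : m × p => ν|
      ≤ 2 * (b * (2 * (s * (a * b))) ^ 2 * a) * (M + 1) := by
    refine (hg k).2.trans ?_
    have hE := norm_entryDirection_le s A B k.1 k.2
    rw [abs_of_nonneg hs] at hE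
    gcongr
    exact hE.trans (by gcongr)
  have hsum := integrable_finsetSum Finset.univ fun k _ => (hg k).1
  rw [integral_congr_ae (ae_of_all _ fun x => (sub_eq_of_eq_add
      (mul_sum_eval_mul_skewResolvent_add s A Θ B hU hV x)).symm),
    integral_sub (hsum.const_mul s)
      ((integrable_of_measurable_of_abs_le hΦm hΦ).const_mul (s ^ 2)), integral_const_mul,
    integral_const_mul]
  refine (abs_sub _ _).trans ?_
  rw [abs_mul, abs_mul, abs_of_nonneg hs, abs_of_nonneg (sq_nonneg s), add_comm]
  refine add_le_add (mul_le_mul_of_nonneg_left (abs_integral_le_of_forall_abs_le hΦ)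
    (sq_nonneg s)) ?_
  refine (mul_le_mul_of_nonneg_left
    (abs_integral_sum_le (fun k => (hg k).1) hgC) hs).trans_eq ?_
  rw [Fintype.card_prod, Nat.cast_mul]
  ring

end Stein

section SmallSingularValues

open Matrix
open scoped Matrix.Norms.L2Operator

lemma norm_diagonal_le {m : Type*} [Fintype m] [DecidableEq m] {d : m → ℝ} {L : ℝ} (hL : 0 ≤ L)
    (hd : ∀ i, |d i| ≤ L) : ‖diagonal d‖ ≤ L := by
  rw [l2_opNorm_diagonal]
  exact (pi_norm_le_iff_of_nonneg hL).mpr fun i => by simpa using hd i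

lemma abs_sum_gramResolvent_diag_le {m p : Type*} [Fintype m] [Fintype p] [DecidableEq p]
    (X : Matrix m p ℝ) (K : Finset p) : |∑ j ∈ K, gramResolvent X j j| ≤ K.card := by
  rw [abs_of_nonneg (Finset.sum_nonneg fun j _ => gramResolvent_diag_nonneg X j)]
  simpa using Finset.sum_le_sum fun j (_ : j ∈ K) => gramResolvent_diag_le_one X j

lemma abs_sum_one_sub_gramResolvent_diag_le {m p : Type*} [Fintype m] [Fintype p] [DecidableEq p]
    (X : Matrix m p ℝ) (K : Finset p) : |∑ j ∈ K, (1 - gramResolvent X j j)| ≤ K.card := by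
  rw [abs_of_nonneg (Finset.sum_nonneg fun j _ => sub_nonneg.mpr (gramResolvent_diag_le_one X j))]
  simpa using Finset.sum_le_sum fun j (_ : j ∈ K) =>
    sub_le_self 1 (gramResolvent_diag_nonneg X j)

lemma measurable_sum_gramResolvent_diag {Ω m p : Type*} [TopologicalSpace Ω] [MeasurableSpace Ω]
    [OpensMeasurableSpace Ω] [Fintype m] [Fintype p] [DecidableEq p] {X : Ω → Matrix m p ℝ}
    (hX : Continuous X) (K : Finset p) :
    Measurable fun ω => ∑ j ∈ K, gramResolvent (X ω) j j :=
  (continuous_finsetSum _ fun j _ => (continuous_gramResolvent.comp hX).matrix_elem j j).measurable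

lemma integrable_sum_gramResolvent_diag {Ω m p : Type*} [TopologicalSpace Ω] [MeasurableSpace Ω]
    [OpensMeasurableSpace Ω] {μ : Measure Ω} [IsFiniteMeasure μ] [Fintype m] [Fintype p]
    [DecidableEq p] {X : Ω → Matrix m p ℝ} (hX : Continuous X) (K : Finset p) :
    Integrable (fun ω => ∑ j ∈ K, gramResolvent (X ω) j j) μ :=
  integrable_of_measurable_of_abs_le (measurable_sum_gramResolvent_diag hX K) fun ω =>
    abs_sum_gramResolvent_diag_le (X ω) K

lemma integrable_sum_one_sub_gramResolvent_diag {Ω m p : Type*} [TopologicalSpace Ω]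
    [MeasurableSpace Ω] [OpensMeasurableSpace Ω] {μ : Measure Ω} [IsFiniteMeasure μ] [Fintype m]
    [Fintype p] [DecidableEq p] {X : Ω → Matrix m p ℝ} (hX : Continuous X) (K : Finset p) :
    Integrable (fun ω => ∑ j ∈ K, (1 - gramResolvent (X ω) j j)) μ := by
  simp only [Finset.sum_sub_distrib]
  exact (integrable_const _).sub (integrable_sum_gramResolvent_diag hX K)

lemma integrable_sum_gramResolvent_diag_mul {Ω m p q l : Type*} [TopologicalSpace Ω]
    [MeasurableSpace Ω] [OpensMeasurableSpace Ω] {μ : Measure Ω} [IsFiniteMeasure μ] [Fintype m]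
    [Fintype p] [Fintype q] [Fintype l] [DecidableEq p] [DecidableEq l] {X : Ω → Matrix m p ℝ}
    (hX : Continuous X) {Y : Ω → Matrix q l ℝ} (hY : Continuous Y) (J : Finset p) (K : Finset l) :
    Integrable (fun ω => (∑ j ∈ J, gramResolvent (X ω) j j)
      * ∑ k ∈ K, gramResolvent (Y ω) k k) μ :=
  (integrable_sum_gramResolvent_diag hY K).bdd_mul
    (measurable_sum_gramResolvent_diag hX J).aestronglyMeasurable
    (ae_of_all _ fun ω => abs_sum_gramResolvent_diag_le (X ω) J)

lemma integral_le_integral_mul_div_add {Ω : Type*} [MeasurableSpace Ω] {μ : Measure Ω}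
    [IsProbabilityMeasure μ] {f g : Ω → ℝ} {r : ℝ} (hr : 0 < r) (hf0 : ∀ ω, 0 ≤ f ω)
    (hfg : ∀ ω, f ω ≤ g ω) (hf : Integrable f μ) (hmul : Integrable (fun ω => f ω * g ω) μ) :
    ∫ ω, f ω ∂μ ≤ (∫ ω, f ω * g ω ∂μ) / (2 * r) + r / 2 := by
  have hle (ω : Ω) : f ω ≤ f ω * g ω / (2 * r) + r / 2 := by
    have hsq : f ω * f ω ≤ f ω * g ω := mul_le_mul_of_nonneg_left (hfg ω) (hf0 ω)
    rw [div_add_div _ _ (by positivity) two_ne_zero, le_div_iff₀ (by positivity)]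
    nlinarith [sq_nonneg (f ω - r)]
  have hint := integral_mono hf ((hmul.div_const _).add (integrable_const _)) hle
  simpa only [Pi.add_apply, integral_add (hmul.div_const _) (integrable_const _),
    integral_div, integral_const, probReal_univ, one_smul] using hint

variable {m p : Type*} [Fintype m] [Fintype p] [DecidableEq m] [DecidableEq p]

lemma sum_gramResolvent_diag_eq_of_apply_eq_zero {X : Matrix m p ℝ} {I : Finset m} {J : Finset p}
    (hIJ : I.card = J.card) (hX : ∀ j ∉ J, ∀ i, X i j = 0) :
    ∑ j ∈ J, gramResolvent X j j
      = ∑ i ∈ I, gramResolvent Xᵀ i i - ∑ i ∈ Iᶜ, (1 - gramResolvent Xᵀ i i) := by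
  have htrace := trace_gramResolvent_transpose X
  simp only [trace, diag_apply] at htrace
  rw [← Finset.sum_add_sum_compl I, ← Finset.sum_add_sum_compl J,
    Finset.sum_congr rfl fun j hj => gramResolvent_diag_eq_one (hX j (Finset.mem_compl.mp hj))]
    at htrace
  simp only [Finset.sum_sub_distrib, Finset.sum_const, nsmul_eq_mul, mul_one, Finset.card_compl,
    Nat.cast_sub (Finset.card_le_univ _)] at htrace ⊢
  rw [← hIJ] at htrace
  linarith

variable {O : Matrix m m ℝ} {O' : Matrix p p ℝ} {L N c M : ℝ} {ν : Measure ℝ}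

lemma norm_diagonal_mul_le {d : m → ℝ} (hL : 0 ≤ L) (hd : ∀ i, |d i| ≤ L) (hO : Oᵀ * O = 1) :
    ‖diagonal d * O‖ ≤ L := by
  simpa using l2_opNorm_mul_le_of_le (norm_diagonal_le hL hd)
    (l2_opNorm_le_one_of_transpose_mul_self hO)

lemma norm_mul_diagonal_le {d : m → ℝ} (hL : 0 ≤ L) (hd : ∀ i, |d i| ≤ L) (hO : Oᵀ * O = 1) :
    ‖O * diagonal d‖ ≤ L := by
  simpa using l2_opNorm_mul_le_of_le (l2_opNorm_le_one_of_transpose_mul_self hO)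
    (norm_diagonal_le hL hd)

lemma trace_mul_diagonal_mul_mul_transpose (hO : Oᵀ * O = 1) (e : m → ℝ) (Q : Matrix m m ℝ) :
    (O * diagonal e * Q * (O * diagonal e)ᵀ).trace = ∑ j, e j ^ 2 * Q j j := by
  have hcycle : (O * diagonal e * Q * (O * diagonal e)ᵀ).trace
      = (diagonal e * (diagonal e * Q)).trace := by
    rw [transpose_mul, diagonal_transpose, trace_mul_comm, Matrix.mul_assoc, ← Matrix.mul_assoc Oᵀ,
      ← Matrix.mul_assoc Oᵀ, hO, Matrix.one_mul]
  rw [hcycle]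
  simp only [trace, diag_apply, diagonal_mul, sq, mul_assoc]

lemma trace_transpose_mul_mul_diagonal_mul (hO : Oᵀ * O = 1) (d θ : m → ℝ) (Q : Matrix m m ℝ) :
    ((diagonal d * O)ᵀ * Q * (diagonal θ * (diagonal d * O))).trace
      = ∑ i, θ i * (d i ^ 2 * Q i i) := by
  have hcycle : ((diagonal d * O)ᵀ * Q * (diagonal θ * (diagonal d * O))).trace
      = (diagonal d * Q * diagonal θ * diagonal d).trace := by
    rw [transpose_mul, diagonal_transpose, Matrix.mul_assoc, Matrix.mul_assoc, trace_mul_comm]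
    simp only [Matrix.mul_assoc, mul_eq_one_comm.mp hO, Matrix.mul_one]
  rw [hcycle]
  simp only [trace, diag_apply, mul_diagonal, diagonal_mul]
  exact Finset.sum_congr rfl fun i _ => by ring

/-- The error, relative to `√N`, of the integration by parts formula for matrices of the form
`N^(-1/2) • (A * W * B)` with `‖A‖ ≤ L`, `‖B‖ ≤ 1` and dimensions at most `c * N`. -/
noncomputable def steinError (c M L : ℝ) : ℝ := c * L ^ 2 + 8 * c ^ 2 * L ^ 3 * (M + 1)

lemma steinError_nonneg (hc : 0 ≤ c) (hM : 0 ≤ M) (hL : 0 ≤ L) : 0 ≤ steinError c M L := by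
  rw [steinError]
  positivity

lemma mul_self_div_sqrt_pow_three (hN : 0 < N) : N * N / √N ^ 3 = √N := by
  have hsqrt : √N * √N = N := Real.mul_self_sqrt hN.le
  rw [div_eq_iff (by positivity)]
  calc N * N = (√N * √N) * (√N * √N) := by rw [hsqrt]
    _ = √N * √N ^ 3 := by ring

lemma le_steinError_mul_sqrt (hL : 0 ≤ L) (hM : 0 ≤ M) (hN : 1 ≤ N) (hc : 0 ≤ c) {k₁ k₂ : ℝ}
    (hk₂ : 0 ≤ k₂) (hk₁c : k₁ ≤ c * N) (hk₂c : k₂ ≤ c * N) :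
    (1 / √N) ^ 2 * (k₁ * (L * 1) ^ 2) + k₁ * k₂ * (8 * (1 / √N * L * 1) ^ 3 * (M + 1))
      ≤ steinError c M L * √N := by
  have hN0 : 0 < N := one_pos.trans_le hN
  have hsq : (1 / √N) ^ 2 = 1 / N := by rw [div_pow, one_pow, Real.sq_sqrt hN0.le]
  rw [steinError, add_mul]
  refine add_le_add ?_ ?_
  · calc (1 / √N) ^ 2 * (k₁ * (L * 1) ^ 2) ≤ 1 / N * (c * N * (L * 1) ^ 2) := by rw [hsq]; gcongr
      _ = c * L ^ 2 := by field_simp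
      _ ≤ c * L ^ 2 * √N := le_mul_of_one_le_right (by positivity) (Real.one_le_sqrt.mpr hN)
  · calc k₁ * k₂ * (8 * (1 / √N * L * 1) ^ 3 * (M + 1))
        ≤ (c * N) * (c * N) * (8 * (1 / √N * L * 1) ^ 3 * (M + 1)) := by gcongr
      _ = 8 * c ^ 2 * L ^ 3 * (M + 1) * (N * N / √N ^ 3) := by field_simp
      _ = 8 * c ^ 2 * L ^ 3 * (M + 1) * √N := by rw [mul_self_div_sqrt_pow_three hN0]

lemma IsStandardized.abs_integral_sum_gramResolvent_diag_sub_le (h : IsStandardized ν M)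
    (hO : Oᵀ * O = 1) (hO' : O'ᵀ * O' = 1) {d θ : m → ℝ} {e : p → ℝ} (hL : 0 ≤ L) (hN : 1 ≤ N)
    (hc : 0 ≤ c) (hm : Fintype.card m ≤ c * N) (hp : Fintype.card p ≤ c * N)
    (hd : ∀ i, |d i| ≤ L) (hθ : ∀ i, |θ i| ≤ 1) (he : ∀ j, |e j| ≤ 1)
    {X : (m × p → ℝ) → Matrix m p ℝ}
    (hX : X = sandwich (1 / √N) (diagonal d * O) (O' * diagonal e)) :
    |∫ x, (∑ i, θ i * (1 - gramResolvent (X x)ᵀ i i)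
        - 1 / N * ((∑ j, e j ^ 2 * gramResolvent (X x) j j)
          * ∑ i, θ i * (d i ^ 2 * gramResolvent (X x)ᵀ i i))) ∂Measure.pi fun _ : m × p => ν|
      ≤ steinError c M L * √N := by
  refine le_trans (le_of_eq ?_) ((h.abs_integral_trace_gramResolvent_sub_le
    (one_div_nonneg.mpr N.sqrt_nonneg) (norm_diagonal_mul_le hL hd hO)
    (norm_mul_diagonal_le zero_le_one he hO') (norm_diagonal_le zero_le_one hθ)).trans
    (le_steinError_mul_sqrt hL h.nonneg hN hc (Nat.cast_nonneg _) hm hp))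
  congr 1
  refine integral_congr_ae (ae_of_all _ fun x => ?_)
  simp only [trace_mul_diagonal_mul_mul_transpose hO', trace_transpose_mul_mul_diagonal_mul hO,
    ← hX, div_pow, one_pow, Real.sq_sqrt (zero_le_one.trans hN)]
  simp only [trace, diag_apply, diagonal_mul, diagonal_apply_eq, mul_sub, mul_one,
    Finset.sum_sub_distrib]

/-- The matrix `N^(-1/2) • (D * O * W * O' * 1_J)`, where `D` has the weight `L` on `I` and `1` off
`I`, and `W` has the entries `x`. The mass of its resolvent on `I` controls the effect of truncating
the large weights of a weighted matrix at the level `L`. -/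
noncomputable def spikedSandwich (N L : ℝ) (O : Matrix m m ℝ) (O' : Matrix p p ℝ) (I : Finset m)
    (J : Finset p) : (m × p → ℝ) → Matrix m p ℝ :=
  sandwich (1 / √N) (diagonal (fun i => if i ∈ I then L else 1) * O)
    (O' * diagonal (fun j => if j ∈ J then 1 else 0))

lemma spikedSandwich_apply_eq_zero (N L : ℝ) (O : Matrix m m ℝ) (O' : Matrix p p ℝ) (I : Finset m)
    {J : Finset p} (x : m × p → ℝ) (i : m) {j : p} (hj : j ∉ J) :
    spikedSandwich N L O O' I J x i j = 0 := by
  simp [spikedSandwich, sandwich, ← Matrix.mul_assoc, mul_diagonal, hj]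

lemma continuous_spikedSandwich (N L : ℝ) (O : Matrix m m ℝ) (O' : Matrix p p ℝ) (I : Finset m)
    (J : Finset p) : Continuous (spikedSandwich N L O O' I J) :=
  continuous_sandwich _ _ _

lemma IsStandardized.abs_integral_spikedSandwich_sub_le (h : IsStandardized ν M) (hO : Oᵀ * O = 1)
    (hO' : O'ᵀ * O' = 1) (hL : 1 ≤ L) (hN : 1 ≤ N) (hc : 0 ≤ c) (hm : Fintype.card m ≤ c * N)
    (hp : Fintype.card p ≤ c * N) {I K : Finset m} (J : Finset p) {w : ℝ}
    (hK : ∀ i ∈ K, (if i ∈ I then L else 1) = w) {X : (m × p → ℝ) → Matrix m p ℝ}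
    (hX : X = spikedSandwich N L O O' I J) :
    |∫ x, ∑ i ∈ K, (1 - gramResolvent (X x)ᵀ i i) ∂Measure.pi (fun _ : m × p => ν)
        - w ^ 2 / N * ∫ x, (∑ j ∈ J, gramResolvent (X x) j j)
          * ∑ i ∈ K, gramResolvent (X x)ᵀ i i ∂Measure.pi (fun _ : m × p => ν)|
      ≤ steinError c M L * √N := by
  have := h.isProbabilityMeasure
  have hL0 : 0 ≤ L := zero_le_one.trans hL
  have hXc : Continuous X := hX ▸ continuous_spikedSandwich N L O O' I J
  rw [← integral_const_mul, ← integral_sub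
    (integrable_sum_one_sub_gramResolvent_diag hXc.matrix_transpose K)
    ((integrable_sum_gramResolvent_diag_mul hXc hXc.matrix_transpose J K).const_mul _)]
  refine le_trans (le_of_eq ?_) (h.abs_integral_sum_gramResolvent_diag_sub_le hO hO' hL0 hN hc hm
    hp (fun i => ?_) (θ := fun i => if i ∈ K then 1 else 0) (fun i => ?_) (fun j => ?_) hX)
  · congr 1
    refine integral_congr_ae (ae_of_all _ fun x => ?_)
    have hweight : ∑ i ∈ K, (if i ∈ I then L else 1) ^ 2 * gramResolvent (X x)ᵀ i i
        = w ^ 2 * ∑ i ∈ K, gramResolvent (X x)ᵀ i i := by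
      rw [Finset.mul_sum]
      exact Finset.sum_congr rfl fun i hi => by rw [hK i hi]
    have hindicator : ∑ j, (if j ∈ J then (1 : ℝ) else 0) ^ 2 * gramResolvent (X x) j j
        = ∑ j ∈ J, gramResolvent (X x) j j := by simp
    simp only [hindicator, ite_mul, one_mul, zero_mul, Finset.sum_ite_mem, Finset.univ_inter,
      hweight]
    ring
  · split_ifs
    · exact (abs_of_nonneg hL0).le
    · simpa using hL
  · split_ifs <;> simp
  · split_ifs <;> simp

lemma IsStandardized.integral_sum_gramResolvent_diag_mul_le (h : IsStandardized ν M)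
    (hO : Oᵀ * O = 1) (hO' : O'ᵀ * O' = 1) (hL : 1 ≤ L) (hN : 1 ≤ N) (hc : 0 ≤ c)
    (hm : Fintype.card m ≤ c * N) (hp : Fintype.card p ≤ c * N) (I : Finset m) (J : Finset p)
    {X : (m × p → ℝ) → Matrix m p ℝ} (hX : X = spikedSandwich N L O O' I J) :
    ∫ x, (∑ j ∈ J, gramResolvent (X x) j j) * ∑ i ∈ I, gramResolvent (X x)ᵀ i i
        ∂Measure.pi (fun _ : m × p => ν)
      ≤ N / L ^ 2 * (c * N + steinError c M L * √N) := by
  have := h.isProbabilityMeasure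
  have : 0 < L := one_pos.trans_le hL
  have : 0 < N := one_pos.trans_le hN
  have hstein := abs_le.mp (h.abs_integral_spikedSandwich_sub_le hO hO' hL hN hc hm hp (K := I) J
    (fun i hi => if_pos hi) hX)
  have hcard := abs_le.mp (abs_integral_le_of_forall_abs_le (μ := Measure.pi fun _ : m × p => ν)
    fun x => abs_sum_one_sub_gramResolvent_diag_le (X x)ᵀ I)
  have hIm : (I.card : ℝ) ≤ c * N := (Nat.cast_le.mpr (Finset.card_le_univ I)).trans hm
  rw [← div_le_iff₀' (by positivity), div_div_eq_mul_div, mul_comm, mul_div_right_comm]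
  linarith [hstein.1, hcard.2]

lemma IsStandardized.integral_sum_gramResolvent_diag_sub_le (h : IsStandardized ν M)
    (hO : Oᵀ * O = 1) (hO' : O'ᵀ * O' = 1) (hL : 1 ≤ L) (hN : 1 ≤ N) (hc : 0 ≤ c)
    (hm : Fintype.card m ≤ c * N) (hp : Fintype.card p ≤ c * N) {I : Finset m} {J : Finset p}
    (hIJ : I.card = J.card) {X : (m × p → ℝ) → Matrix m p ℝ}
    (hX : X = spikedSandwich N L O O' I J) :
    ∫ x, ∑ i ∈ I, gramResolvent (X x)ᵀ i i ∂Measure.pi (fun _ : m × p => ν)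
      ≤ (1 + c) * ∫ x, ∑ j ∈ J, gramResolvent (X x) j j ∂Measure.pi (fun _ : m × p => ν)
        + steinError c M L * √N := by
  have := h.isProbabilityMeasure
  have hN0 : 0 < N := one_pos.trans_le hN
  have hXc : Continuous X := hX ▸ continuous_spikedSandwich N L O O' I J
  set P := Measure.pi fun _ : m × p => ν
  have hstein := (abs_le.mp (h.abs_integral_spikedSandwich_sub_le hO hO' hL hN hc hm hp (K := Iᶜ) J
    (fun i hi => if_neg (Finset.mem_compl.mp hi)) hX)).2
  have htrace : ∫ x, ∑ j ∈ J, gramResolvent (X x) j j ∂P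
      = ∫ x, ∑ i ∈ I, gramResolvent (X x)ᵀ i i ∂P
        - ∫ x, ∑ i ∈ Iᶜ, (1 - gramResolvent (X x)ᵀ i i) ∂P := by
    rw [← integral_sub (integrable_sum_gramResolvent_diag hXc.matrix_transpose I)
      (integrable_sum_one_sub_gramResolvent_diag hXc.matrix_transpose Iᶜ)]
    exact integral_congr_ae (ae_of_all _ fun x =>
      sum_gramResolvent_diag_eq_of_apply_eq_zero hIJ fun j hj i => by
        rw [hX, spikedSandwich_apply_eq_zero _ _ _ _ _ _ _ hj])
  have hmul : ∫ x, (∑ j ∈ J, gramResolvent (X x) j j) * ∑ i ∈ Iᶜ, gramResolvent (X x)ᵀ i i ∂P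
      ≤ (∫ x, ∑ j ∈ J, gramResolvent (X x) j j ∂P) * (c * N) := by
    rw [← integral_mul_const]
    refine integral_mono (integrable_sum_gramResolvent_diag_mul hXc hXc.matrix_transpose J Iᶜ)
      ((integrable_sum_gramResolvent_diag hXc J).mul_const _) fun x => ?_
    refine mul_le_mul_of_nonneg_left ?_ (Finset.sum_nonneg fun j _ => gramResolvent_diag_nonneg _ j)
    exact (le_abs_self _).trans ((abs_sum_gramResolvent_diag_le _ _).trans
      ((Nat.cast_le.mpr (Finset.card_le_univ Iᶜ)).trans hm))
  have hscaled : 1 / N * ∫ x, (∑ j ∈ J, gramResolvent (X x) j j)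
        * ∑ i ∈ Iᶜ, gramResolvent (X x)ᵀ i i ∂P
      ≤ c * ∫ x, ∑ j ∈ J, gramResolvent (X x) j j ∂P :=
    (mul_le_mul_of_nonneg_left hmul (one_div_nonneg.mpr hN0.le)).trans_eq (by field_simp)
  rw [one_pow] at hstein
  linarith

lemma IsStandardized.integral_sum_gramResolvent_diag_le (h : IsStandardized ν M)
    (hO : Oᵀ * O = 1) (hO' : O'ᵀ * O' = 1) {I : Finset m} {J : Finset p} (hIJ : I.card = J.card)
    (hL : 1 ≤ L) (hN : 1 ≤ N) (hc : 0 ≤ c) (hm : Fintype.card m ≤ c * N)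
    (hp : Fintype.card p ≤ c * N) :
    ∫ x, ∑ i ∈ I, gramResolvent (spikedSandwich N L O O' I J x)ᵀ i i
        ∂Measure.pi (fun _ : m × p => ν)
      ≤ (1 + c) ^ 2 * (N / L) + (2 + c) * (steinError c M L * √N) := by
  have := h.isProbabilityMeasure
  have hL0 : 0 < L := one_pos.trans_le hL
  have : 0 < N := one_pos.trans_le hN
  set X := spikedSandwich N L O O' I J with hX
  have hXc : Continuous X := continuous_spikedSandwich N L O O' I J
  set P := Measure.pi fun _ : m × p => ν
  set E := steinError c M L * √N
  have hE0 : 0 ≤ E := mul_nonneg (steinError_nonneg hc h.nonneg hL0.le) (Real.sqrt_nonneg N)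
  have hle (x : m × p → ℝ) :
      ∑ j ∈ J, gramResolvent (X x) j j ≤ ∑ i ∈ I, gramResolvent (X x)ᵀ i i := by
    rw [sum_gramResolvent_diag_eq_of_apply_eq_zero hIJ fun j hj i =>
      spikedSandwich_apply_eq_zero N L O O' I x i hj]
    exact sub_le_self _ (Finset.sum_nonneg fun i _ =>
      sub_nonneg.mpr (gramResolvent_diag_le_one _ i))
  have hcolumns : ∫ x, ∑ j ∈ J, gramResolvent (X x) j j ∂P ≤ (1 + c) / 2 * (N / L) + E / 2 :=
    calc ∫ x, ∑ j ∈ J, gramResolvent (X x) j j ∂P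
        ≤ (∫ x, (∑ j ∈ J, gramResolvent (X x) j j) * ∑ i ∈ I, gramResolvent (X x)ᵀ i i ∂P)
            / (2 * (N / L)) + N / L / 2 :=
          integral_le_integral_mul_div_add (by positivity)
            (fun x => Finset.sum_nonneg fun j _ => gramResolvent_diag_nonneg _ j) hle
            (integrable_sum_gramResolvent_diag hXc J)
            (integrable_sum_gramResolvent_diag_mul hXc hXc.matrix_transpose J I)
      _ ≤ N / L ^ 2 * (c * N + E) / (2 * (N / L)) + N / L / 2 := by
          gcongr
          exact h.integral_sum_gramResolvent_diag_mul_le hO hO' hL hN hc hm hp I J hX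
      _ = (1 + c) / 2 * (N / L) + E / L / 2 := by field_simp; ring
      _ ≤ (1 + c) / 2 * (N / L) + E / 2 := by gcongr; exact div_le_self hE0 hL
  have hrows := h.integral_sum_gramResolvent_diag_sub_le hO hO' hL hN hc hm hp hIJ hX
  have hscaled := mul_le_mul_of_nonneg_left hcolumns (by positivity : 0 ≤ 1 + c)
  have hNL : 0 ≤ (1 + c) ^ 2 * (N / L) := by positivity
  have hcE : 0 ≤ c * E := mul_nonneg hc hE0
  linarith

end SmallSingularValues

section Truncation

open Matrix
open scoped Matrix.Norms.L2Operator

variable {m p : Type*} [Fintype m] [Fintype p] [DecidableEq m] [DecidableEq p]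

lemma dotProduct_self_le_dotProduct_self {p : Type*} [Fintype p] {x y : p → ℝ}
    (h : ∀ i, |x i| ≤ |y i|) : x ⬝ᵥ x ≤ y ⬝ᵥ y :=
  Finset.sum_le_sum fun i _ => abs_le_iff_mul_self_le.mp (h i)

lemma diagonal_mul_mul_diagonal_mulVec (Y : Matrix m p ℝ) (u : m → ℝ) (v x : p → ℝ) :
    (diagonal u * Y * diagonal v) *ᵥ x = fun i => u i * (Y *ᵥ fun j => v j * x j) i := by
  have hx : diagonal v *ᵥ x = fun j => v j * x j := funext (mulVec_diagonal v x)
  rw [← mulVec_mulVec, ← mulVec_mulVec, hx]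
  exact funext (mulVec_diagonal u _)

-- A test vector `x` for the smaller weights is turned into the test vector `c x` for the larger
-- inner weights: the image is unchanged and the norm does not increase.
lemma gramResolvent_diagonal_mul_mul_diagonal_diag_le {Y : Matrix m p ℝ} {u u' : m → ℝ}
    {v v' : p → ℝ} (hu : ∀ i, |u' i| ≤ |u i|) {c : p → ℝ} (hc : ∀ j, |c j| ≤ 1)
    (hv : ∀ j, v' j * c j = v j) {j : p} (hj : c j = 1) :
    gramResolvent (diagonal u * Y * diagonal v) j j
      ≤ gramResolvent (diagonal u' * Y * diagonal v') j j := by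
  refine gramResolvent_diag_le_of_forall_exists fun x =>
    ⟨fun k => c k * x k, by simp [hj], add_le_add ?_ ?_⟩
  · refine dotProduct_self_le_dotProduct_self fun i => ?_
    rw [abs_mul]
    exact mul_le_of_le_one_left (abs_nonneg _) (hc i)
  · simp only [diagonal_mul_mul_diagonal_mulVec, ← mul_assoc, hv]
    refine dotProduct_self_le_dotProduct_self fun i => ?_
    rw [abs_mul, abs_mul]
    exact mul_le_mul_of_nonneg_right (hu i) (abs_nonneg _)

section Pathwise

variable (Y : Matrix m p ℝ) {u : m → ℝ} {v : p → ℝ} {L : ℝ}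

lemma gramResolvent_min_diag_le (u : m → ℝ) (hL : 0 < L) {j : p} (hj : v j ≤ L) :
    gramResolvent (diagonal u * Y * diagonal fun k => min (v k) L) j j
      ≤ gramResolvent (diagonal u * Y * diagonal v) j j := by
  refine gramResolvent_diagonal_mul_mul_diagonal_diag_le (fun _ => le_rfl)
    (c := fun k => if v k ≤ L then 1 else L / v k) (fun k => ?_) (fun k => ?_) (if_pos hj)
  · split_ifs with hk
    · exact abs_one.le
    · have hvk : 0 < v k := hL.trans (not_le.mp hk)
      rw [abs_of_pos (div_pos hL hvk)]
      exact (div_le_one hvk).mpr (not_le.mp hk).le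
  · split_ifs with hk
    · rw [min_eq_left hk, mul_one]
    · rw [min_eq_right (not_le.mp hk).le, mul_div_cancel₀ _ (hL.trans (not_le.mp hk)).ne']

variable {I : Finset p} {J : Finset m} (hJ : ∀ i ∈ J, 1 ≤ u i)

include hJ in
lemma gramResolvent_min_diag_le_spiked (hL : 0 < L) (hv : ∀ k, 0 ≤ v k)
    (hI : ∀ k ∉ I, v k ≤ 1) {j : p} (hj : j ∈ I) (hvj : L ≤ v j) :
    gramResolvent (diagonal u * Y * diagonal fun k => min (v k) L) j j
      ≤ gramResolvent (diagonal (fun i => if i ∈ J then (1 : ℝ) else 0) * Y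
        * diagonal fun k => if k ∈ I then L else (1 : ℝ)) j j := by
  have hmin (k : p) : 0 ≤ min (v k) L := le_min (hv k) hL.le
  refine gramResolvent_diagonal_mul_mul_diagonal_diag_le (fun i => ?_)
    (c := fun k => if k ∈ I then min (v k) L / L else min (v k) L) (fun k => ?_) (fun k => ?_) ?_
  · split_ifs with hi
    · rw [abs_one]
      exact (hJ i hi).trans (le_abs_self _)
    · simp
  · split_ifs with hk
    · rw [abs_of_nonneg (div_nonneg (hmin k) hL.le)]
      exact (div_le_one hL).mpr (min_le_right _ _)
    · rw [abs_of_nonneg (hmin k)]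
      exact (min_le_left _ _).trans (hI k hk)
  · split_ifs
    · exact mul_div_cancel₀ _ hL.ne'
    · exact one_mul _
  · rw [if_pos hj, min_eq_right hvj, div_self hL.ne']

include hJ in
lemma trace_gramResolvent_min_sub_le (hL : 1 ≤ L) (hv : ∀ k, 0 ≤ v k) (hI : ∀ k ∉ I, v k ≤ 1) :
    (gramResolvent (diagonal u * Y * diagonal fun k => min (v k) L)).trace
        - (gramResolvent (diagonal u * Y * diagonal v)).trace
      ≤ ∑ j ∈ I, gramResolvent (diagonal (fun i => if i ∈ J then (1 : ℝ) else 0) * Y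
        * diagonal fun k => if k ∈ I then L else (1 : ℝ)) j j := by
  have hL0 : 0 < L := one_pos.trans_le hL
  rw [trace, trace, ← Finset.sum_sub_distrib, ← Finset.sum_add_sum_compl I]
  refine add_le_of_le_of_nonpos (Finset.sum_le_sum fun j hj => ?_)
    (Finset.sum_nonpos fun j hj => sub_nonpos.mpr
      (gramResolvent_min_diag_le Y u hL0 ((hI j (Finset.mem_compl.mp hj)).trans hL)))
  rcases le_total (v j) L with hvj | hvj
  · exact (sub_nonpos.mpr (gramResolvent_min_diag_le Y u hL0 hvj)).trans
      (gramResolvent_diag_nonneg _ j)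
  · exact (sub_le_self _ (gramResolvent_diag_nonneg _ j)).trans
      (gramResolvent_min_diag_le_spiked Y hJ hL0 hv hI hj hvj)

end Pathwise

lemma abs_trace_gramResolvent_sub_min_le (Y : Matrix m p ℝ) {u : m → ℝ} {v : p → ℝ} {L : ℝ}
    (hu : ∀ i, 0 ≤ u i) (hL : 1 ≤ L) {I : Finset m} (hI : ∀ i ∉ I, u i ≤ 1) {J : Finset p}
    (hJ : ∀ j ∈ J, 1 ≤ v j) :
    |(gramResolvent (diagonal u * Y * diagonal v)).trace
        - (gramResolvent (diagonal (fun i => min (u i) L) * Y * diagonal v)).trace|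
      ≤ ∑ i ∈ I, gramResolvent (diagonal (fun i => if i ∈ I then L else 1) * Y
        * diagonal fun j => if j ∈ J then (1 : ℝ) else 0)ᵀ i i := by
  have hL0 : 0 ≤ L := zero_le_one.trans hL
  have hle : (gramResolvent (diagonal u * Y * diagonal v)).trace
      ≤ (gramResolvent (diagonal (fun i => min (u i) L) * Y * diagonal v)).trace :=
    Finset.sum_le_sum fun j _ => gramResolvent_diagonal_mul_mul_diagonal_diag_le
      (fun i => abs_le_abs_of_nonneg (le_min (hu i) hL0) (min_le_left _ _))
      (c := fun _ => 1) (fun _ => abs_one.le) (fun _ => mul_one _) rfl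
  have htranspose (d : m → ℝ) (e : p → ℝ) :
      (diagonal d * Y * diagonal e)ᵀ = diagonal e * Yᵀ * diagonal d := by
    simp [transpose_mul, Matrix.mul_assoc]
  have hrows := trace_gramResolvent_min_sub_le Yᵀ hJ hL hu hI
  rw [← htranspose u v, ← htranspose (fun i => min (u i) L) v] at hrows
  rw [abs_of_nonpos (sub_nonpos.mpr hle), htranspose]
  linarith [trace_gramResolvent_transpose (diagonal u * Y * diagonal v),
    trace_gramResolvent_transpose (diagonal (fun i => min (u i) L) * Y * diagonal v)]

lemma sandwich_diagonal_mul_mul_diagonal (s : ℝ) (u : m → ℝ) (v : p → ℝ) (O : Matrix m m ℝ)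
    (O' : Matrix p p ℝ) (x : m × p → ℝ) :
    sandwich s (diagonal u * O) (O' * diagonal v) x
      = diagonal u * sandwich s O O' x * diagonal v := by
  simp only [sandwich, Matrix.mul_smul, Matrix.smul_mul, Matrix.mul_assoc]

lemma sandwich_transpose {m p : Type*} [Fintype m] [Fintype p] (s : ℝ) (A : Matrix m m ℝ)
    (B : Matrix p p ℝ) (x : m × p → ℝ) :
    (sandwich s A B x)ᵀ = sandwich s Bᵀ Aᵀ (fun k => x k.swap) := by
  simp only [sandwich, transpose_smul, transpose_mul, Matrix.mul_assoc]
  rfl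

lemma integral_pi_comp_swap {m p : Type*} [Fintype m] [Fintype p] (ν : Measure ℝ)
    [IsProbabilityMeasure ν] (F : (p × m → ℝ) → ℝ) :
    ∫ x, F (fun k => x k.swap) ∂Measure.pi (fun _ : m × p => ν)
      = ∫ x, F x ∂Measure.pi (fun _ : p × m => ν) := by
  rw [← (measurePreserving_piCongrLeft (fun _ : p × m => ν) (Equiv.prodComm m p)).integral_comp' F]
  rfl

omit [DecidableEq m] in
lemma integrable_trace_gramResolvent_sandwich {μ : Measure (m × p → ℝ)} [IsFiniteMeasure μ]
    (s : ℝ) (A : Matrix m m ℝ) (B : Matrix p p ℝ) :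
    Integrable (fun x => (gramResolvent (sandwich s A B x)).trace) μ :=
  integrable_sum_gramResolvent_diag (continuous_sandwich s A B) Finset.univ

/-- The expected trace of the resolvent of `s • (A * W * B)` when `W` has independent entries of law
`ν`. -/
noncomputable def meanResolventTrace (ν : Measure ℝ) (s : ℝ) (A : Matrix m m ℝ)
    (B : Matrix p p ℝ) : ℝ :=
  ∫ x, (gramResolvent (sandwich s A B x)).trace ∂Measure.pi fun _ : m × p => ν

lemma meanResolventTrace_eq_transpose (ν : Measure ℝ) [IsProbabilityMeasure ν] (s : ℝ)
    (A : Matrix m m ℝ) (B : Matrix p p ℝ) :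
    meanResolventTrace ν s A B
      = meanResolventTrace ν s Bᵀ Aᵀ + (Fintype.card p - Fintype.card m) := by
  have htrace (x : m × p → ℝ) : (gramResolvent (sandwich s A B x)).trace
      = (gramResolvent (sandwich s Bᵀ Aᵀ fun k => x k.swap)).trace
        + (Fintype.card p - Fintype.card m) := by
    rw [← sandwich_transpose]
    linarith [trace_gramResolvent_transpose (sandwich s A B x)]
  have hswap : Continuous fun x : m × p → ℝ => fun k : p × m => x k.swap := by fun_prop
  have hint : Integrable (fun x : m × p → ℝ =>
      (gramResolvent (sandwich s Bᵀ Aᵀ fun k => x k.swap)).trace) (Measure.pi fun _ => ν) :=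
    integrable_sum_gramResolvent_diag ((continuous_sandwich s Bᵀ Aᵀ).comp hswap) Finset.univ
  simp only [meanResolventTrace, htrace]
  rw [integral_add hint (integrable_const _), integral_const, probReal_univ, one_smul,
    ← integral_pi_comp_swap ν fun x => (gramResolvent (sandwich s Bᵀ Aᵀ x)).trace]

variable {ν ν₁ ν₂ : Measure ℝ} {M L N c : ℝ}

/-- The error of truncating the weights of an `m × p` matrix with `m, p ≤ c N` at the level `L`. -/
noncomputable def truncationError (c M L N : ℝ) : ℝ :=
  (1 + c) ^ 2 * (N / L) + (2 + c) * (steinError c M L * √N)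

section OrthogonalFactors

variable {O : Matrix m m ℝ} {O' : Matrix p p ℝ} {u : m → ℝ} {v : p → ℝ}

lemma IsStandardized.abs_meanResolventTrace_sub_min_left_le (h : IsStandardized ν M)
    (hO : Oᵀ * O = 1) (hO' : O'ᵀ * O' = 1) (hu : ∀ i, 0 ≤ u i)
    (huv : (Finset.univ.filter fun i => 1 < u i).card ≤ (Finset.univ.filter fun j => 1 ≤ v j).card)
    (hL : 1 ≤ L) (hN : 1 ≤ N) (hc : 0 ≤ c) (hm : Fintype.card m ≤ c * N)
    (hp : Fintype.card p ≤ c * N) :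
    |meanResolventTrace ν (1 / √N) (diagonal u * O) (O' * diagonal v)
        - meanResolventTrace ν (1 / √N) (diagonal (fun i => min (u i) L) * O) (O' * diagonal v)|
      ≤ truncationError c M L N := by
  have := h.isProbabilityMeasure
  obtain ⟨J, hJ, hcard⟩ := Finset.exists_subset_card_eq huv
  refine le_trans ?_ (h.integral_sum_gramResolvent_diag_le hO hO' hcard.symm hL hN hc hm hp)
  have hint (w : m → ℝ) := integrable_trace_gramResolvent_sandwich
    (μ := Measure.pi fun _ : m × p => ν) (1 / √N) (diagonal w * O) (O' * diagonal v)
  rw [meanResolventTrace, meanResolventTrace, ← integral_sub (hint u) (hint _)]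
  refine abs_integral_le_integral_abs.trans (integral_mono ((hint u).sub (hint _)).abs
    (integrable_sum_gramResolvent_diag
      (continuous_spikedSandwich N L O O' _ J).matrix_transpose _) fun x => ?_)
  simp only [spikedSandwich, sandwich_diagonal_mul_mul_diagonal]
  exact abs_trace_gramResolvent_sub_min_le _ hu hL (by simp)
    fun j hj => (Finset.mem_filter.mp (hJ hj)).2

lemma IsStandardized.abs_meanResolventTrace_sub_min_right_le (h : IsStandardized ν M)
    (hO : Oᵀ * O = 1) (hO' : O'ᵀ * O' = 1) (hv : ∀ j, 0 ≤ v j)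
    (hvu : (Finset.univ.filter fun j => 1 < v j).card ≤ (Finset.univ.filter fun i => 1 ≤ u i).card)
    (hL : 1 ≤ L) (hN : 1 ≤ N) (hc : 0 ≤ c) (hm : Fintype.card m ≤ c * N)
    (hp : Fintype.card p ≤ c * N) :
    |meanResolventTrace ν (1 / √N) (diagonal u * O) (O' * diagonal v)
        - meanResolventTrace ν (1 / √N) (diagonal u * O) (O' * diagonal fun j => min (v j) L)|
      ≤ truncationError c M L N := by
  have := h.isProbabilityMeasure
  have hleft := h.abs_meanResolventTrace_sub_min_left_le
    (by rw [transpose_transpose]; exact mul_eq_one_comm.mp hO' : O'ᵀᵀ * O'ᵀ = 1)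
    (by rw [transpose_transpose]; exact mul_eq_one_comm.mp hO : Oᵀᵀ * Oᵀ = 1)
    hv hvu hL hN hc hp hm
  rw [meanResolventTrace_eq_transpose, meanResolventTrace_eq_transpose ν _ _
    (O' * diagonal fun j => min (v j) L), add_sub_add_right_eq_sub]
  simpa only [transpose_mul, diagonal_transpose] using hleft

end OrthogonalFactors

lemma IsStandardized.abs_meanResolventTrace_sub_le_of_norm_le (h₁ : IsStandardized ν₁ M)
    (h₂ : IsStandardized ν₂ M) {A : Matrix m m ℝ} {B : Matrix p p ℝ} (hA : ‖A‖ ≤ L) (hB : ‖B‖ ≤ L)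
    (hN : 1 ≤ N) (hc : 0 ≤ c) (hm : Fintype.card m ≤ c * N) (hp : Fintype.card p ≤ c * N) :
    |meanResolventTrace ν₁ (1 / √N) A B - meanResolventTrace ν₂ (1 / √N) A B|
      ≤ 16 * c ^ 2 * L ^ 6 * M * √N := by
  have hM := h₁.nonneg
  have hN0 : 0 < N := one_pos.trans_le hN
  have hL : 0 ≤ L := (norm_nonneg _).trans hA
  have hs : |1 / √N| * (‖A‖ * ‖B‖) ≤ 1 / √N * (L * L) := by
    rw [abs_of_nonneg (by positivity)]
    gcongr
  have hlindeberg := abs_integral_pi_sub_integral_pi_le h₁ h₂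
    (F := fun x => (gramResolvent (sandwich (1 / √N) A B x)).trace)
    ((continuous_gramResolvent.comp (continuous_sandwich _ A B)).matrix_trace.measurable)
    (b := Fintype.card p) (C := (2 * (1 / √N * (L * L))) ^ 3)
    (fun x => abs_trace_gramResolvent_le _) fun x ⟨i, j⟩ => by
      obtain ⟨c₀, c₁, c₂, happrox⟩ := exists_trace_gramResolvent_add_smul_approx
        (sandwich (1 / √N) A B (Function.update x (i, j) 0))
        ((norm_entryDirection_le _ A B i j).trans hs)
        fun Q => (abs_trace_mul_entryDirection_le ..).trans
          (mul_le_mul_of_nonneg_right hs (norm_nonneg Q))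
      exact ⟨c₀, c₁, c₂, fun z => by simpa only [← sandwich_update] using happrox z⟩
  refine hlindeberg.trans ?_
  rw [Fintype.card_prod, Nat.cast_mul]
  calc (Fintype.card m * Fintype.card p : ℝ) * ((2 * (1 / √N * (L * L))) ^ 3 * (2 * M))
      ≤ (c * N) * (c * N) * ((2 * (1 / √N * (L * L))) ^ 3 * (2 * M)) := by gcongr
    _ = 16 * c ^ 2 * L ^ 6 * M * (N * N / √N ^ 3) := by field_simp; ring
    _ = 16 * c ^ 2 * L ^ 6 * M * √N := by rw [mul_self_div_sqrt_pow_three hN0]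

/-- A bound, valid for every truncation level `L ≥ 1`, on the effect of the entry law on the
expected resolvent trace of an `m × p` matrix with `m, p ≤ c N`. -/
noncomputable def comparisonError (c M L N : ℝ) : ℝ :=
  4 * truncationError c M L N + 16 * c ^ 2 * L ^ 6 * M * √N

lemma IsStandardized.abs_meanResolventTrace_sub_le_of_balanced (h₁ : IsStandardized ν₁ M)
    (h₂ : IsStandardized ν₂ M) {O : Matrix m m ℝ} (hO : Oᵀ * O = 1) {O' : Matrix p p ℝ}
    (hO' : O'ᵀ * O' = 1) {u : m → ℝ} {v : p → ℝ} (hu : ∀ i, 0 ≤ u i) (hv : ∀ j, 0 ≤ v j)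
    (huv : (Finset.univ.filter fun i => 1 < u i).card ≤ (Finset.univ.filter fun j => 1 ≤ v j).card)
    (hvu : (Finset.univ.filter fun j => 1 < v j).card ≤ (Finset.univ.filter fun i => 1 ≤ u i).card)
    (hL : 1 ≤ L) (hN : 1 ≤ N) (hc : 0 ≤ c) (hm : Fintype.card m ≤ c * N)
    (hp : Fintype.card p ≤ c * N) :
    |meanResolventTrace ν₁ (1 / √N) (diagonal u * O) (O' * diagonal v)
        - meanResolventTrace ν₂ (1 / √N) (diagonal u * O) (O' * diagonal v)|
      ≤ comparisonError c M L N := by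
  have hL0 : 0 ≤ L := zero_le_one.trans hL
  have hmin {w : ℝ} (hw : 0 ≤ w) : |min w L| ≤ L := by
    rw [abs_of_nonneg (le_min hw hL0)]
    exact min_le_right _ _
  have hvu' : (Finset.univ.filter fun j => 1 < v j).card
      ≤ (Finset.univ.filter fun i => 1 ≤ min (u i) L).card := by
    simpa [hL] using hvu
  have hleft₁ := abs_le.mp
    (h₁.abs_meanResolventTrace_sub_min_left_le hO hO' hu huv hL hN hc hm hp)
  have hleft₂ := abs_le.mp
    (h₂.abs_meanResolventTrace_sub_min_left_le hO hO' hu huv hL hN hc hm hp)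
  have hright₁ := abs_le.mp
    (h₁.abs_meanResolventTrace_sub_min_right_le hO hO' hv hvu' hL hN hc hm hp)
  have hright₂ := abs_le.mp
    (h₂.abs_meanResolventTrace_sub_min_right_le hO hO' hv hvu' hL hN hc hm hp)
  have hbounded := abs_le.mp (h₁.abs_meanResolventTrace_sub_le_of_norm_le h₂
    (norm_diagonal_mul_le hL0 (fun i => hmin (hu i)) hO)
    (norm_mul_diagonal_le hL0 (fun j => hmin (hv j)) hO') hN hc hm hp)
  rw [comparisonError, abs_le]
  constructor <;> linarith [hleft₁.1, hleft₁.2, hleft₂.1, hleft₂.2, hright₁.1, hright₁.2,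
    hright₂.1, hright₂.2, hbounded.1, hbounded.2]

end Truncation

section Comparison

open Matrix

variable {m p q : Type*} [Fintype m] [Fintype p] [Fintype q] [DecidableEq m] [DecidableEq p]

omit [DecidableEq m] [DecidableEq p] in
lemma exists_pos_card_filter_le_card_filter (u : m → ℝ) (v : p → ℝ) : ∃ κ : ℝ, 0 < κ ∧
    (Finset.univ.filter fun i => 1 < κ * u i).card ≤ (Finset.univ.filter fun j => κ ≤ v j).card ∧
    (Finset.univ.filter fun j => κ < v j).card
      ≤ (Finset.univ.filter fun i => 1 ≤ κ * u i).card := by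
  -- Only finitely many thresholds matter; `κ` is the least one beyond which the members of `v`
  -- no longer outnumber those of `u`.
  set C : Finset ℝ := (insert (1 + ∑ j, |v j|)
    (Finset.univ.image v ∪ Finset.univ.image fun i => (u i)⁻¹)).filter (0 < ·)
  set T : Finset ℝ := C.filter fun κ => (Finset.univ.filter fun j => κ < v j).card
    ≤ (Finset.univ.filter fun i => 1 ≤ κ * u i).card
  have hvC (j : p) (hj : 0 < v j) : v j ∈ C := by simp [C, hj]
  have huC (i : m) (hi : 0 < u i) : (u i)⁻¹ ∈ C := by simp [C, hi]
  have hT : T.Nonempty := by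
    refine ⟨1 + ∑ j, |v j|, Finset.mem_filter.mpr ⟨?_, ?_⟩⟩
    · simp only [C, Finset.mem_filter, Finset.mem_insert_self, true_and]
      positivity
    · rw [Finset.filter_eq_empty_iff.mpr fun j _ => not_lt.mpr ?_, Finset.card_empty]
      · exact Nat.zero_le _
      · have hle := Finset.single_le_sum (f := fun j => |v j|) (fun i _ => abs_nonneg _)
          (Finset.mem_univ j)
        linarith [le_abs_self (v j)]
  obtain ⟨κ, hκT, hκmin⟩ := T.exists_min_image id hT
  obtain ⟨hκC, hκ⟩ := Finset.mem_filter.mp hκT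
  have hκ0 : 0 < κ := (Finset.mem_filter.mp hκC).2
  refine ⟨κ, hκ0, ?_, hκ⟩
  have hlt (i : m) (hi : 1 < κ * u i) : (u i)⁻¹ ∈ C.filter (· < κ) :=
    have hui : 0 < u i := pos_of_mul_pos_right (one_pos.trans hi) hκ0.le
    Finset.mem_filter.mpr ⟨huC i hui, (inv_lt_iff_one_lt_mul₀ hui).mpr hi⟩
  rcases (C.filter (· < κ)).eq_empty_or_nonempty with hempty | hbelow
  · rw [Finset.filter_eq_empty_iff.mpr fun i _ hi => by simpa [hempty] using hlt i hi]
    exact Nat.zero_le _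
  obtain ⟨κ', hκ', hκ'max⟩ := (C.filter (· < κ)).exists_max_image id hbelow
  obtain ⟨hκ'C, hκ'κ⟩ := Finset.mem_filter.mp hκ'
  have hκ'0 : 0 < κ' := (Finset.mem_filter.mp hκ'C).2
  calc (Finset.univ.filter fun i => 1 < κ * u i).card
      ≤ (Finset.univ.filter fun i => 1 ≤ κ' * u i).card :=
        Finset.card_le_card (Finset.monotone_filter_right _ fun i _ hi =>
          (inv_le_iff_one_le_mul₀ (pos_of_mul_pos_right (one_pos.trans hi) hκ0.le)).mp
            (hκ'max _ (hlt i hi)))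
    _ ≤ (Finset.univ.filter fun j => κ' < v j).card := by
        refine (lt_of_not_ge fun hcard => ?_).le
        exact (hκmin κ' (Finset.mem_filter.mpr ⟨hκ'C, hcard⟩)).not_gt hκ'κ
    _ ≤ (Finset.univ.filter fun j => κ ≤ v j).card :=
        Finset.card_le_card (Finset.monotone_filter_right _ fun j _ hj => le_of_not_gt fun hjκ =>
          (hκ'max _ (Finset.mem_filter.mpr ⟨hvC j (hκ'0.trans hj), hjκ⟩)).not_gt hj)

lemma exists_transpose_mul_self_eq_diagonal_mul (A : Matrix q m ℝ) :
    ∃ (u : m → ℝ) (O : Matrix m m ℝ), (∀ i, 0 ≤ u i) ∧ Oᵀ * O = 1 ∧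
      Aᵀ * A = (diagonal u * O)ᵀ * (diagonal u * O) := by
  have hpsd : (Aᵀ * A).PosSemidef := by
    simpa only [conjTranspose_eq_transpose_of_trivial] using posSemidef_conjTranspose_mul_self A
  set lam := hpsd.isHermitian.eigenvalues
  set V : Matrix m m ℝ := hpsd.isHermitian.eigenvectorUnitary.1
  have hV : V * Vᵀ = 1 := by
    simpa only [Unitary.coe_star, star_eq_conjTranspose, conjTranspose_eq_transpose_of_trivial]
      using Unitary.coe_mul_star_self hpsd.isHermitian.eigenvectorUnitary
  have hspectral : Aᵀ * A = V * diagonal lam * Vᵀ := by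
    simpa only [Unitary.conjStarAlgAut_apply, star_eq_conjTranspose,
      conjTranspose_eq_transpose_of_trivial] using! hpsd.isHermitian.spectral_theorem
  have hsqrt : diagonal lam = diagonal (fun i => √(lam i)) * diagonal fun i => √(lam i) := by
    simp only [diagonal_mul_diagonal, Real.mul_self_sqrt (hpsd.eigenvalues_nonneg _), lam]
  refine ⟨fun i => √(lam i), Vᵀ, fun i => Real.sqrt_nonneg _, by rwa [transpose_transpose], ?_⟩
  rw [hspectral, hsqrt]
  simp only [transpose_mul, transpose_transpose, diagonal_transpose, Matrix.mul_assoc]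

omit [DecidableEq m] in
lemma trace_gramResolvent_congr {X : Matrix m p ℝ} {Y : Matrix m p ℝ} (h : X * Xᵀ = Y * Yᵀ) :
    (gramResolvent X).trace = (gramResolvent Y).trace := by
  classical
  have htranspose : gramResolvent Xᵀ = gramResolvent Yᵀ := by
    rw [gramResolvent, gramResolvent, transpose_transpose, transpose_transpose, h]
  have hX := trace_gramResolvent_transpose X
  rw [htranspose] at hX
  linarith [trace_gramResolvent_transpose Y]

section MeanResolventTrace

variable {ν ν₁ ν₂ : Measure ℝ} {s : ℝ}

omit [DecidableEq m] in
lemma meanResolventTrace_congr_right {A : Matrix m m ℝ} {B B' : Matrix p p ℝ}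
    (hB : B * Bᵀ = B' * B'ᵀ) : meanResolventTrace ν s A B = meanResolventTrace ν s A B' := by
  have hgram (x : m × p → ℝ) (B : Matrix p p ℝ) : sandwich s A B x * (sandwich s A B x)ᵀ
      = (s * s) • (A * ((of fun i j => x (i, j)) *
        (B * Bᵀ * ((of fun i j => x (i, j) : Matrix m p ℝ)ᵀ * Aᵀ)))) := by
    simp only [sandwich, transpose_smul, transpose_mul, Matrix.smul_mul, Matrix.mul_smul,
      smul_smul, Matrix.mul_assoc]
  exact integral_congr_ae (ae_of_all _ fun x =>
    trace_gramResolvent_congr (by rw [hgram, hgram, hB]))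

omit [DecidableEq m] in
lemma meanResolventTrace_congr_left [IsProbabilityMeasure ν] {A A' : Matrix m m ℝ}
    {B : Matrix p p ℝ} (hA : Aᵀ * A = A'ᵀ * A') :
    meanResolventTrace ν s A B = meanResolventTrace ν s A' B := by
  classical
  rw [meanResolventTrace_eq_transpose, meanResolventTrace_eq_transpose ν s A',
    meanResolventTrace_congr_right (B' := A'ᵀ) (by simpa using hA)]

omit [DecidableEq m] in
lemma meanResolventTrace_smul_inv_smul {A : Matrix m m ℝ} {B : Matrix p p ℝ} {κ : ℝ}
    (hκ : κ ≠ 0) : meanResolventTrace ν s (κ • A) (κ⁻¹ • B) = meanResolventTrace ν s A B := by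
  simp only [meanResolventTrace, sandwich, Matrix.smul_mul, Matrix.mul_smul,
    inv_smul_smul₀ hκ]

omit [DecidableEq m] in
theorem IsStandardized.abs_meanResolventTrace_sub_le {M : ℝ} (h₁ : IsStandardized ν₁ M)
    (h₂ : IsStandardized ν₂ M) (A : Matrix m m ℝ) (B : Matrix p p ℝ) {L N c : ℝ} (hL : 1 ≤ L)
    (hN : 1 ≤ N) (hc : 0 ≤ c) (hm : Fintype.card m ≤ c * N) (hp : Fintype.card p ≤ c * N) :
    |meanResolventTrace ν₁ (1 / √N) A B - meanResolventTrace ν₂ (1 / √N) A B|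
      ≤ comparisonError c M L N := by
  classical
  obtain ⟨u, O, hu, hO, hA⟩ := exists_transpose_mul_self_eq_diagonal_mul A
  obtain ⟨v, O', hv, hO', hB⟩ := exists_transpose_mul_self_eq_diagonal_mul Bᵀ
  obtain ⟨κ, hκ, huv, hvu⟩ := exists_pos_card_filter_le_card_filter u v
  have hO'T : O'ᵀᵀ * O'ᵀ = 1 := by
    rw [transpose_transpose]
    exact mul_eq_one_comm.mp hO'
  have hnormal {ν : Measure ℝ} [IsProbabilityMeasure ν] : meanResolventTrace ν (1 / √N) A B
      = meanResolventTrace ν (1 / √N) (diagonal (κ • u) * O) (O'ᵀ * diagonal (κ⁻¹ • v)) := by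
    rw [diagonal_smul, diagonal_smul, Matrix.smul_mul, Matrix.mul_smul,
      meanResolventTrace_smul_inv_smul hκ.ne', meanResolventTrace_congr_left hA,
      meanResolventTrace_congr_right (B' := O'ᵀ * diagonal v) (by simpa using hB)]
  have := h₁.isProbabilityMeasure
  have := h₂.isProbabilityMeasure
  rw [hnormal, hnormal]
  refine h₁.abs_meanResolventTrace_sub_le_of_balanced h₂ hO hO'T
    (fun i => mul_nonneg hκ.le (hu i)) (fun j => mul_nonneg (inv_nonneg.mpr hκ.le) (hv j))
    ?_ ?_ hL hN hc hm hp
  · simpa only [Pi.smul_apply, smul_eq_mul, inv_mul_eq_div, one_le_div hκ] using huv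
  · simpa only [Pi.smul_apply, smul_eq_mul, inv_mul_eq_div, one_lt_div hκ] using hvu

end MeanResolventTrace

lemma exists_forall_eventually_comparisonError_le (c M : ℝ) {ε : ℝ} (hε : 0 < ε) :
    ∃ L : ℝ, 1 ≤ L ∧ ∀ᶠ N : ℝ in atTop, comparisonError c M L N ≤ ε * N := by
  set L := max 1 (4 * (1 + c) ^ 2 * (2 / ε))
  refine ⟨L, le_max_left _ _, ?_⟩
  have hL : 0 < L := one_pos.trans_le (le_max_left _ _)
  set K := 4 * ((2 + c) * steinError c M L) + 16 * c ^ 2 * L ^ 6 * M with hK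
  filter_upwards [Real.tendsto_sqrt_atTop.eventually_ge_atTop (K * (2 / ε)),
    eventually_ge_atTop 0] with N hN hN0
  have hcoeff : 4 * (1 + c) ^ 2 ≤ ε / 2 * L :=
    calc 4 * (1 + c) ^ 2 = ε / 2 * (4 * (1 + c) ^ 2 * (2 / ε)) := by field_simp
      _ ≤ ε / 2 * L := by gcongr; exact le_max_right _ _
  have hsqrt : K ≤ ε / 2 * √N :=
    calc K = ε / 2 * (K * (2 / ε)) := by field_simp
      _ ≤ ε / 2 * √N := by gcongr
  calc comparisonError c M L N = 4 * (1 + c) ^ 2 * (N / L) + K * √N := by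
        rw [comparisonError, truncationError, hK]; ring
    _ ≤ ε / 2 * L * (N / L) + ε / 2 * √N * √N := by gcongr
    _ = ε * N := by
        rw [mul_div_assoc', mul_right_comm _ L, mul_div_cancel_right₀ _ hL.ne', mul_assoc _ (√N),
          Real.mul_self_sqrt hN0]
        ring

end Comparison

section BoundedDifferences

lemma memLp_of_measurable_of_abs_le {α : Type*} [MeasurableSpace α] {μ : Measure α}
    [IsFiniteMeasure μ] {p : ENNReal} {f : α → ℝ} {b : ℝ} (hf : Measurable f)
    (hb : ∀ a, |f a| ≤ b) : MemLp f p μ :=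
  MemLp.of_bound hf.aestronglyMeasurable b (ae_of_all μ hb)

lemma variance_prod {α β : Type*} [MeasurableSpace α] [MeasurableSpace β] {μ : Measure α}
    {ρ : Measure β} [IsProbabilityMeasure μ] [IsProbabilityMeasure ρ] {F : α × β → ℝ}
    (hF : MemLp F 2 (μ.prod ρ)) (hFβ : ∀ a, MemLp (fun b => F (a, b)) 2 ρ)
    (hFα : MemLp (fun a => ∫ b, F (a, b) ∂ρ) 2 μ) :
    Var[F; μ.prod ρ] = ∫ a, Var[fun b => F (a, b); ρ] ∂μ + Var[fun a => ∫ b, F (a, b) ∂ρ; μ] := by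
  have hmean : ∫ a, ∫ b, F (a, b) ∂ρ ∂μ = ∫ w, F w ∂μ.prod ρ :=
    (integral_prod F (hF.integrable one_le_two)).symm
  have hsq : ∫ a, ∫ b, F (a, b) ^ 2 ∂ρ ∂μ = ∫ w, F w ^ 2 ∂μ.prod ρ :=
    (integral_prod _ hF.integrable_sq).symm
  simp only [variance_eq_sub hF, variance_eq_sub hFα, variance_eq_sub (hFβ _), Pi.pow_apply]
  rw [integral_sub hF.integrable_sq.integral_prod_left hFα.integrable_sq, hsq, hmean]
  ring

lemma variance_le_sq_of_forall_abs_sub_le {α : Type*} [MeasurableSpace α] {μ : Measure α}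
    [IsProbabilityMeasure μ] {f : α → ℝ} {a₀ : α} {c : ℝ} (hf : AEMeasurable f μ)
    (hc : ∀ a, |f a - f a₀| ≤ c) : Var[f; μ] ≤ c ^ 2 := by
  have hmem (a : α) : f a ∈ Set.Icc (f a₀ - c) (f a₀ + c) := by
    have := abs_le.mp (hc a)
    constructor <;> linarith
  refine (variance_le_sq_of_bounded (ae_of_all μ hmem) hf).trans_eq ?_
  ring

variable {ι E : Type*} [DecidableEq ι]

lemma eq_of_forall_update_eq [Finite ι] {β : Type*} {f : (ι → E) → β}
    (hf : ∀ x i z, f (Function.update x i z) = f x) (x y : ι → E) : f x = f y := by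
  have := Fintype.ofFinite ι
  have hpiecewise (s : Finset ι) : f (s.piecewise y x) = f x := by
    induction s using Finset.induction_on with
    | empty => rw [Finset.piecewise_empty]
    | insert i s _ ih => rw [Finset.piecewise_insert, hf, ih]
  rw [← hpiecewise Finset.univ, Finset.piecewise_univ]

variable [MeasurableSpace E] (μ : ι → Measure E) [∀ i, IsProbabilityMeasure (μ i)]

lemma abs_integral_update_sub_le (i : ι) {b : ℝ} {c : ι → ℝ} {f : (ι → E) → ℝ}
    (hf : Measurable f) (hb : ∀ x, |f x| ≤ b)
    (hc : ∀ x i z, |f (Function.update x i z) - f x| ≤ c i) (x : ι → E) (k : ι) (y : E) :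
    |∫ z, f (Function.update (Function.update x k y) i z) ∂μ i
      - ∫ z, f (Function.update x i z) ∂μ i| ≤ Function.update c i 0 k := by
  have hint (x : ι → E) : Integrable (fun z => f (Function.update x i z)) (μ i) :=
    integrable_of_measurable_of_abs_le (hf.comp (measurable_update x)) fun z => hb _
  rcases eq_or_ne k i with rfl | hki
  · simp
  · rw [Function.update_of_ne hki, ← integral_sub (hint _) (hint _)]
    refine abs_integral_le_of_forall_abs_le fun z => ?_
    rw [Function.update_comm hki]
    exact hc _ k y

variable [Fintype ι]

lemma measurePreserving_update (i : ι) : MeasurePreserving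
    (fun w : (ι → E) × E => Function.update w.1 i w.2) ((Measure.pi μ).prod (μ i))
    (Measure.pi μ) :=
  ⟨measurable_update', by rw [map_update_pi, Function.update_eq_self]⟩

lemma variance_pi_eq_add_update (i : ι) {f : (ι → E) → ℝ} (hf : MemLp f 2 (Measure.pi μ))
    (hupdate : ∀ x, MemLp (fun z => f (Function.update x i z)) 2 (μ i))
    (hmean : MemLp (fun x => ∫ z, f (Function.update x i z) ∂μ i) 2 (Measure.pi μ)) :
    Var[f; Measure.pi μ] = ∫ x, Var[fun z => f (Function.update x i z); μ i] ∂Measure.pi μ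
      + Var[fun x => ∫ z, f (Function.update x i z) ∂μ i; Measure.pi μ] := by
  have hpreserving := measurePreserving_update μ i
  rw [← hpreserving.variance_fun_comp hf.1.aemeasurable]
  exact variance_prod (hf.comp_measurePreserving hpreserving) hupdate hmean

lemma variance_pi_le_sum_sq_of_support_subset (s : Finset ι) {b : ℝ} {c : ι → ℝ} {f : (ι → E) → ℝ}
    (hf : Measurable f) (hb : ∀ x, |f x| ≤ b)
    (hc : ∀ x i z, |f (Function.update x i z) - f x| ≤ c i) (hs : ∀ i ∉ s, c i = 0) :
    Var[f; Measure.pi μ] ≤ ∑ i ∈ s, c i ^ 2 := by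
  induction s using Finset.induction_on generalizing f c with
  | empty =>
    have hconst (x y : ι → E) : f x = f y := eq_of_forall_update_eq
      (fun x i z => sub_eq_zero.mp (abs_nonpos_iff.mp ((hc x i z).trans_eq (hs i (by simp))))) x y
    obtain ⟨x₀⟩ := (Measure.pi μ).nonempty_of_neZero
    simpa using variance_le_sq_of_forall_abs_sub_le (a₀ := x₀) (c := 0) (μ := Measure.pi μ)
      hf.aemeasurable fun x => by simp [hconst x x₀]
  | insert i s hi ih =>
    have hupdate (x : ι → E) : Measurable fun z => f (Function.update x i z) :=
      hf.comp (measurable_update x)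
    set g : (ι → E) → ℝ := fun x => ∫ z, f (Function.update x i z) ∂μ i
    have hg : Measurable g :=
      (hf.comp measurable_update').stronglyMeasurable.integral_prod_right'.measurable
    have hgb (x : ι → E) : |g x| ≤ b := abs_integral_le_of_forall_abs_le fun z => hb _
    have hgs (k : ι) (hk : k ∉ s) : Function.update c i 0 k = 0 := by
      rcases eq_or_ne k i with rfl | hki
      · simp
      · rw [Function.update_of_ne hki, hs k (by simp [hk, hki])]
    have hsum : ∑ k ∈ s, Function.update c i 0 k ^ 2 = ∑ k ∈ s, c k ^ 2 :=
      Finset.sum_congr rfl fun k hk => by rw [Function.update_of_ne (ne_of_mem_of_not_mem hk hi)]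
    rw [variance_pi_eq_add_update μ i (memLp_of_measurable_of_abs_le hf hb)
      (fun x => memLp_of_measurable_of_abs_le (hupdate x) fun _ => hb _)
      (memLp_of_measurable_of_abs_le hg hgb), Finset.sum_insert hi, ← hsum]
    refine add_le_add ((le_abs_self _).trans (abs_integral_le_of_forall_abs_le fun x => ?_))
      (ih hg hgb (abs_integral_update_sub_le μ i hf hb hc) hgs)
    rw [abs_of_nonneg (variance_nonneg _ _)]
    refine variance_le_sq_of_forall_abs_sub_le (a₀ := x i) (hupdate x).aemeasurable fun z => ?_
    simpa using hc x i z

lemma variance_pi_le_sum_sq {b : ℝ} {c : ι → ℝ} {f : (ι → E) → ℝ} (hf : Measurable f)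
    (hb : ∀ x, |f x| ≤ b) (hc : ∀ x i z, |f (Function.update x i z) - f x| ≤ c i) :
    Var[f; Measure.pi μ] ≤ ∑ i, c i ^ 2 :=
  variance_pi_le_sum_sq_of_support_subset μ Finset.univ hf hb hc (by simp)

end BoundedDifferences

section QuadraticForms

/-- The law `ν` is centered with variance `w` and its fourth moment is at most `K * w ^ 2`: the
moment condition under which quadratic forms in independent coordinates concentrate. The variance
may vanish. -/
structure IsCenteredFourth (ν : Measure ℝ) (w K : ℝ) : Prop where
  isProbabilityMeasure : IsProbabilityMeasure ν
  memLp : MemLp (fun z : ℝ => z) 4 ν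
  integral_id : ∫ z, z ∂ν = 0
  integral_sq : ∫ z, z ^ 2 ∂ν = w
  integral_pow_four_le : ∫ z, z ^ 4 ∂ν ≤ K * w ^ 2

namespace IsCenteredFourth

variable {ν : Measure ℝ} {w K : ℝ}

lemma integrable_id (h : IsCenteredFourth ν w K) : Integrable (fun z : ℝ => z) ν :=
  have := h.isProbabilityMeasure
  h.memLp.integrable (by norm_num)

lemma integrable_sq (h : IsCenteredFourth ν w K) : Integrable (fun z : ℝ => z ^ 2) ν :=
  have := h.isProbabilityMeasure
  (h.memLp.mono_exponent (by norm_num : (2 : ENNReal) ≤ 4)).integrable_sq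

lemma integrable_pow_four (h : IsCenteredFourth ν w K) : Integrable (fun z : ℝ => z ^ 4) ν := by
  simpa [(by decide : Even 4).pow_abs] using h.memLp.integrable_norm_pow four_ne_zero

lemma nonneg (h : IsCenteredFourth ν w K) : 0 ≤ w :=
  h.integral_sq ▸ integral_nonneg fun z => sq_nonneg z

lemma memLp_quadratic (h : IsCenteredFourth ν w K) (a b c : ℝ) :
    MemLp (fun z => a * z ^ 2 + b * z + c) 2 ν := by
  have := h.isProbabilityMeasure
  have hsq : MemLp (fun z : ℝ => z ^ 2) 2 ν :=
    (memLp_two_iff_integrable_sq (by fun_prop)).mpr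
      (by simpa [← pow_mul] using h.integrable_pow_four)
  have hid : MemLp (fun z : ℝ => z) 2 ν := h.memLp.mono_exponent (by norm_num)
  exact ((hsq.const_mul a).add (hid.const_mul b)).add (memLp_const c)

lemma integral_quadratic (h : IsCenteredFourth ν w K) (a b c : ℝ) :
    ∫ z, (a * z ^ 2 + b * z + c) ∂ν = a * w + c := by
  have := h.isProbabilityMeasure
  have hsq := h.integrable_sq.const_mul a
  have hid := h.integrable_id.const_mul b
  have hadd : Integrable (fun z => a * z ^ 2 + b * z) ν := hsq.add hid
  rw [integral_add hadd (integrable_const c), integral_add hsq hid, integral_const_mul,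
    integral_const_mul, h.integral_sq, h.integral_id]
  simp

lemma variance_quadratic_le (h : IsCenteredFourth ν w K) (a b c : ℝ) :
    Var[fun z => a * z ^ 2 + b * z + c; ν] ≤ 2 * a ^ 2 * (K * w ^ 2) + 2 * b ^ 2 * w := by
  have := h.isProbabilityMeasure
  have hfour := h.integrable_pow_four.const_mul (2 * a ^ 2)
  have hsq := h.integrable_sq.const_mul (2 * b ^ 2)
  rw [variance_add_const (by fun_prop)]
  calc Var[fun z => a * z ^ 2 + b * z; ν] ≤ ∫ z, (a * z ^ 2 + b * z) ^ 2 ∂ν :=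
        variance_le_expectation_sq (by fun_prop)
    _ ≤ ∫ z, (2 * a ^ 2 * z ^ 4 + 2 * b ^ 2 * z ^ 2) ∂ν := by
        refine integral_mono_of_nonneg (ae_of_all _ fun z => sq_nonneg _) (hfour.add hsq)
          (ae_of_all _ fun z => ?_)
        linear_combination sq_nonneg (a * z ^ 2 - b * z)
    _ ≤ 2 * a ^ 2 * (K * w ^ 2) + 2 * b ^ 2 * w := by
        rw [integral_add hfour hsq, integral_const_mul, integral_const_mul, h.integral_sq]
        gcongr
        exact h.integral_pow_four_le

end IsCenteredFourth

lemma sum_sum_insert_update {ι : Type*} [DecidableEq ι] {s : Finset ι} {i : ι} (hi : i ∉ s)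
    {Q : Matrix ι ι ℝ} (hQ : Q.IsSymm) (x : ι → ℝ) (z : ℝ) :
    ∑ a ∈ insert i s, ∑ b ∈ insert i s,
        Q a b * (Function.update x i z a * Function.update x i z b)
      = Q i i * z ^ 2 + 2 * (∑ b ∈ s, Q i b * x b) * z
        + ∑ a ∈ s, ∑ b ∈ s, Q a b * (x a * x b) := by
  have hx (a : ι) (ha : a ∈ s) : Function.update x i z a = x a :=
    Function.update_of_ne (ne_of_mem_of_not_mem ha hi) z x
  have hcross : ∑ a ∈ s, Q a i * (Function.update x i z a * z) = (∑ b ∈ s, Q i b * x b) * z := by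
    rw [Finset.sum_mul]
    exact Finset.sum_congr rfl fun a ha => by rw [hx a ha, hQ.apply i a, mul_assoc]
  have hrow : ∑ b ∈ s, Q i b * (z * Function.update x i z b) = (∑ b ∈ s, Q i b * x b) * z := by
    rw [Finset.sum_mul]
    exact Finset.sum_congr rfl fun a ha => by rw [hx a ha, mul_comm z, mul_assoc]
  have hblock : ∑ a ∈ s, ∑ b ∈ s, Q a b * (Function.update x i z a * Function.update x i z b)
      = ∑ a ∈ s, ∑ b ∈ s, Q a b * (x a * x b) :=
    Finset.sum_congr rfl fun a ha => Finset.sum_congr rfl fun b hb => by rw [hx a ha, hx b hb]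
  simp only [Finset.sum_insert hi, Function.update_self, Finset.sum_add_distrib, hcross, hrow,
    hblock]
  ring

variable {ι : Type*} [Fintype ι] {μ : ι → Measure ℝ} {w : ι → ℝ} {K : ℝ}

lemma memLp_eval_mul_eval (h : ∀ i, IsCenteredFourth (μ i) (w i) K) (a b : ι) :
    MemLp (fun x : ι → ℝ => x a * x b) 2 (Measure.pi μ) := by
  have (i : ι) := (h i).isProbabilityMeasure
  have heval (i : ι) : MemLp (fun x : ι → ℝ => x i) 4 (Measure.pi μ) :=
    (h i).memLp.comp_measurePreserving (measurePreserving_eval μ i)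
  have : ENNReal.HolderTriple 4 4 2 := ⟨by
    rw [← ENNReal.toReal_eq_toReal_iff' (by simp) (by simp),
      ENNReal.toReal_add (by simp) (by simp)]
    norm_num⟩
  exact (heval b).mul (heval a)

lemma memLp_sum_sum_mul (h : ∀ i, IsCenteredFourth (μ i) (w i) K) (s : Finset ι)
    (Q : Matrix ι ι ℝ) :
    MemLp (fun x : ι → ℝ => ∑ a ∈ s, ∑ b ∈ s, Q a b * (x a * x b)) 2 (Measure.pi μ) :=
  memLp_finsetSum s fun a _ => memLp_finsetSum s fun b _ =>
    (memLp_eval_mul_eval h a b).const_mul (Q a b)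


lemma integral_eval_mul_eval [DecidableEq ι] (h : ∀ i, IsCenteredFourth (μ i) (w i) K) (a b : ι) :
    ∫ x : ι → ℝ, x a * x b ∂Measure.pi μ = if a = b then w a else 0 := by
  have (i : ι) := (h i).isProbabilityMeasure
  have hint := (memLp_eval_mul_eval h a b).integrable one_le_two
  rw [← Function.update_eq_self a μ, integral_pi_update μ a (μ a) (by simpa using hint)]
  rcases eq_or_ne a b with rfl | hab
  · simp [← sq, (h a).integral_sq]
  · simp [hab, hab.symm, integral_mul_const, (h a).integral_id]

lemma integral_sum_sum_mul (h : ∀ i, IsCenteredFourth (μ i) (w i) K) (s : Finset ι)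
    (Q : Matrix ι ι ℝ) :
    ∫ x : ι → ℝ, ∑ a ∈ s, ∑ b ∈ s, Q a b * (x a * x b) ∂Measure.pi μ = ∑ a ∈ s, Q a a * w a := by
  classical
  have (i : ι) := (h i).isProbabilityMeasure
  have hint (a b : ι) : Integrable (fun x : ι → ℝ => Q a b * (x a * x b)) (Measure.pi μ) :=
    ((memLp_eval_mul_eval h a b).integrable one_le_two).const_mul (Q a b)
  rw [integral_finsetSum s fun a _ => integrable_finsetSum s fun b _ => hint a b]
  refine Finset.sum_congr rfl fun a ha => ?_
  simp [integral_finsetSum s fun b _ => hint a b, integral_const_mul, integral_eval_mul_eval h, ha]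

lemma integral_sum_mul_sq (h : ∀ i, IsCenteredFourth (μ i) (w i) K) (s : Finset ι) (q : ι → ℝ) :
    ∫ x : ι → ℝ, (∑ b ∈ s, q b * x b) ^ 2 ∂Measure.pi μ = ∑ b ∈ s, q b ^ 2 * w b := by
  have hsq (x : ι → ℝ) : (∑ b ∈ s, q b * x b) ^ 2
      = ∑ a ∈ s, ∑ b ∈ s, Matrix.vecMulVec q q a b * (x a * x b) := by
    rw [sq, Finset.sum_mul_sum]
    exact Finset.sum_congr rfl fun a _ => Finset.sum_congr rfl fun b _ => mul_mul_mul_comm _ _ _ _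
  simp only [hsq, integral_sum_sum_mul h]
  simp only [Matrix.vecMulVec_apply, sq]

lemma integral_variance_quadratic_le (h : ∀ i, IsCenteredFourth (μ i) (w i) K) (i : ι)
    (s : Finset ι) (a : ℝ) (l : ι → ℝ) (q : (ι → ℝ) → ℝ) :
    ∫ x : ι → ℝ, Var[fun z => a * z ^ 2 + 2 * (∑ b ∈ s, l b * x b) * z + q x; μ i] ∂Measure.pi μ
      ≤ 2 * a ^ 2 * (K * w i ^ 2) + 8 * w i * ∑ b ∈ s, l b ^ 2 * w b := by
  have (i : ι) := (h i).isProbabilityMeasure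
  have hlinear : MemLp (fun x : ι → ℝ => ∑ b ∈ s, l b * x b) 2 (Measure.pi μ) :=
    memLp_finsetSum s fun b _ => (((h b).memLp.mono_exponent (by norm_num)).comp_measurePreserving
      (measurePreserving_eval μ b)).const_mul (l b)
  have hsq := hlinear.integrable_sq.const_mul (8 * w i)
  calc ∫ x : ι → ℝ, Var[fun z => a * z ^ 2 + 2 * (∑ b ∈ s, l b * x b) * z + q x; μ i] ∂Measure.pi μ
      ≤ ∫ x : ι → ℝ, (2 * a ^ 2 * (K * w i ^ 2) + 8 * w i * (∑ b ∈ s, l b * x b) ^ 2)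
          ∂Measure.pi μ := by
        refine integral_mono_of_nonneg (ae_of_all _ fun x => variance_nonneg _ _)
          ((integrable_const _).add hsq) (ae_of_all _ fun x => ?_)
        refine ((h i).variance_quadratic_le _ _ _).trans_eq ?_
        ring
    _ = 2 * a ^ 2 * (K * w i ^ 2) + 8 * w i * ∑ b ∈ s, l b ^ 2 * w b := by
        rw [integral_add (integrable_const _) hsq, integral_const, probReal_univ, one_smul,
          integral_const_mul, integral_sum_mul_sq h]

lemma variance_sum_sum_mul_le (h : ∀ i, IsCenteredFourth (μ i) (w i) K) (hK : 0 ≤ K)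
    {Q : Matrix ι ι ℝ} (hQ : Q.IsSymm) (s : Finset ι) :
    Var[fun x : ι → ℝ => ∑ a ∈ s, ∑ b ∈ s, Q a b * (x a * x b); Measure.pi μ]
      ≤ (2 * K + 4) * ∑ a ∈ s, ∑ b ∈ s, w a * w b * Q a b ^ 2 := by
  have (i : ι) := (h i).isProbabilityMeasure
  classical
  induction s using Finset.induction_on with
  | empty => simp [← Pi.zero_def]
  | insert i s hi ih =>
    have hq := memLp_sum_sum_mul h s Q
    rw [variance_pi_eq_add_update μ i (memLp_sum_sum_mul h _ Q)]
    · simp only [sum_sum_insert_update hi hQ, (h i).integral_quadratic]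
      rw [variance_const_add hq.1]
      refine (add_le_add (integral_variance_quadratic_le h i s (Q i i) (Q i) _) ih).trans ?_
      have hcross : ∑ a ∈ s, w a * w i * Q a i ^ 2 = w i * ∑ b ∈ s, Q i b ^ 2 * w b := by
        rw [Finset.mul_sum]
        exact Finset.sum_congr rfl fun a _ => by rw [hQ.apply i a]; ring
      have hrow : ∑ b ∈ s, w i * w b * Q i b ^ 2 = w i * ∑ b ∈ s, Q i b ^ 2 * w b := by
        rw [Finset.mul_sum]
        exact Finset.sum_congr rfl fun a _ => by ring
      have hnonneg : 0 ≤ K * (w i * ∑ b ∈ s, Q i b ^ 2 * w b) := mul_nonneg hK <|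
        mul_nonneg (h i).nonneg
          (Finset.sum_nonneg fun b _ => mul_nonneg (sq_nonneg _) (h b).nonneg)
      simp only [Finset.sum_insert hi, Finset.sum_add_distrib, hcross, hrow]
      linear_combination 4 * hnonneg + 4 * sq_nonneg (w i * Q i i)
    · intro x
      simp only [sum_sum_insert_update hi hQ]
      exact (h i).memLp_quadratic _ _ _
    · simp only [sum_sum_insert_update hi hQ, (h i).integral_quadratic]
      exact (memLp_const (Q i i * w i)).add hq

section Covariance

open Matrix
open scoped Matrix.Norms.L2Operator

variable {k : Type*} [Fintype k]

omit [Fintype ι] in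
lemma isSymm_gram (M : Matrix k ι ℝ) : (Mᵀ * M).IsSymm := by
  rw [IsSymm, transpose_mul, transpose_transpose]

lemma trace_mul_diagonal_mul_transpose [DecidableEq ι] (M : Matrix k ι ℝ) (w : ι → ℝ) :
    (M * diagonal w * Mᵀ).trace = ∑ a, (Mᵀ * M) a a * w a := by
  rw [Matrix.mul_assoc, trace_mul_comm, Matrix.mul_assoc, trace_mul_comm]
  simp [trace, diag, mul_diagonal]

lemma sum_sum_mul_gram_sq [DecidableEq ι] (M : Matrix k ι ℝ) (w : ι → ℝ) :
    ∑ a, ∑ b, w a * w b * (Mᵀ * M) a b ^ 2 = ∑ i, ∑ j, (M * diagonal w * Mᵀ) i j ^ 2 := by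
  have hsymm : (M * diagonal w * Mᵀ)ᵀ = M * diagonal w * Mᵀ := by
    simp [transpose_mul, Matrix.mul_assoc]
  have hgram (a b : ι) : (Mᵀ * M) a b = (Mᵀ * M) b a :=
    (isSymm_gram M).apply b a
  calc ∑ a, ∑ b, w a * w b * (Mᵀ * M) a b ^ 2
      = ((diagonal w * (Mᵀ * M)) * (diagonal w * (Mᵀ * M))).trace := by
        simp only [trace, diag, mul_apply (M := diagonal w * (Mᵀ * M)), diagonal_mul]
        refine Finset.sum_congr rfl fun a _ => Finset.sum_congr rfl fun b _ => ?_
        rw [hgram b a]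
        ring
    _ = (M * diagonal w * Mᵀ * (M * diagonal w * Mᵀ)).trace := by
        rw [Matrix.mul_assoc M, Matrix.mul_assoc M, trace_mul_comm M]
        simp only [Matrix.mul_assoc]
    _ = ∑ i, ∑ j, (M * diagonal w * Mᵀ) i j ^ 2 := by
        conv_lhs => enter [1, 2]; rw [← hsymm]
        simp only [trace, diag, mul_apply (M := M * diagonal w * Mᵀ), transpose_apply, sq]

lemma dotProduct_mulVec_self_eq_sum_sum (M : Matrix k ι ℝ) (x : ι → ℝ) :
    (M *ᵥ x) ⬝ᵥ (M *ᵥ x) = ∑ a, ∑ b, (Mᵀ * M) a b * (x a * x b) := by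
  rw [dotProduct_mulVec, vecMul_mulVec, ← dotProduct_mulVec, dotProduct]
  simp only [mulVec, dotProduct, Finset.mul_sum]
  exact Finset.sum_congr rfl fun a _ => Finset.sum_congr rfl fun b _ => by ring

lemma memLp_dotProduct_mulVec_self (h : ∀ i, IsCenteredFourth (μ i) (w i) K) (M : Matrix k ι ℝ) :
    MemLp (fun x => (M *ᵥ x) ⬝ᵥ (M *ᵥ x)) 2 (Measure.pi μ) := by
  simpa only [dotProduct_mulVec_self_eq_sum_sum] using memLp_sum_sum_mul h Finset.univ (Mᵀ * M)

lemma integral_dotProduct_mulVec_self [DecidableEq ι] (h : ∀ i, IsCenteredFourth (μ i) (w i) K)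
    (M : Matrix k ι ℝ) :
    ∫ x, (M *ᵥ x) ⬝ᵥ (M *ᵥ x) ∂Measure.pi μ = (M * diagonal w * Mᵀ).trace := by
  simp only [dotProduct_mulVec_self_eq_sum_sum, integral_sum_sum_mul h,
    trace_mul_diagonal_mul_transpose]

lemma variance_dotProduct_mulVec_self_le [DecidableEq ι] [DecidableEq k]
    (h : ∀ i, IsCenteredFourth (μ i) (w i) K) (hK : 0 ≤ K) (M : Matrix k ι ℝ) :
    Var[fun x => (M *ᵥ x) ⬝ᵥ (M *ᵥ x); Measure.pi μ]
      ≤ (2 * K + 4) * (Fintype.card k * ‖M * diagonal w * Mᵀ‖ ^ 2) := by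
  simp only [dotProduct_mulVec_self_eq_sum_sum]
  refine (variance_sum_sum_mul_le h hK (isSymm_gram M) Finset.univ).trans ?_
  gcongr
  rw [sum_sum_mul_gram_sq, Finset.sum_comm]
  exact (Finset.sum_le_sum fun j _ => sum_sq_apply_le_l2_opNorm_sq _ j).trans_eq (by simp)

end Covariance

end QuadraticForms

section GaussianMoments

/-- The fourth moment of the standard Gaussian law. Only its finiteness matters here. -/
noncomputable def gaussianFourth : ℝ := ∫ z, z ^ 4 ∂gaussianReal 0 1

lemma gaussianFourth_nonneg : 0 ≤ gaussianFourth :=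
  integral_nonneg fun z => by positivity

lemma integral_pow_four_gaussianReal (w : NNReal) :
    ∫ z, z ^ 4 ∂gaussianReal 0 w = gaussianFourth * (w : ℝ) ^ 2 := by
  have hmap : (gaussianReal 0 1).map (√w * ·) = gaussianReal 0 w := by
    rw [gaussianReal_map_const_mul, mul_zero]
    congr
    ext
    simp
  rw [← hmap, integral_map (by fun_prop) (by fun_prop)]
  simp only [mul_pow]
  rw [integral_const_mul, ← gaussianFourth, show 4 = 2 * 2 from rfl, pow_mul,
    Real.sq_sqrt w.coe_nonneg, mul_comm]

lemma isCenteredFourth_gaussianReal (w : NNReal) :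
    IsCenteredFourth (gaussianReal 0 w) w gaussianFourth where
  isProbabilityMeasure := inferInstance
  memLp := memLp_id_gaussianReal' 4 (by norm_num)
  integral_id := integral_id_gaussianReal
  integral_sq := by
    have hvariance := variance_fun_id_gaussianReal (μ := 0) (v := w)
    rw [variance_eq_integral (by fun_prop), integral_id_gaussianReal] at hvariance
    simpa using hvariance
  integral_pow_four_le := (integral_pow_four_gaussianReal w).le

end GaussianMoments

section ConditionalRisk

open Matrix

variable {m p : Type*} [Fintype m] [Fintype p] [DecidableEq p]

lemma inv_gram_add_smul_one (X : Matrix m p ℝ) {κ : ℝ} (hκ : 0 < κ) :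
    (Xᵀ * X + κ • 1)⁻¹ = κ⁻¹ • gramResolvent ((1 / √κ) • X) := by
  refine inv_eq_right_inv ?_
  have hgram : Xᵀ * X + κ • 1 = κ • (1 + ((1 / √κ) • X)ᵀ * ((1 / √κ) • X)) := by
    have hsq : κ * (1 / √κ * (1 / √κ)) = 1 := by
      rw [div_mul_div_comm, Real.mul_self_sqrt hκ.le]
      field_simp
    rw [transpose_smul, Matrix.smul_mul, Matrix.mul_smul, smul_smul, smul_add, smul_smul, hsq,
      one_smul, add_comm]
  rw [hgram, smul_mul_smul_comm, one_add_gram_mul_gramResolvent, mul_inv_cancel₀ hκ.ne', one_smul]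

/-- The matrix sending the stacked vector of coefficients `β` and noise `ε` to the error
`β̂ - β` of ridge regression with design matrix `X` and penalty `r⁻²`. -/
noncomputable def ridgeErrorMatrix (r : ℝ) (X : Matrix m p ℝ) : Matrix p (p ⊕ m) ℝ :=
  fromCols (-gramResolvent (r • X)) (r • (gramResolvent (r • X) * (r • X)ᵀ))

lemma ridge_sub_eq_ridgeErrorMatrix_mulVec {n d : ℕ} {lam : ℝ} (hlam : 0 < lam) (hn : 0 < n)
    (X : Matrix (Fin n) (Fin d) ℝ) (β : Fin d → ℝ) (ε : Fin n → ℝ) :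
    ridge lam X (X *ᵥ β + ε) - β = ridgeErrorMatrix (1 / √(lam * n)) X *ᵥ Sum.elim β ε := by
  have hκ : 0 < lam * n := mul_pos hlam (Nat.cast_pos.mpr hn)
  set r := 1 / √(lam * n) with hr
  have hr2 : (lam * n)⁻¹ = r * r := by
    rw [hr, div_mul_div_comm, Real.mul_self_sqrt hκ.le, one_mul, one_div]
  have hQ : (r * r) • (gramResolvent (r • X) * Xᵀ * X) = 1 - gramResolvent (r • X) := by
    simp only [← gramResolvent_mul_gram, transpose_smul, Matrix.smul_mul, Matrix.mul_smul,
      smul_smul, Matrix.mul_assoc]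
  rw [ridge, inv_gram_add_smul_one X hκ, ← hr, ridgeErrorMatrix, fromCols_mulVec_sumElim,
    mulVec_add, mulVec_add, mulVec_mulVec, mulVec_mulVec, mulVec_mulVec, Matrix.smul_mul,
    Matrix.smul_mul, hr2, hQ, sub_mulVec, one_mulVec, transpose_smul, Matrix.mul_smul, smul_smul,
    neg_mulVec]
  abel

/-- The covariance matrix, given the scaled design matrix `Y`, of the ridge regression error, with
`w` the variance of the coefficients and `w'` the variance of the noise over the penalty. -/
noncomputable def ridgeErrorCovariance (w w' : ℝ) (Y : Matrix m p ℝ) : Matrix p p ℝ :=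
  w • (gramResolvent Y * gramResolvent Y)
    + w' • (gramResolvent Y - gramResolvent Y * gramResolvent Y)

lemma ridgeErrorMatrix_mul_diagonal_mul_transpose [DecidableEq m] (r v v' : ℝ) (X : Matrix m p ℝ) :
    ridgeErrorMatrix r X * diagonal (Sum.elim (fun _ : p => v) fun _ : m => v') *
        (ridgeErrorMatrix r X)ᵀ
      = ridgeErrorCovariance v (r ^ 2 * v') (r • X) := by
  rw [ridgeErrorMatrix]
  generalize r • X = Y
  have hQ : gramResolvent Y * Yᵀ * (Y * gramResolvent Y)
      = gramResolvent Y - gramResolvent Y * gramResolvent Y := by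
    rw [Matrix.mul_assoc, ← Matrix.mul_assoc Yᵀ, gram_mul_gramResolvent, Matrix.mul_sub,
      Matrix.mul_one]
  have hdiagonal : diagonal (Sum.elim (fun _ : p => v) fun _ : m => v')
      = fromBlocks (v • 1) 0 0 (v' • 1) := by
    rw [smul_one_eq_diagonal, smul_one_eq_diagonal, fromBlocks_diagonal]
  rw [hdiagonal, fromCols_mul_fromBlocks, transpose_fromCols, fromCols_mul_fromRows,
    ridgeErrorCovariance, ← hQ]
  simp only [transpose_neg, transpose_smul, transpose_mul, gramResolvent_transpose,
    transpose_transpose, Matrix.mul_zero, add_zero, zero_add, Matrix.mul_smul, Matrix.smul_mul,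
    Matrix.mul_one, Matrix.neg_mul, Matrix.mul_neg, smul_neg, neg_neg, smul_smul]
  ring_nf

open scoped Matrix.Norms.L2Operator in
lemma norm_ridgeErrorCovariance_le {w w' : ℝ} (hw : 0 ≤ w) (hw' : 0 ≤ w') (Y : Matrix m p ℝ) :
    ‖ridgeErrorCovariance w w' Y‖ ≤ 2 * (w + w') := by
  have hQ := norm_gramResolvent_le_one Y
  have hQ2 : ‖gramResolvent Y * gramResolvent Y‖ ≤ 1 := by
    simpa using l2_opNorm_mul_le_of_le hQ hQ
  calc ‖ridgeErrorCovariance w w' Y‖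
      ≤ w * ‖gramResolvent Y * gramResolvent Y‖
        + w' * (‖gramResolvent Y‖ + ‖gramResolvent Y * gramResolvent Y‖) := by
        refine (norm_add_le _ _).trans ?_
        rw [norm_smul, norm_smul, Real.norm_of_nonneg hw, Real.norm_of_nonneg hw']
        gcongr
        exact norm_sub_le _ _
    _ ≤ w * 1 + w' * (1 + 1) := by gcongr
    _ ≤ 2 * (w + w') := by linarith

end ConditionalRisk

section ConditionalRisk

open Matrix

lemma measurePreserving_sumElim {ι κ E : Type*} [Fintype ι] [Fintype κ] [MeasurableSpace E]
    (μ ν : Measure E) [SigmaFinite μ] [SigmaFinite ν] :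
    MeasurePreserving (fun x : (ι → E) × (κ → E) => Sum.elim x.1 x.2)
      ((Measure.pi fun _ => μ).prod (Measure.pi fun _ => ν))
      (Measure.pi (Sum.elim (fun _ => μ) fun _ => ν)) := by
  have : ∀ i : ι ⊕ κ, SigmaFinite (Sum.elim (fun _ => μ) (fun _ => ν) i) := by
    rintro (_ | _) <;> assumption
  have helim : (fun x : (ι → E) × (κ → E) => Sum.elim x.1 x.2)
      = (MeasurableEquiv.sumPiEquivProdPi fun _ : ι ⊕ κ => E).symm := by
    ext x (i | i) <;> rfl
  rw [helim]
  exact measurePreserving_sumPiEquivProdPi_symm (Sum.elim (fun _ => μ) fun _ => ν)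

/-- The expectation of the squared norm of the ridge regression error given the scaled design matrix
`Y`, with `w` and `w'` as in `ridgeErrorCovariance`. -/
noncomputable def conditionalRisk {m p : Type*} [Fintype m] [Fintype p] [DecidableEq p]
    (w w' : ℝ) (Y : Matrix m p ℝ) : ℝ :=
  (ridgeErrorCovariance w w' Y).trace

lemma continuous_mul_of_mul {m p : Type*} [Fintype m] [Fintype p] (A : Matrix m m ℝ)
    (B : Matrix p p ℝ) : Continuous fun W : m → p → ℝ => A * of W * B := by
  have hof : Continuous fun W : m → p → ℝ => of W := continuous_id
  exact (continuous_const.matrix_mul hof).matrix_mul continuous_const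

variable {n d : ℕ} {lam : ℝ}

lemma estimationError_ridge (hlam : 0 < lam) (hn : 0 < n) (X : Matrix (Fin n) (Fin d) ℝ)
    (β : Fin d → ℝ) (ε : Fin n → ℝ) :
    estimationError (ridge lam X (X *ᵥ β + ε)) β
      = (ridgeErrorMatrix (1 / √(lam * n)) X *ᵥ Sum.elim β ε)
        ⬝ᵥ (ridgeErrorMatrix (1 / √(lam * n)) X *ᵥ Sum.elim β ε) := by
  rw [estimationError, ridge_sub_eq_ridgeErrorMatrix_mulVec hlam hn, norm_toLp_sq]

lemma continuous_ridgeError (hlam : 0 < lam) (hn : 0 < n) (A : Matrix (Fin n) (Fin n) ℝ)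
    (B : Matrix (Fin d) (Fin d) ℝ) :
    Continuous fun x : (Fin n → Fin d → ℝ) × (Fin d → ℝ) × (Fin n → ℝ) =>
      ridgeError lam A B x.1 x.2.1 x.2.2 := by
  simp only [ridgeError, estimationError_ridge hlam hn, ridgeErrorMatrix, fromCols_mulVec_sumElim]
  have hX : Continuous fun x : (Fin n → Fin d → ℝ) × (Fin d → ℝ) × (Fin n → ℝ) =>
      (1 / √(lam * n)) • (A * Matrix.of x.1 * B) :=
    ((continuous_mul_of_mul A B).comp continuous_fst).const_smul (1 / √(lam * n))
  have hQ := continuous_gramResolvent.comp hX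
  have herror := (hQ.neg.matrix_mulVec (continuous_fst.comp continuous_snd)).add
    (((hQ.matrix_mul hX.matrix_transpose).const_smul (1 / √(lam * n))).matrix_mulVec
      (continuous_snd.comp continuous_snd))
  exact herror.dotProduct herror

/-- The law of the stacked vector of coefficients and noise. -/
noncomputable def stackedLaw (α σ : ℝ) (n d : ℕ) : Measure (Fin d ⊕ Fin n → ℝ) :=
  Measure.pi (Sum.elim (fun _ => gaussianReal 0 (Real.toNNReal (α ^ 2 / d)))
    fun _ => gaussianReal 0 (Real.toNNReal (σ ^ 2)))

lemma measurePreserving_stackedLaw (α σ : ℝ) (n d : ℕ) :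
    MeasurePreserving (fun x : (Fin d → ℝ) × (Fin n → ℝ) => Sum.elim x.1 x.2)
      ((coefficientLaw α d).prod (noiseLaw σ n)) (stackedLaw α σ n d) :=
  measurePreserving_sumElim _ _

lemma isCenteredFourth_sumElim (α σ : ℝ) (n d : ℕ) (i : Fin d ⊕ Fin n) :
    IsCenteredFourth
      (Sum.elim (fun _ : Fin d => gaussianReal 0 (Real.toNNReal (α ^ 2 / d)))
        (fun _ : Fin n => gaussianReal 0 (Real.toNNReal (σ ^ 2))) i)
      (Sum.elim (fun _ : Fin d => α ^ 2 / d) (fun _ : Fin n => σ ^ 2) i) gaussianFourth := by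
  rcases i with _ | _
  · have h := isCenteredFourth_gaussianReal (Real.toNNReal (α ^ 2 / d))
    rwa [Real.coe_toNNReal _ (by positivity)] at h
  · have h := isCenteredFourth_gaussianReal (Real.toNNReal (σ ^ 2))
    rwa [Real.coe_toNNReal _ (sq_nonneg σ)] at h

lemma memLp_estimationError_ridge (hlam : 0 < lam) (hn : 0 < n) (α σ : ℝ)
    (X : Matrix (Fin n) (Fin d) ℝ) :
    MemLp (fun x => estimationError (ridge lam X (X *ᵥ x.1 + x.2)) x.1) 2
      ((coefficientLaw α d).prod (noiseLaw σ n)) := by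
  simp only [estimationError_ridge hlam hn]
  exact (memLp_dotProduct_mulVec_self (isCenteredFourth_sumElim α σ n d) _).comp_measurePreserving
    (measurePreserving_stackedLaw α σ n d)

lemma integral_estimationError_ridge (hlam : 0 < lam) (hn : 0 < n) (α σ : ℝ)
    (X : Matrix (Fin n) (Fin d) ℝ) :
    ∫ x, estimationError (ridge lam X (X *ᵥ x.1 + x.2)) x.1
        ∂(coefficientLaw α d).prod (noiseLaw σ n)
      = conditionalRisk (α ^ 2 / d) (σ ^ 2 / (lam * n)) ((1 / √(lam * n)) • X) := by
  have hr : (1 / √(lam * n)) ^ 2 * σ ^ 2 = σ ^ 2 / (lam * n) := by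
    rw [div_pow, Real.sq_sqrt (by positivity), one_pow, one_div_mul_eq_div]
  simp only [estimationError_ridge hlam hn]
  rw [conditionalRisk, ← hr, ← ridgeErrorMatrix_mul_diagonal_mul_transpose,
    ← integral_dotProduct_mulVec_self (isCenteredFourth_sumElim α σ n d), ← stackedLaw,
    ← (measurePreserving_stackedLaw α σ n d).map_eq,
    integral_map (measurePreserving_stackedLaw α σ n d).aemeasurable]
  rw [(measurePreserving_stackedLaw α σ n d).map_eq]
  exact (memLp_dotProduct_mulVec_self (isCenteredFourth_sumElim α σ n d) _).1

open scoped Matrix.Norms.L2Operator in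
lemma variance_estimationError_ridge_le (hlam : 0 < lam) (hn : 0 < n) (α σ : ℝ)
    (X : Matrix (Fin n) (Fin d) ℝ) :
    Var[fun x => estimationError (ridge lam X (X *ᵥ x.1 + x.2)) x.1;
        (coefficientLaw α d).prod (noiseLaw σ n)]
      ≤ (2 * gaussianFourth + 4) * (d * (2 * (α ^ 2 / d + σ ^ 2 / (lam * n))) ^ 2) := by
  have hr : (1 / √(lam * n)) ^ 2 * σ ^ 2 = σ ^ 2 / (lam * n) := by
    rw [div_pow, Real.sq_sqrt (by positivity), one_pow, one_div_mul_eq_div]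
  have hK := gaussianFourth_nonneg
  have hmemLp := memLp_dotProduct_mulVec_self (isCenteredFourth_sumElim α σ n d)
    (ridgeErrorMatrix (1 / √(lam * n)) X)
  have hvariance := variance_dotProduct_mulVec_self_le (isCenteredFourth_sumElim α σ n d) hK
    (ridgeErrorMatrix (1 / √(lam * n)) X)
  simp only [estimationError_ridge hlam hn]
  rw [← stackedLaw] at hmemLp hvariance
  rw [(measurePreserving_stackedLaw α σ n d).variance_fun_comp hmemLp.1.aemeasurable]
  refine hvariance.trans ?_
  rw [ridgeErrorMatrix_mul_diagonal_mul_transpose, hr, Fintype.card_fin]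
  gcongr
  exact norm_ridgeErrorCovariance_le (by positivity) (by positivity) _

end ConditionalRisk

section RiskSurrogate

open Matrix

variable {m p : Type*} [Fintype m] [Fintype p] [DecidableEq p]

lemma gramResolvent_sub_gramResolvent_sqrt_smul (Y : Matrix m p ℝ) {t : ℝ} (ht : 0 ≤ t) :
    gramResolvent Y - gramResolvent (√(1 + t) • Y)
      = t • ((1 - gramResolvent Y) * gramResolvent (√(1 + t) • Y)) := by
  set Q := gramResolvent Y
  set Q' := gramResolvent (√(1 + t) • Y)
  have hQ' : (1 + Yᵀ * Y + t • (Yᵀ * Y)) * Q' = 1 := by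
    have hone := one_add_gram_mul_gramResolvent (√(1 + t) • Y)
    rwa [transpose_smul, Matrix.smul_mul, Matrix.mul_smul, smul_smul,
      Real.mul_self_sqrt (by linarith), add_smul, one_smul, ← add_assoc] at hone
  calc Q - Q' = Q * ((1 + Yᵀ * Y + t • (Yᵀ * Y)) * Q') - Q * (1 + Yᵀ * Y) * Q' := by
        rw [hQ', gramResolvent_mul_one_add_gram, Matrix.mul_one, Matrix.one_mul]
    _ = t • (Q * (Yᵀ * Y) * Q') := by
        rw [Matrix.add_mul, Matrix.mul_add, Matrix.mul_assoc Q (1 + _), add_sub_cancel_left,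
          Matrix.smul_mul, Matrix.mul_smul, Matrix.mul_assoc Q (Yᵀ * Y)]
    _ = t • ((1 - Q) * Q') := by rw [gramResolvent_mul_gram]

open scoped Matrix.Norms.L2Operator in
lemma abs_trace_gramResolvent_sub_sqrt_smul_sub_le (Y : Matrix m p ℝ) {t : ℝ} (ht : 0 ≤ t) :
    |(gramResolvent Y).trace - (gramResolvent (√(1 + t) • Y)).trace
        - t * (gramResolvent Y - gramResolvent Y * gramResolvent Y).trace|
      ≤ 4 * t ^ 2 * Fintype.card p := by
  have hdiff := gramResolvent_sub_gramResolvent_sqrt_smul Y ht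
  set Q := gramResolvent Y
  set Q' := gramResolvent (√(1 + t) • Y)
  have hsecond : Q - Q' - t • (Q - Q * Q) = -(t ^ 2 • ((1 - Q) * ((1 - Q) * Q'))) := by
    have hfactor : Q - Q * Q = (1 - Q) * Q := by rw [Matrix.sub_mul, Matrix.one_mul]
    rw [hfactor, hdiff, ← smul_sub, ← Matrix.mul_sub, ← neg_sub Q Q', hdiff, Matrix.mul_neg,
      Matrix.mul_smul, smul_neg, smul_smul, sq]
  have hone : ‖1 - Q‖ ≤ 2 := by
    have hone : ‖(1 : Matrix p p ℝ)‖ ≤ 1 := l2_opNorm_le_one_of_transpose_mul_self (by simp)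
    linarith [norm_sub_le (1 : Matrix p p ℝ) Q, norm_gramResolvent_le_one Y]
  have hnorm : ‖(1 - Q) * ((1 - Q) * Q')‖ ≤ 2 * (2 * 1) :=
    l2_opNorm_mul_le_of_le hone (l2_opNorm_mul_le_of_le hone (norm_gramResolvent_le_one _))
  calc |Q.trace - Q'.trace - t * (Q - Q * Q).trace|
      = |t ^ 2 * ((1 - Q) * ((1 - Q) * Q')).trace| := by
        have htrace := congrArg trace hsecond
        rw [trace_sub, trace_sub, trace_neg, trace_smul, trace_smul, smul_eq_mul,
          smul_eq_mul] at htrace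
        rw [htrace, abs_neg]
    _ ≤ t ^ 2 * (Fintype.card p * (2 * (2 * 1))) := by
        rw [abs_mul, abs_of_nonneg (sq_nonneg t)]
        gcongr
        exact (abs_trace_le_card_mul_l2_opNorm _).trans (by gcongr)
    _ = 4 * t ^ 2 * Fintype.card p := by ring

/-- The approximation of `conditionalRisk w w' Y` in which the trace of the squared resolvent is
replaced by a difference quotient with step `h`, so that only resolvent traces occur. -/
noncomputable def riskSurrogate (w w' h : ℝ) (Y : Matrix m p ℝ) : ℝ :=
  (w + (w' - w) / h) * (gramResolvent Y).trace
    - (w' - w) / h * (gramResolvent (√(1 + h) • Y)).trace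

variable {w w' h : ℝ}

lemma abs_sub_le_add (hw : 0 ≤ w) (hw' : 0 ≤ w') : |w' - w| ≤ w + w' := by
  rw [abs_le]
  constructor <;> linarith

lemma abs_conditionalRisk_sub_riskSurrogate_le (hw : 0 ≤ w) (hw' : 0 ≤ w') (hh : 0 < h)
    (Y : Matrix m p ℝ) :
    |conditionalRisk w w' Y - riskSurrogate w w' h Y| ≤ 4 * h * Fintype.card p * (w + w') := by
  have hdiff := abs_trace_gramResolvent_sub_sqrt_smul_sub_le Y hh.le
  have hsplit : conditionalRisk w w' Y - riskSurrogate w w' h Y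
      = -((w' - w) / h) * ((gramResolvent Y).trace - (gramResolvent (√(1 + h) • Y)).trace
        - h * (gramResolvent Y - gramResolvent Y * gramResolvent Y).trace) := by
    simp only [conditionalRisk, ridgeErrorCovariance, riskSurrogate, trace_add, trace_smul,
      trace_sub, smul_eq_mul]
    field_simp
    ring
  rw [hsplit, abs_mul, abs_neg, abs_div, abs_of_pos hh]
  calc |w' - w| / h * _ ≤ (w + w') / h * (4 * h ^ 2 * Fintype.card p) := by
        gcongr
        exact abs_sub_le_add hw hw'
    _ = 4 * h * Fintype.card p * (w + w') := by field_simp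

lemma abs_linear_combination_le (hw : 0 ≤ w) (hw' : 0 ≤ w') (hh : 0 < h) {x y t : ℝ}
    (hx : |x| ≤ t) (hy : |y| ≤ t) :
    |(w + (w' - w) / h) * x - (w' - w) / h * y| ≤ (w + w') * (1 + 2 / h) * t := by
  have hquot : |(w' - w) / h| ≤ (w + w') / h := by
    rw [abs_div, abs_of_pos hh]
    gcongr
    exact abs_sub_le_add hw hw'
  calc |(w + (w' - w) / h) * x - (w' - w) / h * y|
      ≤ |w + (w' - w) / h| * |x| + |(w' - w) / h| * |y| := by
        rw [← abs_mul, ← abs_mul]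
        exact abs_sub _ _
    _ ≤ (w + w' + (w + w') / h) * t + (w + w') / h * t := by
        gcongr
        refine (abs_add_le _ _).trans (add_le_add ?_ hquot)
        rw [abs_of_nonneg hw]
        linarith
    _ = (w + w') * (1 + 2 / h) * t := by ring

end RiskSurrogate

section Standardization

open Matrix

lemma exists_isStandardized_map {D : Measure ℝ} [IsProbabilityMeasure D]
    (h : MemLp (fun z : ℝ => z) 3 D) (hvar : Var[fun z : ℝ => z; D] ≠ 0) :
    ∃ M, IsStandardized (D.map fun z => (z - ∫ x, x ∂D) / √(Var[fun z : ℝ => z; D])) M := by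
  set μ := ∫ x, x ∂D with hμ
  set s := √(Var[fun z : ℝ => z; D]) with hs
  have hmeas : Measurable fun z : ℝ => (z - μ) / s := by fun_prop
  have hint : Integrable (fun z : ℝ => z) D := h.integrable (by norm_num)
  refine ⟨_, Measure.isProbabilityMeasure_map hmeas.aemeasurable, ?_, ?_, ?_, le_rfl⟩
  · rw [memLp_map_measure_iff (by fun_prop) hmeas.aemeasurable]
    simpa only [Function.comp_def, div_eq_inv_mul, Pi.sub_apply] using
      (h.sub (memLp_const μ)).const_mul s⁻¹
  · rw [integral_map hmeas.aemeasurable (by fun_prop), integral_div,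
      integral_sub hint (integrable_const _)]
    simp [hμ]
  · rw [integral_map hmeas.aemeasurable (by fun_prop)]
    simp only [div_pow]
    rw [integral_div, hs, Real.sq_sqrt (variance_nonneg _ _), hμ,
      ← variance_eq_integral hint.aemeasurable, div_self hvar]

lemma eq_dirac_of_variance_eq_zero {D : Measure ℝ} [IsProbabilityMeasure D]
    (h : MemLp (fun z : ℝ => z) 2 D) (hvar : Var[fun z : ℝ => z; D] = 0) :
    D = Measure.dirac (∫ x, x ∂D) := by
  have hmap : D.map (fun z : ℝ => z) = D := Measure.map_id
  rw [Measure.map_congr (ae_eq_integral_of_variance_eq_zero h hvar), Measure.map_const] at hmap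
  simpa using hmap.symm

lemma IsSubGaussianLaw.memLp {D : Measure ℝ} [IsProbabilityMeasure D] (h : IsSubGaussianLaw D)
    (p : NNReal) : MemLp (fun z : ℝ => z) p D := by
  obtain ⟨c, hc⟩ := h
  simpa [Pi.add_def] using (hc.memLp p).add (memLp_const (∫ x, x ∂D))

variable {m p : Type*} [Fintype m] [Fintype p]

lemma sandwich_smul_left (s κ : ℝ) (A : Matrix m m ℝ) (B : Matrix p p ℝ) :
    sandwich s (κ • A) B = sandwich (s * κ) A B := by
  ext1 x
  simp only [sandwich, Matrix.smul_mul, smul_smul]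

lemma sandwich_eq_add_vecMulVec (s : ℝ) (A : Matrix m m ℝ) (B : Matrix p p ℝ) (b : ℝ) {a : ℝ}
    (ha : a ≠ 0) (x : m × p → ℝ) :
    sandwich s A B x = sandwich (s * a) A B (fun k => (x k - b) / a)
      + vecMulVec (s • (A *ᵥ fun _ => b)) ((fun _ => 1) ᵥ* B) := by
  have hentries : (of fun i j => x (i, j) : Matrix m p ℝ)
      = a • of (fun i j => (x (i, j) - b) / a) + vecMulVec (fun _ => b) fun _ => 1 := by
    ext i j
    simp [vecMulVec_apply, mul_div_cancel₀ _ ha]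
  rw [sandwich, hentries, sandwich, Matrix.mul_add, Matrix.add_mul, smul_add, mul_vecMulVec,
    vecMulVec_mul, smul_vecMulVec, Matrix.mul_smul, Matrix.smul_mul, smul_smul]

/-- Recentring the entries is a rank-one perturbation of the matrix. -/
lemma abs_meanResolventTrace_sub_map_le [DecidableEq p] (D : Measure ℝ) [IsProbabilityMeasure D]
    (s : ℝ) (A : Matrix m m ℝ) (B : Matrix p p ℝ) (b : ℝ) {a : ℝ} (ha : a ≠ 0) :
    |meanResolventTrace D s A B
      - meanResolventTrace (D.map fun z => (z - b) / a) (s * a) A B| ≤ 1 := by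
  have hmeas : Measurable fun z : ℝ => (z - b) / a := by fun_prop
  have : IsProbabilityMeasure (D.map fun z => (z - b) / a) :=
    Measure.isProbabilityMeasure_map hmeas.aemeasurable
  have hmap : MeasurePreserving (fun (x : m × p → ℝ) k => (x k - b) / a)
      (Measure.pi fun _ => D) (Measure.pi fun _ => D.map fun z => (z - b) / a) :=
    measurePreserving_pi _ _ fun _ => ⟨hmeas, rfl⟩
  have hint := integrable_trace_gramResolvent_sandwich
    (μ := Measure.pi fun _ : m × p => D.map fun z => (z - b) / a) (s * a) A B
  have hint_comp : Integrable
      (fun x => (gramResolvent (sandwich (s * a) A B fun k => (x k - b) / a)).trace)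
      (Measure.pi fun _ => D) := hmap.integrable_comp_of_integrable hint
  rw [meanResolventTrace, meanResolventTrace, ← hmap.map_eq,
    integral_map hmap.aemeasurable (hmap.map_eq ▸ hint.1),
    ← integral_sub (integrable_trace_gramResolvent_sandwich s A B) hint_comp]
  refine abs_integral_le_of_forall_abs_le fun x => ?_
  rw [sandwich_eq_add_vecMulVec s A B b ha x]
  exact abs_trace_gramResolvent_add_vecMulVec_sub_le _ _ _

variable {D₁ D₂ : Measure ℝ} [IsProbabilityMeasure D₁] [IsProbabilityMeasure D₂]

lemma abs_meanResolventTrace_sub_le_of_isStandardized_map [DecidableEq p] {b s M L N c : ℝ}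
    (hs : s ≠ 0) (h₁ : IsStandardized (D₁.map fun z => (z - b) / s) M)
    (h₂ : IsStandardized (D₂.map fun z => (z - b) / s) M) (A : Matrix m m ℝ) (B : Matrix p p ℝ)
    (hL : 1 ≤ L) (hN : 1 ≤ N) (hc : 0 ≤ c) (hm : Fintype.card m ≤ c * N)
    (hp : Fintype.card p ≤ c * N) :
    |meanResolventTrace D₁ 1 A B - meanResolventTrace D₂ 1 A B| ≤ comparisonError c M L N + 2 := by
  have hscale (ν : Measure ℝ) : meanResolventTrace ν (1 * s) A B
      = meanResolventTrace ν (1 / √N) ((√N * s) • A) B := by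
    have hsqrt : 0 < √N := Real.sqrt_pos.mpr (by linarith)
    rw [meanResolventTrace, meanResolventTrace, sandwich_smul_left, ← mul_assoc,
      one_div_mul_cancel hsqrt.ne']
  have hcomparison := h₁.abs_meanResolventTrace_sub_le h₂ ((√N * s) • A) B hL hN hc hm hp
  rw [← hscale, ← hscale] at hcomparison
  have hcentre₁ := abs_meanResolventTrace_sub_map_le D₁ 1 A B b hs
  have hcentre₂ := abs_meanResolventTrace_sub_map_le D₂ 1 A B b hs
  rw [abs_le] at *
  constructor <;> linarith

theorem eventually_abs_meanResolventTrace_sub_le (h₁ : MemLp (fun z : ℝ => z) 3 D₁)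
    (h₂ : MemLp (fun z : ℝ => z) 3 D₂) (hmean : ∫ z, z ∂D₁ = ∫ z, z ∂D₂)
    (hvar : Var[fun z : ℝ => z; D₁] = Var[fun z : ℝ => z; D₂]) (c : ℝ) {ε : ℝ} (hε : 0 < ε) :
    ∀ᶠ n : ℕ in atTop, ∀ d : ℕ, (d : ℝ) ≤ c * n →
      ∀ (A : Matrix (Fin n) (Fin n) ℝ) (B : Matrix (Fin d) (Fin d) ℝ),
        |meanResolventTrace D₁ 1 A B - meanResolventTrace D₂ 1 A B| ≤ ε * n := by
  rcases eq_or_ne (Var[fun z : ℝ => z; D₁]) 0 with hzero | hpos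
  · have hD : D₁ = D₂ := by
      rw [eq_dirac_of_variance_eq_zero (h₁.mono_exponent (by norm_num)) hzero, hmean,
        ← eq_dirac_of_variance_eq_zero (h₂.mono_exponent (by norm_num)) (hvar ▸ hzero)]
    refine Eventually.of_forall fun n d _ A B => ?_
    rw [hD, sub_self, abs_zero]
    positivity
  · obtain ⟨M₁, hM₁⟩ := exists_isStandardized_map h₁ hpos
    obtain ⟨M₂, hM₂⟩ := exists_isStandardized_map h₂ (hvar ▸ hpos)
    rw [← hmean, ← hvar] at hM₂
    obtain ⟨L, hL, hlim⟩ :=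
      exists_forall_eventually_comparisonError_le (max c 1) (max M₁ M₂) (half_pos hε)
    filter_upwards [tendsto_natCast_atTop_atTop.eventually hlim,
      tendsto_natCast_atTop_atTop.eventually_ge_atTop (4 / ε), eventually_ge_atTop 1]
      with n hcomparison hn hn1 d hd A B
    have hn1 : (1 : ℝ) ≤ n := by exact_mod_cast hn1
    have hbound := abs_meanResolventTrace_sub_le_of_isStandardized_map
      (Real.sqrt_ne_zero'.mpr ((variance_nonneg _ _).lt_of_ne' hpos))
      (hM₁.mono (le_max_left M₁ M₂)) (hM₂.mono (le_max_right M₁ M₂)) A B hL hn1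
      (zero_le_one.trans (le_max_right c 1))
      (by simpa using le_mul_of_one_le_left n.cast_nonneg (le_max_right c 1))
      (by simpa using hd.trans (mul_le_mul_of_nonneg_right (le_max_left c 1) n.cast_nonneg))
    rw [div_le_iff₀ hε] at hn
    linarith

lemma measurePreserving_uncurry_iidMatrixLaw (D : Measure ℝ) [IsProbabilityMeasure D] (n d : ℕ) :
    MeasurePreserving (fun (W : Fin n → Fin d → ℝ) (k : Fin n × Fin d) => W k.1 k.2)
      (iidMatrixLaw D n d) (Measure.pi fun _ => D) := by
  refine ⟨(MeasurableEquiv.curry (Fin n) (Fin d) ℝ).symm.measurable, ?_⟩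
  have hmap := Measure.infinitePi_map_curry_symm fun (_ : Fin n) (_ : Fin d) => D
  simp only [Measure.infinitePi_eq_pi] at hmap
  exact hmap

lemma integral_trace_gramResolvent_iidMatrixLaw (D : Measure ℝ) [IsProbabilityMeasure D] {n d : ℕ}
    (A : Matrix (Fin n) (Fin n) ℝ) (B : Matrix (Fin d) (Fin d) ℝ) :
    ∫ W, (gramResolvent (A * of W * B)).trace ∂iidMatrixLaw D n d = meanResolventTrace D 1 A B := by
  have hmap := measurePreserving_uncurry_iidMatrixLaw D n d
  have hint := integrable_trace_gramResolvent_sandwich (μ := Measure.pi fun _ => D) 1 A B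
  rw [meanResolventTrace, ← hmap.map_eq, integral_map hmap.aemeasurable (hmap.map_eq ▸ hint.1)]
  simp only [sandwich, one_smul]

end Standardization

section Concentration

open Matrix

lemma measure_prod_le_of_forall_section_le {α β : Type*} [MeasurableSpace α] [MeasurableSpace β]
    {μ : Measure α} {ρ : Measure β} [IsProbabilityMeasure μ] [SFinite ρ] {s : Set (α × β)}
    (hs : MeasurableSet s) {ε : ENNReal} (hε : ∀ a, ρ (Prod.mk a ⁻¹' s) ≤ ε) :
    μ.prod ρ s ≤ ε := by
  rw [Measure.prod_apply hs]
  simpa using lintegral_mono (μ := μ) hε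

lemma measure_prod_three_mul_le_abs_sub_le {α β : Type*} [MeasurableSpace α] [MeasurableSpace β]
    {μ : Measure α} {ρ : Measure β} [IsProbabilityMeasure μ] [IsProbabilityMeasure ρ]
    {f : α × β → ℝ} {F : α → ℝ} {δ v v' : ℝ} (hδ : 0 < δ) (hf : Measurable f)
    (hfL2 : ∀ a, MemLp (fun b => f (a, b)) 2 ρ) (hfv : ∀ a, Var[fun b => f (a, b); ρ] ≤ v)
    (hF : Measurable F) (hFL2 : MemLp F 2 μ) (hFv : Var[F; μ] ≤ v')
    (hfF : ∀ a, |∫ b, f (a, b) ∂ρ - F a| ≤ δ) :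
    μ.prod ρ {x | 3 * δ ≤ |f x - ∫ a, F a ∂μ|}
      ≤ ENNReal.ofReal (v / δ ^ 2) + ENNReal.ofReal (v' / δ ^ 2) := by
  set s := {x : α × β | δ ≤ |f x - ∫ b, f (x.1, b) ∂ρ|}
  set s' := {a : α | δ ≤ |F a - ∫ a, F a ∂μ|}
  have hs : MeasurableSet s := by
    have hmean : Measurable fun a => ∫ b, f (a, b) ∂ρ :=
      hf.stronglyMeasurable.integral_prod_right'.measurable
    exact measurableSet_le measurable_const (hf.sub (hmean.comp measurable_fst)).norm
  have hs' : MeasurableSet s' := measurableSet_le measurable_const (hF.sub_const _).norm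
  have hcover : {x | 3 * δ ≤ |f x - ∫ a, F a ∂μ|} ⊆ s ∪ Prod.fst ⁻¹' s' := by
    intro x hx
    by_contra! hout
    simp only [Set.mem_union, not_or, s, s', Set.mem_preimage, Set.mem_ofPred_eq, not_le] at hout hx
    have htriangle := abs_add_three (f x - ∫ b, f (x.1, b) ∂ρ) (∫ b, f (x.1, b) ∂ρ - F x.1)
      (F x.1 - ∫ a, F a ∂μ)
    rw [sub_add_sub_cancel, sub_add_sub_cancel] at htriangle
    linarith [hfF x.1]
  refine (measure_mono hcover).trans ((measure_union_le _ _).trans (add_le_add ?_ ?_))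
  · refine measure_prod_le_of_forall_section_le hs fun a => ?_
    refine (meas_ge_le_variance_div_sq (hfL2 a) hδ).trans (ENNReal.ofReal_le_ofReal ?_)
    gcongr
    exact hfv a
  · rw [measurePreserving_fst.measure_preimage hs'.nullMeasurableSet]
    refine (meas_ge_le_variance_div_sq hFL2 hδ).trans (ENNReal.ofReal_le_ofReal ?_)
    gcongr

lemma of_update_eq_add_vecMulVec {m p α : Type*} [NonAssocRing α] [DecidableEq m] (W : m → p → α)
    (i : m) (y : p → α) :
    of (Function.update W i y) = of W + vecMulVec (Pi.single i 1) (y - W i) := by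
  ext a b
  rcases eq_or_ne a i with rfl | hai
  · simp [vecMulVec_apply]
  · simp [vecMulVec_apply, hai]

section Surrogate

variable {m p : Type*} [Fintype m] [Fintype p] [DecidableEq p] {w w' h : ℝ}

lemma abs_trace_gramResolvent_update_sub_le [DecidableEq m] (A : Matrix m m ℝ) (B : Matrix p p ℝ)
    (W : m → p → ℝ) (i : m) (y : p → ℝ) :
    |(gramResolvent (A * of (Function.update W i y) * B)).trace
      - (gramResolvent (A * of W * B)).trace| ≤ 1 := by
  rw [of_update_eq_add_vecMulVec, Matrix.mul_add, Matrix.add_mul, mul_vecMulVec, vecMulVec_mul]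
  exact abs_trace_gramResolvent_add_vecMulVec_sub_le _ _ _

lemma continuous_riskSurrogate :
    Continuous fun Y : Matrix m p ℝ => riskSurrogate w w' h Y :=
  (continuous_const.mul continuous_gramResolvent.matrix_trace).sub
    (continuous_const.mul
      (continuous_gramResolvent.comp (continuous_const_smul _)).matrix_trace)

lemma measurable_riskSurrogate_mul (A : Matrix m m ℝ) (B : Matrix p p ℝ) :
    Measurable fun W : m → p → ℝ => riskSurrogate w w' h (A * of W * B) :=
  (continuous_riskSurrogate.comp (continuous_mul_of_mul A B)).measurable

lemma abs_riskSurrogate_le (hw : 0 ≤ w) (hw' : 0 ≤ w') (hh : 0 < h) (Y : Matrix m p ℝ) :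
    |riskSurrogate w w' h Y| ≤ (w + w') * (1 + 2 / h) * Fintype.card p :=
  abs_linear_combination_le hw hw' hh (abs_trace_gramResolvent_le _)
    (abs_trace_gramResolvent_le _)

lemma abs_riskSurrogate_update_sub_le [DecidableEq m] (hw : 0 ≤ w) (hw' : 0 ≤ w') (hh : 0 < h)
    (A : Matrix m m ℝ) (B : Matrix p p ℝ) (W : m → p → ℝ) (i : m) (y : p → ℝ) :
    |riskSurrogate w w' h (A * of (Function.update W i y) * B)
      - riskSurrogate w w' h (A * of W * B)| ≤ (w + w') * (1 + 2 / h) := by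
  have hbound := abs_linear_combination_le hw hw' hh
    (abs_trace_gramResolvent_update_sub_le A B W i y)
    (abs_trace_gramResolvent_update_sub_le (√(1 + h) • A) B W i y)
  rw [mul_one] at hbound
  convert hbound using 2
  simp only [riskSurrogate, Matrix.smul_mul]
  ring

lemma variance_riskSurrogate_le (hw : 0 ≤ w) (hw' : 0 ≤ w') (hh : 0 < h)
    (A : Matrix m m ℝ) (B : Matrix p p ℝ) (μ : m → Measure (p → ℝ))
    [∀ i, IsProbabilityMeasure (μ i)] :
    Var[fun W => riskSurrogate w w' h (A * of W * B); Measure.pi μ]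
      ≤ Fintype.card m * ((w + w') * (1 + 2 / h)) ^ 2 := by
  classical
  have hvariance := variance_pi_le_sum_sq μ (measurable_riskSurrogate_mul A B)
    (fun _ => abs_riskSurrogate_le hw hw' hh _) (abs_riskSurrogate_update_sub_le hw hw' hh A B)
  simpa using hvariance

end Surrogate

variable {n d : ℕ} {lam : ℝ}

/-- The mean of the surrogate of the conditional risk when the entries of the random matrix have
law `D`: the deterministic quantity around which the ridge estimation error concentrates. -/
noncomputable def meanSurrogate (lam α σ h : ℝ) (D : Measure ℝ) (A : Matrix (Fin n) (Fin n) ℝ)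
    (B : Matrix (Fin d) (Fin d) ℝ) : ℝ :=
  ∫ W, riskSurrogate (α ^ 2 / d) (σ ^ 2 / (lam * n)) h (((1 / √(lam * n)) • A) * of W * B)
    ∂iidMatrixLaw D n d

lemma modelLaw_three_mul_le_abs_sub_le (hlam : 0 < lam) (hn : 0 < n) (α σ : ℝ) (D : Measure ℝ)
    [IsProbabilityMeasure D] (A : Matrix (Fin n) (Fin n) ℝ) (B : Matrix (Fin d) (Fin d) ℝ)
    {h δ : ℝ} (hh : 0 < h) (hδ : 0 < δ)
    (hhδ : 4 * h * d * (α ^ 2 / d + σ ^ 2 / (lam * n)) ≤ δ) :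
    modelLaw D α σ n d
        {x | 3 * δ ≤ |ridgeError lam A B x.1 x.2.1 x.2.2 - meanSurrogate lam α σ h D A B|}
      ≤ ENNReal.ofReal ((2 * gaussianFourth + 4)
          * (d * (2 * (α ^ 2 / d + σ ^ 2 / (lam * n))) ^ 2) / δ ^ 2)
        + ENNReal.ofReal
          (n * ((α ^ 2 / d + σ ^ 2 / (lam * n)) * (1 + 2 / h)) ^ 2 / δ ^ 2) := by
  have : IsProbabilityMeasure ((coefficientLaw α d).prod (noiseLaw σ n)) := by
    unfold coefficientLaw noiseLaw
    infer_instance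
  have : IsProbabilityMeasure (iidMatrixLaw D n d) := by
    unfold iidMatrixLaw
    infer_instance
  have hw : 0 ≤ α ^ 2 / (d : ℝ) := by positivity
  have hw' : 0 ≤ σ ^ 2 / (lam * n) := by positivity
  have hF := measurable_riskSurrogate_mul (w := α ^ 2 / d) (w' := σ ^ 2 / (lam * n)) (h := h)
    ((1 / √(lam * n)) • A) B
  have hFv := variance_riskSurrogate_le hw hw' hh ((1 / √(lam * n)) • A) B
    fun _ => Measure.pi fun _ => D
  rw [Fintype.card_fin] at hFv
  refine measure_prod_three_mul_le_abs_sub_le hδ (continuous_ridgeError hlam hn A B).measurable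
    (fun W => memLp_estimationError_ridge hlam hn α σ (A * of W * B))
    (fun W => variance_estimationError_ridge_le hlam hn α σ (A * of W * B)) hF
    (memLp_of_measurable_of_abs_le hF fun _ => abs_riskSurrogate_le hw hw' hh _) hFv fun W => ?_
  have hrisk := abs_conditionalRisk_sub_riskSurrogate_le hw hw' hh
    ((1 / √(lam * n)) • (A * of W * B))
  rw [← integral_estimationError_ridge hlam hn, Fintype.card_fin] at hrisk
  rw [Matrix.smul_mul, Matrix.smul_mul]
  exact hrisk.trans hhδ

lemma integral_riskSurrogate (w w' h : ℝ) (D : Measure ℝ) [IsProbabilityMeasure D]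
    (A : Matrix (Fin n) (Fin n) ℝ) (B : Matrix (Fin d) (Fin d) ℝ) :
    ∫ W, riskSurrogate w w' h (A * of W * B) ∂iidMatrixLaw D n d
      = (w + (w' - w) / h) * meanResolventTrace D 1 A B
        - (w' - w) / h * meanResolventTrace D 1 (√(1 + h) • A) B := by
  have : IsProbabilityMeasure (iidMatrixLaw D n d) := by
    unfold iidMatrixLaw
    infer_instance
  have hint (A : Matrix (Fin n) (Fin n) ℝ) :
      Integrable (fun W => (gramResolvent (A * of W * B)).trace) (iidMatrixLaw D n d) :=
    integrable_of_measurable_of_abs_le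
      (continuous_gramResolvent.comp (continuous_mul_of_mul A B)).matrix_trace.measurable
      fun _ => abs_trace_gramResolvent_le _
  simp only [riskSurrogate, ← Matrix.smul_mul]
  rw [integral_sub ((hint _).const_mul _) ((hint _).const_mul _), integral_const_mul,
    integral_const_mul, integral_trace_gramResolvent_iidMatrixLaw,
    integral_trace_gramResolvent_iidMatrixLaw]

lemma abs_meanSurrogate_sub_le (hlam : 0 < lam) (α σ : ℝ) {D₁ D₂ : Measure ℝ}
    [IsProbabilityMeasure D₁] [IsProbabilityMeasure D₂] {h t : ℝ} (hh : 0 < h)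
    (B : Matrix (Fin d) (Fin d) ℝ)
    (ht : ∀ A : Matrix (Fin n) (Fin n) ℝ,
      |meanResolventTrace D₁ 1 A B - meanResolventTrace D₂ 1 A B| ≤ t)
    (A : Matrix (Fin n) (Fin n) ℝ) :
    |meanSurrogate lam α σ h D₁ A B - meanSurrogate lam α σ h D₂ A B|
      ≤ (α ^ 2 / d + σ ^ 2 / (lam * n)) * (1 + 2 / h) * t := by
  have hbound := abs_linear_combination_le (w := α ^ 2 / d) (w' := σ ^ 2 / (lam * n))
    (by positivity) (by positivity) hh (ht ((1 / √(lam * n)) • A))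
    (ht (√(1 + h) • (1 / √(lam * n)) • A))
  rw [meanSurrogate, meanSurrogate, integral_riskSurrogate, integral_riskSurrogate]
  convert hbound using 2
  ring

end Concentration

section Universality

variable {n d : ℕ} {lam α σ c : ℝ}

lemma add_div_le_div_natCast (hn : 0 < n) (hd : 0 < d) (hnd : (n : ℝ) ≤ c * d) :
    α ^ 2 / d + σ ^ 2 / (lam * n) ≤ (α ^ 2 * c + σ ^ 2 / lam) / n := by
  have hn' : (0 : ℝ) < n := by exact_mod_cast hn
  have hd' : (0 : ℝ) < d := by exact_mod_cast hd
  rw [add_div, div_div]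
  gcongr ?_ + _
  rw [div_le_div_iff₀ hd' hn', mul_assoc]
  gcongr

lemma exists_modelLaw_le_abs_sub_le_div_natCast (hlam : 0 < lam) (α σ : ℝ) (hc : 0 < c) {η : ℝ}
    (hη : 0 < η) :
    ∃ h > 0, ∃ C, ∀ (D : Measure ℝ) [IsProbabilityMeasure D] (n d : ℕ), 0 < n → 0 < d →
      (d : ℝ) ≤ c * n → (n : ℝ) ≤ c * d →
      ∀ (A : Matrix (Fin n) (Fin n) ℝ) (B : Matrix (Fin d) (Fin d) ℝ),
        modelLaw D α σ n d
          {x | η ≤ |ridgeError lam A B x.1 x.2.1 x.2.2 - meanSurrogate lam α σ h D A B|}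
          ≤ ENNReal.ofReal (C / n) := by
  obtain ⟨δ, rfl⟩ : ∃ δ, η = 3 * δ := ⟨η / 3, by ring⟩
  have hδ : 0 < δ := by linarith
  set C₁ := α ^ 2 * c + σ ^ 2 / lam
  have : 0 ≤ C₁ := by positivity
  obtain ⟨h, hh, hhδ⟩ : ∃ h : ℝ, 0 < h ∧ 4 * h * (c * C₁) ≤ δ := by
    refine ⟨δ / (4 * (c * C₁ + 1)), by positivity, ?_⟩
    rw [mul_comm 4, mul_assoc, div_mul_eq_mul_div, div_le_iff₀ (by positivity)]
    gcongr
    linarith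
  refine ⟨h, hh, (2 * gaussianFourth + 4) * (c * (2 * C₁) ^ 2) / δ ^ 2
    + (C₁ * (1 + 2 / h)) ^ 2 / δ ^ 2, fun D _ n d hn hd hdn hnd A B => ?_⟩
  have : (0 : ℝ) < n := by exact_mod_cast hn
  have hK := gaussianFourth_nonneg
  have hw : α ^ 2 / d + σ ^ 2 / (lam * n) ≤ C₁ / n := add_div_le_div_natCast hn hd hnd
  refine (modelLaw_three_mul_le_abs_sub_le hlam hn α σ D A B hh hδ ?_).trans ?_
  · calc 4 * h * d * (α ^ 2 / d + σ ^ 2 / (lam * n)) ≤ 4 * h * (c * n) * (C₁ / n) := by gcongr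
      _ = 4 * h * (c * C₁) := by field_simp
      _ ≤ δ := hhδ
  · rw [← ENNReal.ofReal_add (by positivity) (by positivity)]
    refine ENNReal.ofReal_le_ofReal ?_
    calc _ ≤ (2 * gaussianFourth + 4) * ((c * n) * (2 * (C₁ / n)) ^ 2) / δ ^ 2
          + n * (C₁ / n * (1 + 2 / h)) ^ 2 / δ ^ 2 := by gcongr
      _ = _ := by field_simp

variable {D₁ D₂ : Measure ℝ} [IsProbabilityMeasure D₁] [IsProbabilityMeasure D₂]

lemma eventually_abs_meanSurrogate_sub_le (h₁ : MemLp (fun z : ℝ => z) 3 D₁)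
    (h₂ : MemLp (fun z : ℝ => z) 3 D₂) (hmean : ∫ z, z ∂D₁ = ∫ z, z ∂D₂)
    (hvar : Var[fun z : ℝ => z; D₁] = Var[fun z : ℝ => z; D₂]) (hlam : 0 < lam) (α σ : ℝ)
    (hc : 0 < c) {h η : ℝ} (hh : 0 < h) (hη : 0 < η) :
    ∀ᶠ n : ℕ in atTop, ∀ d : ℕ, 0 < d → (d : ℝ) ≤ c * n → (n : ℝ) ≤ c * d →
      ∀ (A : Matrix (Fin n) (Fin n) ℝ) (B : Matrix (Fin d) (Fin d) ℝ),
        |meanSurrogate lam α σ h D₁ A B - meanSurrogate lam α σ h D₂ A B| ≤ η := by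
  set C₁ := α ^ 2 * c + σ ^ 2 / lam
  have hC₁ : 0 ≤ C₁ := by positivity
  have hε : 0 < η / ((C₁ + 1) * (1 + 2 / h)) := by positivity
  filter_upwards [eventually_abs_meanResolventTrace_sub_le h₁ h₂ hmean hvar c hε,
    eventually_gt_atTop 0] with n htrace hn d hd hdn hnd A B
  have hn' : (0 : ℝ) < n := by exact_mod_cast hn
  calc |meanSurrogate lam α σ h D₁ A B - meanSurrogate lam α σ h D₂ A B|
      ≤ (α ^ 2 / d + σ ^ 2 / (lam * n)) * (1 + 2 / h) * (η / ((C₁ + 1) * (1 + 2 / h)) * n) :=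
        abs_meanSurrogate_sub_le hlam α σ hh B (fun A => htrace d hdn A B) A
    _ ≤ (C₁ + 1) / n * (1 + 2 / h) * (η / ((C₁ + 1) * (1 + 2 / h)) * n) := by
        gcongr
        refine (add_div_le_div_natCast hn hd hnd).trans (div_le_div_of_nonneg_right ?_ hn'.le)
        exact (lt_add_one C₁).le
    _ = η := by field_simp

lemma measure_preimage_le_of_hasLaw {Ω E : Type*} [MeasurableSpace Ω] [MeasurableSpace E]
    {X : Ω → E} {μ : Measure E} {P : Measure Ω} (hX : HasLaw X μ P) (s : Set E) :
    P (X ⁻¹' s) ≤ μ s :=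
  hX.map_eq ▸ Measure.le_map_apply hX.aemeasurable s

lemma one_sub_le_measure_abs_sub_le {Ω : Type*} [MeasurableSpace Ω] {P : Measure Ω}
    [IsProbabilityMeasure P] {X Y : Ω → ℝ} {x y t : ℝ} (hxy : |x - y| ≤ t) :
    1 - (P {ω | t ≤ |X ω - x|} + P {ω | t ≤ |Y ω - y|}) ≤ P {ω | |X ω - Y ω| ≤ 3 * t} := by
  have hcover : Set.univ ⊆ {ω | |X ω - Y ω| ≤ 3 * t}
      ∪ ({ω | t ≤ |X ω - x|} ∪ {ω | t ≤ |Y ω - y|}) := by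
    intro ω _
    by_contra! hout
    simp only [Set.mem_union, Set.mem_ofPred_eq, not_or, not_le] at hout
    have htriangle := abs_add_three (X ω - x) (x - y) (y - Y ω)
    rw [abs_sub_comm y, sub_add_sub_cancel, sub_add_sub_cancel] at htriangle
    linarith
  have hone := (measure_mono (μ := P) hcover).trans
    ((measure_union_le _ _).trans (add_le_add_right (measure_union_le _ _) _))
  rw [measure_univ] at hone
  exact tsub_le_iff_right.mpr hone

lemma exists_pos_eventually_le_mul_of_isTheta {ι : Type*} {l : Filter ι} {n d : ι → ℕ}
    (hn : Tendsto n l atTop) (hnd : (fun k => (d k : ℝ)) =Θ[l] fun k => (n k : ℝ)) :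
    ∃ c > (0 : ℝ), ∀ᶠ k in l,
      0 < n k ∧ 0 < d k ∧ (d k : ℝ) ≤ c * n k ∧ (n k : ℝ) ≤ c * d k := by
  obtain ⟨c₁, hc₁, hle⟩ := hnd.1.exists_pos
  obtain ⟨c₂, -, hge⟩ := hnd.2.exists_pos
  refine ⟨max c₁ c₂, lt_max_of_lt_left hc₁, ?_⟩
  filter_upwards [hn.eventually_gt_atTop 0, hle.bound, hge.bound] with k hnk hlek hgek
  simp only [Real.norm_natCast] at hlek hgek
  refine ⟨hnk, Nat.pos_of_ne_zero fun hdk => ?_,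
    hlek.trans (by gcongr; exact le_max_left _ _), hgek.trans (by gcongr; exact le_max_right _ _)⟩
  rw [hdk, Nat.cast_zero, mul_zero] at hgek
  exact hgek.not_gt (by exact_mod_cast hnk)

theorem theorem1_general
    (h₁ : MemLp (fun z : ℝ => z) 3 D₁) (h₂ : MemLp (fun z : ℝ => z) 3 D₂)
    (hmean : ∫ z, z ∂D₁ = ∫ z, z ∂D₂) (hvar : Var[fun z : ℝ => z; D₁] = Var[fun z : ℝ => z; D₂])
    (hlam : 0 < lam) (α σ : ℝ) {ι : Type*} {l : Filter ι} {n d : ι → ℕ} (hn : Tendsto n l atTop)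
    (hnd : (fun k => (d k : ℝ)) =Θ[l] fun k => (n k : ℝ))
    (A : ∀ k, Matrix (Fin (n k)) (Fin (n k)) ℝ) (B : ∀ k, Matrix (Fin (d k)) (Fin (d k)) ℝ)
    {Ω : ι → Type*} [∀ k, MeasurableSpace (Ω k)]
    (P : ∀ k, Measure (Ω k)) [∀ k, IsProbabilityMeasure (P k)]
    (Z G : ∀ k, Ω k → Fin (n k) → Fin (d k) → ℝ)
    (β : ∀ k, Ω k → Fin (d k) → ℝ) (ε : ∀ k, Ω k → Fin (n k) → ℝ)
    (hZ : ∀ k, HasLaw (fun ω => (Z k ω, β k ω, ε k ω)) (modelLaw D₁ α σ (n k) (d k)) (P k))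
    (hG : ∀ k, HasLaw (fun ω => (G k ω, β k ω, ε k ω)) (modelLaw D₂ α σ (n k) (d k)) (P k))
    {η : ℝ} (hη : 0 < η) :
    Tendsto (fun k => P k {ω | |ridgeError lam (A k) (B k) (Z k ω) (β k ω) (ε k ω)
      - ridgeError lam (A k) (B k) (G k ω) (β k ω) (ε k ω)| ≤ η}) l (𝓝 1) := by
  obtain ⟨t, rfl⟩ : ∃ t, η = 3 * t := ⟨η / 3, by ring⟩
  have ht : 0 < t := by linarith
  obtain ⟨c, hc, hproportional⟩ := exists_pos_eventually_le_mul_of_isTheta hn hnd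
  obtain ⟨h, hh, C, hconcentration⟩ := exists_modelLaw_le_abs_sub_le_div_natCast hlam α σ hc ht
  have hlim : Tendsto (fun k => 1 - (ENNReal.ofReal (C / n k) + ENNReal.ofReal (C / n k))) l
      (𝓝 1) := by
    have hvanish := ENNReal.tendsto_ofReal ((tendsto_const_div_atTop_nhds_zero_nat C).comp hn)
    simpa using ENNReal.Tendsto.sub tendsto_const_nhds (hvanish.add hvanish) (by simp)
  refine tendsto_of_tendsto_of_tendsto_of_le_of_le' hlim tendsto_const_nhds ?_
    (Eventually.of_forall fun k => prob_le_one)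
  filter_upwards [hproportional, hn.eventually
    (eventually_abs_meanSurrogate_sub_le h₁ h₂ hmean hvar hlam α σ hc hh ht)]
    with k ⟨hnk, hdk, hle, hge⟩ hmeans
  refine le_trans ?_ (one_sub_le_measure_abs_sub_le (hmeans (d k) hdk hle hge (A k) (B k)))
  gcongr
  · exact (measure_preimage_le_of_hasLaw (hZ k) _).trans
      (hconcentration D₁ (n k) (d k) hnk hdk hle hge (A k) (B k))
  · exact (measure_preimage_le_of_hasLaw (hG k) _).trans
      (hconcentration D₂ (n k) (d k) hnk hdk hle hge (A k) (B k))

end Universality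

section MatchingGaussian

variable {D : Measure ℝ}

instance : IsProbabilityMeasure (matchingGaussian D) := by
  unfold matchingGaussian
  infer_instance

lemma memLp_matchingGaussian (p : NNReal) : MemLp (fun z : ℝ => z) p (matchingGaussian D) :=
  memLp_id_gaussianReal p

lemma integral_matchingGaussian : ∫ z, z ∂matchingGaussian D = ∫ z, z ∂D :=
  integral_id_gaussianReal

lemma variance_matchingGaussian :
    Var[fun z : ℝ => z; matchingGaussian D] = Var[fun z : ℝ => z; D] :=
  variance_fun_id_gaussianReal.trans (Real.coe_toNNReal _ (variance_nonneg _ _))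

end MatchingGaussian

theorem theorem1
    -- law of the entries of `Z`
    (D : Measure ℝ) [IsProbabilityMeasure D] (hD : IsSubGaussianLaw D)
    -- ridge parameter, signal strength, noise level, limiting aspect ratio
    (lam α σ γ : ℝ) (hlam : 0 < lam) (hγ : 0 < γ)
    -- the proportional regime
    (n d : ℕ → ℕ) (hn : Tendsto n atTop atTop) (hd : Tendsto d atTop atTop)
    (hnd : Tendsto (fun k => (d k : ℝ) / (n k : ℝ)) atTop (𝓝 γ))
    -- deterministic dependency matrices
    (A : ∀ k, Matrix (Fin (n k)) (Fin (n k)) ℝ) (B : ∀ k, Matrix (Fin (d k)) (Fin (d k)) ℝ)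
    -- the random objects; the probability space may change with `k`
    {Ω : ℕ → Type*} [∀ k, MeasurableSpace (Ω k)]
    (P : ∀ k, Measure (Ω k)) [∀ k, IsProbabilityMeasure (P k)]
    (Z G : ∀ k, Ω k → Fin (n k) → Fin (d k) → ℝ)
    (β : ∀ k, Ω k → Fin (d k) → ℝ) (ε : ∀ k, Ω k → Fin (n k) → ℝ)
    (hZ : ∀ k, HasLaw (fun ω => (Z k ω, β k ω, ε k ω))
      (modelLaw D α σ (n k) (d k)) (P k))
    (hG : ∀ k, HasLaw (fun ω => (G k ω, β k ω, ε k ω))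
      (modelLaw (matchingGaussian D) α σ (n k) (d k)) (P k)) :
    ∀ η : ℝ, 0 < η →
      Tendsto
        (fun k => P k {ω | |ridgeError lam (A k) (B k) (Z k ω) (β k ω) (ε k ω)
          - ridgeError lam (A k) (B k) (G k ω) (β k ω) (ε k ω)| ≤ η})
        atTop (𝓝 1) :=
  fun _ hη => theorem1_general (hD.memLp 3) (memLp_matchingGaussian 3)
    integral_matchingGaussian.symm variance_matchingGaussian.symm hlam α σ hn
    (Asymptotics.isTheta_of_div_tendsto_nhds_ne_zero hnd hγ.ne').symm A B P Z G β ε hZ hG hη
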